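/- Let $S$ be an oriented (Hausdorff) $C^\infty$-surface with (possibly empty) boundary $\partial S$. Let $X$ be a non-empty disjoint union of finitely many copies of $I=[0,1]$ and of the circle. A $C^\infty$-immersion $f\colon X\to S$ is *generic* if it has only transverse double points as its singularities, $f^{-1}(\partial S)=\partial X$, and $f|_{\partial X}$ is injective. A *generalized link diagram* on $S$ is a subset $D=f(X)$ of $S$, for such $X$ and generic $f$, together with a choice of over- and undercrossing at each double point. It is *oriented* if $X$ is oriented and $D$ inherits this orientation. Two diagrams are *regularly equivalent* if one is transformed into the other by a finite sequence of ambient isotopies of $S$ relative to $\partial S$ and of Reidemeister moves $R_2$, $R_3$ (and their inverses) performed in discs in $S$. Two oriented diagrams are *equivalent* if one is transformed into the other by a finite sequence of ambient isotopies relative to $\partial S$ and of moves $R_1,R_2,R_3$ (and their inverses), the orientations being carried along. At a crossing, the type A splitting merges the two regions swept out by the overcrossing arc when it is turned counterclockwise (with respect to the orientation of $S$) until it meets the undercrossing arc; the type B splitting merges the other two regions. A *state* $s$ of $D$ is a choice of splitting type for each crossing; let $\alpha(s)$ and $\beta(s)$ be the numbers of type A and type B splittings, and $\mu(s)$ the number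 of connected components of the compact $1$-manifold $D(s)$ obtained from $D$ by splitting every crossing according to $s$. The *bracket polynomial* is $$\langle D\rangle=\sum_{s}A^{\alpha(s)-\beta(s)}(-A^2-A^{-2})^{\mu(s)-1}\in\mathbb Z[A,A^{-1}].$$ For an oriented diagram $D$ let $w(D)$ be its writhe, the sum over all crossings of the sign $\varepsilon_p\in\{\pm1\}$, where $\varepsilon_p=1$ if and only if the tangent vectors of the over- and the undercrossing arc at $p$, in this order, form a positively oriented basis; the *Kauffman–Jones polynomial* is $L_D(A)=(-A)^{-3w(D)}\langle D\rangle$. Theorem. Let $D$ and $D'$ be generalized link diagrams on $S$. (1) If $D$ and $D'$ are regularly equivalent, then $\langle D\rangle=\langle D'\rangle$. (2) If $D$ and $D'$ are oriented and are equivalent as oriented diagrams, then $L_D(A)=L_{D'}(A)$. -/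

import Mathlib

open scoped Manifold ContDiff Topology

noncomputable section

namespace GenLink

/-! ### The source: a finite disjoint union of intervals and circles -/

/-- The compact 1-manifold `I ⊔ ⋯ ⊔ I ⊔ S¹ ⊔ ⋯ ⊔ S¹` with `m` copies of `I = [0,1]` and `n` copies
of the circle `S¹ = ℝ / ℤ`, with its standard topology and orientation. -/
abbrev OneManifold (m n : ℕ) : Type :=
  (Fin m × unitInterval) ⊕ (Fin n × AddCircle (1 : ℝ))

/-- Moving the point `x` by the parameter length `s` in the positive direction (in an interval the
movement stops at the end points). For fixed `x` this is a local parametrization around `x`. -/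
def shift {m n : ℕ} : OneManifold m n → ℝ → OneManifold m n
  | .inl (i, t), s => .inl (i, Set.projIcc 0 1 zero_le_one ((t : ℝ) + s))
  | .inr (i, z), s => .inr (i, z + (s : AddCircle (1 : ℝ)))

/-- The parameters `s` for which the movement `shift x s` is not stopped by an end point. -/
def shiftDom {m n : ℕ} : OneManifold m n → Set ℝ
  | .inl (_, t) => {s | (t : ℝ) + s ∈ Set.Icc (0 : ℝ) 1}
  | .inr _ => Set.univ

/-- The end points of the intervals. -/
def endPoints (m n : ℕ) : Set (OneManifold m n) :=
  {x | ∃ i, x = .inl (i, 0) ∨ x = .inl (i, 1)}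

/-- The filter of points approaching `x` from its positive side (`σ = 1`) or from its negative side
(`σ = -1`): this is one of the two half-branches at `x`. -/
def halfBranch {m n : ℕ} (x : OneManifold m n) (σ : ℤˣ) : Filter (OneManifold m n) :=
  Filter.map (fun s : ℝ => shift x (((σ : ℤ) : ℝ) * s)) (𝓝[>] 0)

/-! ### Oriented surfaces -/

section Surface

variable {S : Type*} [TopologicalSpace S] [ChartedSpace (EuclideanHalfSpace 2) S]

/-- The determinant of two vectors of the plane. -/
def det2 (v w : EuclideanSpace ℝ (Fin 2)) : ℝ := v 0 * w 1 - v 1 * w 0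

/-- An orientation of a smooth surface. Each tangent space is identified with `ℝ²` through the
preferred chart at its base point, and `sign p` tells whether the orientation at `p` is the standard
one or the opposite one; the orientation varies continuously, i.e. nearby orientations agree when
compared in one and the same chart. -/
structure SurfaceOrientation (S : Type*) [TopologicalSpace S]
    [ChartedSpace (EuclideanHalfSpace 2) S] [IsManifold (𝓡∂ 2) ∞ S] where
  sign : S → ℤˣ
  compatible : ∀ p : S, ∀ᶠ q in 𝓝 p,
    0 < ((sign p : ℤ) : ℝ) * ((sign q : ℤ) : ℝ) * (tangentCoordChange (𝓡∂ 2) q p q).det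

/-- `(v, w)` is a positively oriented basis of the tangent space at `p`. -/
def SurfaceOrientation.Positive [IsManifold (𝓡∂ 2) ∞ S] (o : SurfaceOrientation S) (p : S)
    (v w : EuclideanSpace ℝ (Fin 2)) : Prop :=
  0 < ((o.sign p : ℤ) : ℝ) * det2 v w

/-- The velocity of the parametrized curve `f` at `x`, a tangent vector of `S` at `f x`. -/
def velocity {m n : ℕ} (f : OneManifold m n → S) (x : OneManifold m n) :
    EuclideanSpace ℝ (Fin 2) :=
  mfderivWithin 𝓘(ℝ, ℝ) (𝓡∂ 2) (fun s : ℝ => f (shift x s)) (shiftDom x) 0 (1 : ℝ)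

/-! ### Diagrams -/

/-- A non-empty generalized link diagram on `S`, presented by a generic immersion `f` together with
a choice of crossing at each double point: of the two points `a ≠ b` with `f a = f b`, exactly one
lies in `overSet` (membership in `overSet` is irrelevant for the other points of the source).
With the standard orientation of the source, this also presents an oriented diagram. The diagram
itself is the image of `f` with the crossings; see `SameDiagram` and `SameOrientedDiagram`. -/
structure Diagram (S : Type*) [TopologicalSpace S] [ChartedSpace (EuclideanHalfSpace 2) S]
    (m n : ℕ) where
  f : OneManifold m n → S
  nonempty : 0 < m + n
  smooth : ∀ x, ContMDiffOn 𝓘(ℝ, ℝ) (𝓡∂ 2) ∞ (fun s : ℝ => f (shift x s)) (shiftDom x)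
  immersion : ∀ x, velocity f x ≠ 0
  double : ∀ a b c, f a = f b → f b = f c → a = b ∨ b = c ∨ a = c
  transverse : ∀ a b, a ≠ b → f a = f b → LinearIndependent ℝ ![velocity f a, velocity f b]
  preimage_boundary : f ⁻¹' (𝓡∂ 2).boundary S = endPoints m n
  injOn_boundary : Set.InjOn f (endPoints m n)
  overSet : Set (OneManifold m n)
  overSet_iff : ∀ a b, a ≠ b → f a = f b → (a ∈ overSet ↔ b ∉ overSet)

namespace Diagram

variable {m n m' n' : ℕ}

/-- The preimages of the double points. -/
def doubleSet (D : Diagram S m n) : Set (OneManifold m n) :=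
  {x | ∃ y, y ≠ x ∧ D.f y = D.f x}

/-- A crossing of `D`, given by its preimages: the one on the overcrossing arc and the one on the
undercrossing arc. -/
structure Crossing (D : Diagram S m n) where
  upper : OneManifold m n
  lower : OneManifold m n
  ne : upper ≠ lower
  eq : D.f upper = D.f lower
  upper_mem : upper ∈ D.overSet

/-- The two presentations give the same subset of `S` and the same crossings: at each double
point the overcrossing arcs, distinguished by their tangent lines, are the same. -/
def SameDiagram (D : Diagram S m n) (D' : Diagram S m' n') : Prop :=
  Set.range D.f = Set.range D'.f ∧
  ∀ x ∈ D.doubleSet, ∀ x', D.f x = D'.f x' →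
    ¬ LinearIndependent ℝ ![velocity D.f x, velocity D'.f x'] → (x ∈ D.overSet ↔ x' ∈ D'.overSet)

/-- The two presentations give the same diagram with the same orientation: wherever they pass
through the same point with the same tangent line, they do so in the same direction. -/
def SameOrientedDiagram (D : Diagram S m n) (D' : Diagram S m' n') : Prop :=
  D.SameDiagram D' ∧
  ∀ x x', D.f x = D'.f x' → ¬ LinearIndependent ℝ ![velocity D.f x, velocity D'.f x'] →
    SameRay ℝ (velocity D.f x) (velocity D'.f x')

end Diagram

/-! ### Ambient isotopies -/

/-- A smooth ambient isotopy `(H t)`, `0 ≤ t ≤ 1`, of `S` relative to the boundary of `S`. -/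
structure AmbientIsotopy (S : Type*) [TopologicalSpace S]
    [ChartedSpace (EuclideanHalfSpace 2) S] where
  H : ℝ → S → S
  smooth : ContMDiffOn (𝓘(ℝ, ℝ).prod (𝓡∂ 2)) (𝓡∂ 2) ∞ (fun q : ℝ × S => H q.1 q.2)
    (Set.Icc (0 : ℝ) 1 ×ˢ Set.univ)
  diffeo : ∀ t ∈ Set.Icc (0 : ℝ) 1, ∃ φ : S ≃ₘ^∞⟮𝓡∂ 2, 𝓡∂ 2⟯ S, ∀ p, φ p = H t p
  start : ∀ p, H 0 p = p
  fix_boundary : ∀ t ∈ Set.Icc (0 : ℝ) 1, ∀ p ∈ (𝓡∂ 2).boundary S, H t p = p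

/-- `D'` is the result of moving `D` by an ambient isotopy relative to the boundary. -/
def Isotopic {m n : ℕ} (D D' : Diagram S m n) : Prop :=
  ∃ h : AmbientIsotopy S, (∀ x, D'.f x = h.H 1 (D.f x)) ∧ D'.overSet = D.overSet

/-! ### Reidemeister moves -/

variable [IsManifold (𝓡∂ 2) ∞ S]

/-- An open disc in `S`, as an orientation preserving smooth open embedding of the plane. -/
structure OrientedDisc (o : SurfaceOrientation S) where
  ψ : ℝ × ℝ → S
  smooth : ContMDiff 𝓘(ℝ, ℝ × ℝ) (𝓡∂ 2) ∞ ψ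
  openEmbedding : Topology.IsOpenEmbedding ψ
  positive : ∀ p, o.Positive (ψ p) (mfderiv 𝓘(ℝ, ℝ × ℝ) (𝓡∂ 2) ψ p ((1, 0) : ℝ × ℝ))
    (mfderiv 𝓘(ℝ, ℝ × ℝ) (𝓡∂ 2) ψ p ((0, 1) : ℝ × ℝ))

/-- The square in which the Reidemeister moves are drawn. -/
def square : Set (ℝ × ℝ) := Set.Icc (-1) 1 ×ˢ Set.Icc (-1) 1

/-- `D'` is obtained from `D` by a replacement in a closed disc, the image of the square under `ψ`.
The part of the source that `D` maps into that disc consists of `k` disjoint intervals, the strands,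
each parametrized by `[-1, 1]` (in either direction) through `t ↦ strand i t`. On the `i`-th strand,
`D` draws the curve `c i` in the square, and `D'` draws the curve `c' i` instead. Elsewhere the two
diagrams agree. -/
structure LocalReplacement (o : SurfaceOrientation S) {m n : ℕ} (D D' : Diagram S m n) (k : ℕ)
    (c c' : Fin k → ℝ → ℝ × ℝ) where
  disc : OrientedDisc o
  center : Fin k → OneManifold m n
  speed : Fin k → ℝ
  injective : ∀ i j, ∀ s ∈ Set.Icc (-1 : ℝ) 1, ∀ t ∈ Set.Icc (-1 : ℝ) 1,
    shift (center i) (speed i * s) = shift (center j) (speed j * t) → i = j ∧ s = t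
  mem_square : ∀ i, ∀ t ∈ Set.Icc (-1 : ℝ) 1, c i t ∈ square
  mem_square' : ∀ i, ∀ t ∈ Set.Icc (-1 : ℝ) 1, c' i t ∈ square
  inside : ∀ i, ∀ t ∈ Set.Icc (-1 : ℝ) 1,
    D.f (shift (center i) (speed i * t)) = disc.ψ (c i t)
  inside' : ∀ i, ∀ t ∈ Set.Icc (-1 : ℝ) 1,
    D'.f (shift (center i) (speed i * t)) = disc.ψ (c' i t)
  only_strands : ∀ x, D.f x ∈ disc.ψ '' square →
    ∃ i, ∃ t ∈ Set.Icc (-1 : ℝ) 1, x = shift (center i) (speed i * t)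
  outside : ∀ x, (∀ i, ∀ t ∈ Set.Ioo (-1 : ℝ) 1, x ≠ shift (center i) (speed i * t)) →
    D'.f x = D.f x ∧ (x ∈ D'.overSet ↔ x ∈ D.overSet)

/-- The point with parameter `t` of the `i`-th strand. -/
def LocalReplacement.strand {o : SurfaceOrientation S} {m n : ℕ} {D D' : Diagram S m n} {k : ℕ}
    {c c' : Fin k → ℝ → ℝ × ℝ} (r : LocalReplacement o D D' k c c') (i : Fin k) (t : ℝ) :
    OneManifold m n :=
  shift (r.center i) (r.speed i * t)

/-- The move `R₁`: a strand without double points is replaced by a strand with a kink, i.e. with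
exactly one double point (with either choice of crossing). -/
def R1 (o : SurfaceOrientation S) {m n : ℕ} (D D' : Diagram S m n) : Prop :=
  ∃ (c c' : ℝ → ℝ × ℝ) (_ : LocalReplacement o D D' 1 (fun _ => c) (fun _ => c')) (t₁ t₂ : ℝ),
    Set.InjOn c (Set.Icc (-1) 1) ∧
    -1 < t₁ ∧ t₁ < t₂ ∧ t₂ < 1 ∧ c' t₁ = c' t₂ ∧
    ∀ s ∈ Set.Icc (-1 : ℝ) 1, ∀ t ∈ Set.Icc (-1 : ℝ) 1, s < t → c' s = c' t → s = t₁ ∧ t = t₂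

/-- The crossings between the strands, drawn as graphs of the functions `g i` on `[-1, 1]`, are such
that at each of them the strand with the larger value of `height` is the overcrossing one. -/
def Layered {m n k : ℕ} (D : Diagram S m n) (strand : Fin k → ℝ → OneManifold m n)
    (g : Fin k → ℝ → ℝ) (height : Fin k → ℕ) : Prop :=
  ∀ i j, i ≠ j → ∀ t ∈ Set.Icc (-1 : ℝ) 1, g i t = g j t →
    (strand i t ∈ D.overSet ↔ height j < height i)

/-- The move `R₂`: the strands are drawn as graphs over the horizontal axis; in `D` the strand `0`
runs below the strand `1` without meeting it, in `D'` the two strands meet in exactly two points,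
where one and the same strand is the overcrossing one. -/
def R2 (o : SurfaceOrientation S) {m n : ℕ} (D D' : Diagram S m n) : Prop :=
  ∃ (g g' : Fin 2 → ℝ → ℝ)
    (r : LocalReplacement o D D' 2 (fun i t => (t, g i t)) (fun i t => (t, g' i t)))
    (height : Fin 2 → ℕ) (t₁ t₂ : ℝ),
    (∀ i, ContDiffOn ℝ ∞ (g i) (Set.Icc (-1) 1)) ∧
    (∀ i, ContDiffOn ℝ ∞ (g' i) (Set.Icc (-1) 1)) ∧
    (∀ t ∈ Set.Icc (-1 : ℝ) 1, g 0 t < g 1 t) ∧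
    -1 < t₁ ∧ t₁ < t₂ ∧ t₂ < 1 ∧
    (∀ t ∈ Set.Icc (-1 : ℝ) 1, g' 0 t = g' 1 t ↔ t = t₁ ∨ t = t₂) ∧
    Function.Injective height ∧ Layered D' r.strand g' height

/-- The move `R₃`: three strands are drawn as graphs over the horizontal axis, numbered from
below at the left end. Any two of them cross exactly once, and they lie in three different layers.
From left to right, in `D` the crossings occur in the order `01, 02, 12`, and in `D'` they occur in
the order `12, 02, 01`. -/
def R3 (o : SurfaceOrientation S) {m n : ℕ} (D D' : Diagram S m n) : Prop :=
  ∃ (g g' : Fin 3 → ℝ → ℝ)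
    (r : LocalReplacement o D D' 3 (fun i t => (t, g i t)) (fun i t => (t, g' i t)))
    (height : Fin 3 → ℕ) (a b c a' b' c' : ℝ),
    (∀ i, ContDiffOn ℝ ∞ (g i) (Set.Icc (-1) 1)) ∧
    (∀ i, ContDiffOn ℝ ∞ (g' i) (Set.Icc (-1) 1)) ∧
    g 0 (-1) < g 1 (-1) ∧ g 1 (-1) < g 2 (-1) ∧
    -1 < a ∧ a < b ∧ b < c ∧ c < 1 ∧
    -1 < c' ∧ c' < b' ∧ b' < a' ∧ a' < 1 ∧
    (∀ t ∈ Set.Icc (-1 : ℝ) 1, g 0 t = g 1 t ↔ t = a) ∧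
    (∀ t ∈ Set.Icc (-1 : ℝ) 1, g 0 t = g 2 t ↔ t = b) ∧
    (∀ t ∈ Set.Icc (-1 : ℝ) 1, g 1 t = g 2 t ↔ t = c) ∧
    (∀ t ∈ Set.Icc (-1 : ℝ) 1, g' 0 t = g' 1 t ↔ t = a') ∧
    (∀ t ∈ Set.Icc (-1 : ℝ) 1, g' 0 t = g' 2 t ↔ t = b') ∧
    (∀ t ∈ Set.Icc (-1 : ℝ) 1, g' 1 t = g' 2 t ↔ t = c') ∧
    Function.Injective height ∧ Layered D r.strand g height ∧ Layered D' r.strand g' height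

/-! ### Equivalences -/

/-- Diagrams with an arbitrary source. -/
abbrev AnyDiagram (S : Type*) [TopologicalSpace S] [ChartedSpace (EuclideanHalfSpace 2) S] :
    Type _ :=
  Σ m : ℕ, Σ n : ℕ, Diagram S m n

/-- The elementary steps of the regular equivalence of diagrams. -/
inductive RegularStep (o : SurfaceOrientation S) : AnyDiagram S → AnyDiagram S → Prop
  | same {m n m' n' : ℕ} (D : Diagram S m n) (D' : Diagram S m' n') :
      D.SameDiagram D' → RegularStep o ⟨m, n, D⟩ ⟨m', n', D'⟩
  | isotopy {m n : ℕ} (D D' : Diagram S m n) :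
      Isotopic D D' → RegularStep o ⟨m, n, D⟩ ⟨m, n, D'⟩
  | r2 {m n : ℕ} (D D' : Diagram S m n) : R2 o D D' → RegularStep o ⟨m, n, D⟩ ⟨m, n, D'⟩
  | r3 {m n : ℕ} (D D' : Diagram S m n) : R3 o D D' → RegularStep o ⟨m, n, D⟩ ⟨m, n, D'⟩

/-- The elementary steps of the equivalence of oriented diagrams. The orientation of the source is
carried along by the isotopies and the Reidemeister moves. -/
inductive OrientedStep (o : SurfaceOrientation S) : AnyDiagram S → AnyDiagram S → Prop
  | same {m n m' n' : ℕ} (D : Diagram S m n) (D' : Diagram S m' n') :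
      D.SameOrientedDiagram D' → OrientedStep o ⟨m, n, D⟩ ⟨m', n', D'⟩
  | isotopy {m n : ℕ} (D D' : Diagram S m n) :
      Isotopic D D' → OrientedStep o ⟨m, n, D⟩ ⟨m, n, D'⟩
  | r1 {m n : ℕ} (D D' : Diagram S m n) : R1 o D D' → OrientedStep o ⟨m, n, D⟩ ⟨m, n, D'⟩
  | r2 {m n : ℕ} (D D' : Diagram S m n) : R2 o D D' → OrientedStep o ⟨m, n, D⟩ ⟨m, n, D'⟩
  | r3 {m n : ℕ} (D D' : Diagram S m n) : R3 o D D' → OrientedStep o ⟨m, n, D⟩ ⟨m, n, D'⟩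

/-- Regular equivalence of (unoriented) generalized link diagrams: finite sequences of ambient
isotopies relative to the boundary and of moves `R₂`, `R₃` and their inverses. -/
def RegularlyEquivalent (o : SurfaceOrientation S) : AnyDiagram S → AnyDiagram S → Prop :=
  Relation.EqvGen (RegularStep o)

/-- Equivalence of oriented generalized link diagrams: finite sequences of ambient isotopies
relative to the boundary and of moves `R₁`, `R₂`, `R₃` and their inverses. -/
def OrientedEquivalent (o : SurfaceOrientation S) : AnyDiagram S → AnyDiagram S → Prop :=
  Relation.EqvGen (OrientedStep o)

/-! ### States, bracket, writhe -/

/-- The two types of splitting of a crossing. -/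
inductive SplitType
  | A
  | B

namespace Diagram

variable {m n : ℕ}

open Classical in
/-- The sign of a crossing: positive if (over, under) is a positively oriented pair of tangent
vectors. -/
def Crossing.sign (o : SurfaceOrientation S) {D : Diagram S m n} (c : D.Crossing) : ℤˣ :=
  if o.Positive (D.f c.upper) (velocity D.f c.upper) (velocity D.f c.lower) then 1 else -1

/-- A state of `D`: a choice of splitting type for each crossing. -/
abbrev State (D : Diagram S m n) : Type := D.Crossing → SplitType

/-- The splitting of a crossing connects the upper half-branch in the direction `σ v` with the lower
half-branch in the direction `τ u`, where `v` and `u` are the velocities of the upper and of the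
lower arc, and `τ = splitEnd o s c σ` is the sign for which the pair `(σ v, τ u)` is negatively
oriented (type A) or positively oriented (type B). So the type A splitting merges the two regions
that are swept out by the overcrossing arc when it is turned counterclockwise until it meets the
undercrossing arc. -/
def splitEnd (o : SurfaceOrientation S) {D : Diagram S m n} (s : D.State) (c : D.Crossing)
    (σ : ℤˣ) : ℤˣ :=
  match s c with
  | .A => -(c.sign o * σ)
  | .B => c.sign o * σ

/-- The compact 1-manifold `D(s)` obtained by splitting `D` by the state `s`: the preimages of the
double points are removed, and for each crossing `c` and each sign `σ` a new point `(c, σ)` is put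
in, which connects the upper half-branch with sign `σ` to the lower half-branch with sign
`splitEnd o s c σ`. -/
def Split (_o : SurfaceOrientation S) (D : Diagram S m n) (_s : D.State) : Type :=
  {x : OneManifold m n // x ∉ D.doubleSet} ⊕ (D.Crossing × ℤˣ)

/-- The topology of `D(s)`: a set is open if its part away from the crossings is open, and if with a
new point it contains all nearby points of the two half-branches that end there. -/
instance (o : SurfaceOrientation S) (D : Diagram S m n) (s : D.State) :
    TopologicalSpace (D.Split o s) where
  IsOpen U := IsOpen {x : {x : OneManifold m n // x ∉ D.doubleSet} | Sum.inl x ∈ U} ∧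
    ∀ c σ, Sum.inr (c, σ) ∈ U →
      (∀ᶠ x in halfBranch c.upper σ, ∀ h : x ∉ D.doubleSet, Sum.inl ⟨x, h⟩ ∈ U) ∧
      (∀ᶠ x in halfBranch c.lower (splitEnd o s c σ),
        ∀ h : x ∉ D.doubleSet, Sum.inl ⟨x, h⟩ ∈ U)
  isOpen_univ := by
    refine ⟨?_, fun c σ _ => ⟨Filter.Eventually.of_forall fun x h => Set.mem_univ _,
      Filter.Eventually.of_forall fun x h => Set.mem_univ _⟩⟩
    exact isOpen_univ
  isOpen_inter U V hU hV := by
    refine ⟨hU.1.inter hV.1, fun c σ h => ⟨?_, ?_⟩⟩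
    · filter_upwards [(hU.2 c σ h.1).1, (hV.2 c σ h.2).1] with x h₁ h₂ hx
      exact ⟨h₁ hx, h₂ hx⟩
    · filter_upwards [(hU.2 c σ h.1).2, (hV.2 c σ h.2).2] with x h₁ h₂ hx
      exact ⟨h₁ hx, h₂ hx⟩
  isOpen_sUnion 𝒰 h𝒰 := by
    refine ⟨?_, ?_⟩
    · have : {x : {x : OneManifold m n // x ∉ D.doubleSet} | Sum.inl x ∈ ⋃₀ 𝒰}
          = ⋃ U ∈ 𝒰, {x : {x : OneManifold m n // x ∉ D.doubleSet} | Sum.inl x ∈ U} := by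
        ext x
        simp only [Set.mem_ofPred_eq, Set.mem_iUnion, exists_prop]
        rfl
      rw [this]
      exact isOpen_biUnion fun U hU => (h𝒰 U hU).1
    · rintro c σ ⟨U, hU, h⟩
      refine ⟨((h𝒰 U hU).2 c σ h).1.mono fun x hx hx' => ⟨U, hU, hx hx'⟩,
        ((h𝒰 U hU).2 c σ h).2.mono fun x hx hx' => ⟨U, hU, hx hx'⟩⟩

open LaurentPolynomial

/-- The number of type A splittings. -/
def alpha (D : Diagram S m n) (s : D.State) : ℕ := Nat.card {c : D.Crossing // s c = .A}

/-- The number of type B splittings. -/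
def beta (D : Diagram S m n) (s : D.State) : ℕ := Nat.card {c : D.Crossing // s c = .B}

/-- The number of connected components of `D(s)`. -/
def mu (o : SurfaceOrientation S) (D : Diagram S m n) (s : D.State) : ℕ :=
  Nat.card (ConnectedComponents (D.Split o s))

/-- The bracket polynomial of `D`, a Laurent polynomial in the variable `A = T 1`. The sum runs over
the finitely many states of `D`. -/
def bracket (o : SurfaceOrientation S) (D : Diagram S m n) : LaurentPolynomial ℤ :=
  ∑ᶠ s : D.State, T ((D.alpha s : ℤ) - (D.beta s : ℤ)) * (-T 2 - T (-2)) ^ (D.mu o s - 1)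

/-- The writhe number of `D`, with the orientation inherited from the source. -/
def writhe (o : SurfaceOrientation S) (D : Diagram S m n) : ℤ :=
  ∑ᶠ c : D.Crossing, (c.sign o : ℤ)

/-- The unit `-A` of the ring of Laurent polynomials. -/
def negA : (LaurentPolynomial ℤ)ˣ where
  val := -T 1
  inv := -T (-1)
  val_inv := by rw [neg_mul_neg, ← T_add]; simp
  inv_val := by rw [neg_mul_neg, ← T_add]; simp

/-- The Kauffman-Jones polynomial of `D`, with the orientation inherited from the source. -/
def kauffmanJones (o : SurfaceOrientation S) (D : Diagram S m n) : LaurentPolynomial ℤ :=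
  ((negA ^ (-3 * D.writhe o) : (LaurentPolynomial ℤ)ˣ) : LaurentPolynomial ℤ) * D.bracket o

end Diagram

end Surface

end GenLink

end

noncomputable section

namespace GenLink

section Source

variable {m n : ℕ}

/-! ### Local parametrizations of the source -/

/-! A Reidemeister move changes the diagram only inside a disc, so Kauffman's local calculation
should suffice: split the crossings in the disc in all possible ways and use that an extra closed
circle contributes the factor δ = -A² - A⁻². The delicate point is how μ(s) reacts to a local
change. The proof does not follow components through the disc; it counts colourings. Since D(s) has
finitely many components, it has exactly 2^μ(s) continuous maps to `Bool`
(`Diagram.card_stateColorings`), and such a map amounts to a locally constant two-colouring of the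
half-branches of the source that respects the gluing prescribed by s.

Colourings can be cut. Each strand in the disc carries two marked times, where its crossings sit. A
colouring is determined by its part outside the strands together with the colour of the middle arc
of each strand (`StrandSystem.card_colorings_eq`), and the number of admissible middle colours
depends only on the colours b at the ends of the strands. To compare two splittings it is therefore
enough to compare these numbers for all Boolean values of b, which is a finite check
(`kinkCount_relations`, `bigonCount_relations`, `triangleCount_relations`). Equal numbers mean equal
μ; a doubled number means one more circle.

Grouping the state sum by the splittings outside the disc (`AgreeOutside.bracket_eq_mul`) leaves
identities of Laurent polynomials. For R₂ the three unwanted terms cancel because A² + A⁻² + δ = 0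
(`localSum_bigon`). A kink of sign ε multiplies the bracket by (-A)^(3ε) (`localSum_kink`), which
the writhe factor compensates. For R₃ the terms are matched across the move (`localSum_triangle`),
for all sign patterns except two cyclic ones, and these cannot occur for strands lying in layers.

The A/B convention enters through crossing signs, which are computed from the slopes of the strands
and the orientation of the disc (`DrawnBy.sign_eq`). The remaining steps, isotopies and changes of
presentation, yield a bijection of the sources that respects half-branches, crossings and signs
(`Diagram.GermIso`). For an isotopy it is the identity, and the point is that the time-one map
preserves orientation. For two presentations of one subset, points with the same image and the same
tangent line are matched; compactness of the source provides the match and its continuity. -/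

theorem shift_zero (x : OneManifold m n) : shift x 0 = x := by
  rcases x with ⟨i, t⟩ | ⟨i, z⟩
  · simp [shift]
  · simp [shift]

theorem continuous_shift (x : OneManifold m n) : Continuous (shift x) := by
  rcases x with ⟨i, t⟩ | ⟨i, z⟩
  · have : Continuous fun s : ℝ => Set.projIcc (0 : ℝ) 1 zero_le_one ((t : ℝ) + s) :=
      continuous_projIcc.comp (continuous_const.add continuous_id)
    exact continuous_inl.comp (continuous_const.prodMk this)
  · have : Continuous fun s : ℝ => z + (s : AddCircle (1 : ℝ)) :=
      continuous_const.add (AddCircle.continuous_mk' 1)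
    exact continuous_inr.comp (continuous_const.prodMk this)

theorem zero_mem_shiftDom (x : OneManifold m n) : (0 : ℝ) ∈ shiftDom x := by
  rcases x with ⟨i, t⟩ | ⟨i, z⟩
  · simpa only [shiftDom, Set.mem_ofPred_eq, add_zero] using t.2
  · trivial

theorem convex_shiftDom (x : OneManifold m n) : Convex ℝ (shiftDom x) := by
  rcases x with ⟨i, t⟩ | ⟨i, z⟩
  · have : shiftDom (.inl (i, t) : OneManifold m n) = Set.Icc (-(t : ℝ)) (1 - t) := by
      ext s
      simp only [shiftDom, Set.mem_ofPred_eq, Set.mem_Icc]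
      constructor <;> rintro ⟨h₁, h₂⟩ <;> constructor <;> linarith
    rw [this]
    exact convex_Icc _ _
  · exact convex_univ

theorem interior_shiftDom_nonempty (x : OneManifold m n) : (interior (shiftDom x)).Nonempty := by
  rcases x with ⟨i, t⟩ | ⟨i, z⟩
  · have : shiftDom (.inl (i, t) : OneManifold m n) = Set.Icc (-(t : ℝ)) (1 - t) := by
      ext s
      simp only [shiftDom, Set.mem_ofPred_eq, Set.mem_Icc]
      constructor <;> rintro ⟨h₁, h₂⟩ <;> constructor <;> linarith
    rw [this, interior_Icc, Set.nonempty_Ioo]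
    linarith
  · simp [shiftDom]

theorem uniqueDiffOn_shiftDom (x : OneManifold m n) : UniqueDiffOn ℝ (shiftDom x) :=
  uniqueDiffOn_convex (convex_shiftDom x) (interior_shiftDom_nonempty x)

theorem shift_shift {x : OneManifold m n} {s : ℝ} (hs : s ∈ shiftDom x) (u : ℝ) :
    shift (shift x s) u = shift x (s + u) := by
  rcases x with ⟨i, t⟩ | ⟨i, z⟩
  · simp only [shiftDom, Set.mem_ofPred_eq] at hs
    simp only [shift, Set.projIcc_of_mem zero_le_one hs, add_assoc]
  · simp [shift, add_assoc]

theorem mem_shiftDom_shift {x : OneManifold m n} {s : ℝ} (hs : s ∈ shiftDom x) (u : ℝ) :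
    u ∈ shiftDom (shift x s) ↔ s + u ∈ shiftDom x := by
  rcases x with ⟨i, t⟩ | ⟨i, z⟩
  · simp only [shiftDom, Set.mem_ofPred_eq] at hs
    simp only [shift, shiftDom, Set.mem_ofPred_eq, Set.projIcc_of_mem zero_le_one hs, add_assoc]
  · simp [shift, shiftDom]

theorem shift_injOn (x : OneManifold m n) {s u : ℝ} (hs : s ∈ shiftDom x) (hu : u ∈ shiftDom x)
    (hsu : |s - u| < 1) (h : shift x s = shift x u) : s = u := by
  rcases x with ⟨i, t⟩ | ⟨i, z⟩
  · simp only [shiftDom, Set.mem_ofPred_eq] at hs hu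
    simp only [shift, Set.projIcc_of_mem zero_le_one hs, Set.projIcc_of_mem zero_le_one hu,
      Sum.inl.injEq, Prod.mk.injEq, Subtype.mk.injEq, true_and] at h
    linarith
  · simp only [shift, Sum.inr.injEq, Prod.mk.injEq, true_and, add_right_inj] at h
    rw [← sub_eq_zero, ← AddCircle.coe_sub, AddCircle.coe_eq_zero_iff] at h
    obtain ⟨k, hk⟩ := h
    rw [zsmul_eq_mul, mul_one] at hk
    rw [← hk] at hsu
    have : |k| < 1 := by exact_mod_cast hsu
    have hk0 : k = 0 := Int.abs_lt_one_iff.1 this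
    rw [hk0] at hk
    push_cast at hk
    linarith

/-- A movement stopped by an end point can be replaced by a shorter one that is not. -/
theorem exists_mem_shiftDom (x : OneManifold m n) (s : ℝ) :
    ∃ u ∈ shiftDom x, shift x u = shift x s ∧ |u| ≤ |s| ∧ 0 ≤ u * s := by
  rcases x with ⟨i, t⟩ | ⟨i, z⟩
  · refine ⟨(Set.projIcc (0 : ℝ) 1 zero_le_one (t + s) : ℝ) - t, ?_, ?_, ?_⟩
    · simpa only [shiftDom, Set.mem_ofPred_eq, add_sub_cancel] using Subtype.property _
    · simp only [shift, add_sub_cancel, Set.projIcc_val]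
    · have h0 := t.2.1
      have h1 := t.2.2
      simp only [Set.coe_projIcc]
      rcases le_total 0 s with hs | hs
      · have : max 0 (min 1 ((t : ℝ) + s)) = min 1 (t + s) := max_eq_right (by positivity)
        rw [this]
        have h2 : 0 ≤ min 1 ((t : ℝ) + s) - t := by
          rw [sub_nonneg]; exact le_min h1 (by linarith)
        refine ⟨?_, mul_nonneg h2 hs⟩
        rw [abs_of_nonneg h2, abs_of_nonneg hs]
        have := min_le_right 1 ((t : ℝ) + s)
        linarith
      · have : min 1 ((t : ℝ) + s) = t + s := min_eq_right (by linarith)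
        rw [this]
        have h2 : max 0 ((t : ℝ) + s) - t ≤ 0 := by
          rw [sub_nonpos]; exact max_le h0 (by linarith)
        refine ⟨?_, mul_nonneg_of_nonpos_of_nonpos h2 hs⟩
        rw [abs_of_nonpos h2, abs_of_nonpos hs]
        have := le_max_right 0 ((t : ℝ) + s)
        linarith
  · exact ⟨s, trivial, rfl, le_rfl, mul_self_nonneg s⟩

/-- On an interval, clamping retracts the line onto [0,1]; on a circle, the quotient map from the
line is open. Either way small movements from `x` sweep out neighbourhoods. -/
theorem nhds_eq_map_shift (x : OneManifold m n) : 𝓝 x = Filter.map (shift x) (𝓝 0) := by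
  refine le_antisymm ?_ ?_
  · rcases x with ⟨i, t⟩ | ⟨i, z⟩
    · intro V hV
      rw [Filter.mem_map] at hV
      have h1 : {r : ℝ | (.inl (i, Set.projIcc 0 1 zero_le_one r) : OneManifold m n) ∈ V}
          ∈ 𝓝 (t : ℝ) := by
        have : Filter.Tendsto (fun r : ℝ => r - t) (𝓝 (t : ℝ)) (𝓝 0) := by
          have h : Continuous fun r : ℝ => r - t := by fun_prop
          simpa using h.tendsto (t : ℝ)
        filter_upwards [this hV] with r hr
        simpa [shift] using hr
      have h2 : {t' : unitInterval | (.inl (i, t') : OneManifold m n) ∈ V} ∈ 𝓝 t := by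
        filter_upwards [continuous_subtype_val.continuousAt.preimage_mem_nhds h1] with t' ht'
        simpa [Set.projIcc_val] using ht'
      rw [nhds_inl, Filter.mem_map, nhds_prod_eq, nhds_discrete, Filter.pure_prod,
        Filter.mem_map]
      exact h2
    · intro V hV
      rw [Filter.mem_map] at hV
      have h2 : {z' : AddCircle (1 : ℝ) | (.inr (i, z') : OneManifold m n) ∈ V} ∈ 𝓝 z := by
        have h3 : {w : AddCircle (1 : ℝ) | (.inr (i, z + w) : OneManifold m n) ∈ V} ∈
            𝓝 ((0 : ℝ) : AddCircle (1 : ℝ)) := by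
          have ho : IsOpenMap ((↑) : ℝ → AddCircle (1 : ℝ)) := QuotientAddGroup.isOpenMap_coe
          refine Filter.mem_of_superset (ho.image_mem_nhds hV) ?_
          rintro _ ⟨s, hs, rfl⟩
          exact hs
        have : Filter.Tendsto (fun r : AddCircle (1 : ℝ) => r - z) (𝓝 z)
            (𝓝 ((0 : ℝ) : AddCircle (1 : ℝ))) := by
          have h : Continuous fun r : AddCircle (1 : ℝ) => r - z := by fun_prop
          simpa using h.tendsto z
        filter_upwards [this h3] with r hr
        simpa using hr
      rw [nhds_inr, Filter.mem_map, nhds_prod_eq, nhds_discrete, Filter.pure_prod,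
        Filter.mem_map]
      exact h2
  · have := (continuous_shift x).tendsto 0
    rwa [shift_zero] at this

theorem nhds_eq_map_shift_shiftDom (x : OneManifold m n) :
    𝓝 x = Filter.map (shift x) (𝓝[shiftDom x] 0) := by
  refine le_antisymm ?_ ?_
  · intro V hV
    rw [nhds_eq_map_shift, Filter.mem_map]
    rw [Filter.mem_map, mem_nhdsWithin_iff_eventually, Metric.eventually_nhds_iff] at hV
    obtain ⟨ε, hε, h⟩ := hV
    refine Filter.mem_of_superset (Metric.ball_mem_nhds 0 hε) fun s hs => ?_
    obtain ⟨u, hu, hu', hus, -⟩ := exists_mem_shiftDom x s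
    have := h (y := u) (by simp at hs ⊢; linarith) hu
    change shift x s ∈ V
    rw [← hu']
    exact this
  · rw [nhds_eq_map_shift]
    exact Filter.map_mono nhdsWithin_le_nhds

theorem halfBranch_one (x : OneManifold m n) : halfBranch x 1 = Filter.map (shift x) (𝓝[>] 0) := by
  simp [halfBranch]

theorem halfBranch_neg_one (x : OneManifold m n) :
    halfBranch x (-1) = Filter.map (shift x) (𝓝[<] 0) := by
  have h : Filter.map (fun s : ℝ => -s) (𝓝[>] 0) = 𝓝[<] 0 := by
    simp
  rw [← h, Filter.map_map]
  simp [halfBranch, Function.comp_def]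

/-- This also holds at an end point: there the movement towards the blocked side is clamped, and
that half-branch is just `pure x`. -/
theorem nhds_eq_sup_halfBranch (x : OneManifold m n) :
    𝓝 x = pure x ⊔ halfBranch x 1 ⊔ halfBranch x (-1) := by
  have h : 𝓝 (0 : ℝ) = pure 0 ⊔ 𝓝[>] 0 ⊔ 𝓝[<] 0 := by
    rw [← nhdsGE_sup_nhdsLT, ← Set.Ioi_insert, nhdsWithin_insert]
  rw [nhds_eq_map_shift, h, Filter.map_sup, Filter.map_sup, Filter.map_pure, shift_zero,
    halfBranch_one, halfBranch_neg_one]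

theorem halfBranch_le_nhds (x : OneManifold m n) (σ : ℤˣ) : halfBranch x σ ≤ 𝓝 x := by
  rw [nhds_eq_sup_halfBranch]
  rcases Int.units_eq_one_or σ with rfl | rfl
  · exact le_sup_of_le_left le_sup_right
  · exact le_sup_right

instance halfBranch_neBot (x : OneManifold m n) (σ : ℤˣ) : (halfBranch x σ).NeBot :=
  Filter.map_neBot

theorem mem_endPoints_iff (x : OneManifold m n) : x ∉ endPoints m n ↔ shiftDom x ∈ 𝓝 (0 : ℝ) := by
  rcases x with ⟨i, t⟩ | ⟨i, z⟩
  · have h0 := t.2.1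
    have h1 := t.2.2
    have hd : shiftDom (.inl (i, t) : OneManifold m n) = Set.Icc (-(t : ℝ)) (1 - t) := by
      ext s
      simp only [shiftDom, Set.mem_ofPred_eq, Set.mem_Icc]
      constructor <;> rintro ⟨h₁, h₂⟩ <;> constructor <;> linarith
    rw [hd, Icc_mem_nhds_iff]
    simp only [endPoints, Set.mem_ofPred_eq, Sum.inl.injEq, Prod.mk.injEq, Set.mem_Ioo]
    rw [← not_iff_not, not_not]
    constructor
    · rintro ⟨j, ⟨-, rfl⟩ | ⟨-, rfl⟩⟩ <;> simp
    · intro h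
      refine ⟨i, ?_⟩
      by_cases ht : (t : ℝ) = 0
      · exact Or.inl ⟨rfl, Subtype.ext ht⟩
      · refine Or.inr ⟨rfl, Subtype.ext ?_⟩
        have h2 : 0 < (t : ℝ) := lt_of_le_of_ne h0 (Ne.symm ht)
        by_contra h3
        have h4 : (t : ℝ) < 1 := lt_of_le_of_ne h1 h3
        exact h ⟨by linarith, by linarith⟩
  · simp [endPoints, shiftDom]

end Source

/-! ### Transversality, compactness and the finiteness of the double points -/

section DoublePoints

variable {m n m' n' : ℕ}

theorem shift_image_mem_nhds (x : OneManifold m n) {δ : ℝ} (hδ : 0 < δ) :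
    shift x '' {s | s ∈ shiftDom x ∧ |s| < δ} ∈ 𝓝 x := by
  rw [nhds_eq_map_shift_shiftDom]
  refine Filter.image_mem_map ?_
  rw [mem_nhdsWithin_iff_eventually]
  filter_upwards [Metric.ball_mem_nhds (0 : ℝ) hδ] with s hs hs'
  exact ⟨hs', by simpa using hs⟩

/-- A curve that is continuously differentiable on a convex set is strictly differentiable there. -/
theorem exists_norm_sub_sub_smul_le {F : Type*} [NormedAddCommGroup F] [NormedSpace ℝ F]
    {γ : ℝ → F} {s : Set ℝ} (hs : Convex ℝ s) (hs' : UniqueDiffOn ℝ s) (h0 : (0 : ℝ) ∈ s)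
    (hγ : ContDiffWithinAt ℝ 1 γ s 0) {v : F} (hv : HasDerivWithinAt γ v s 0) {ε : ℝ}
    (hε : 0 < ε) :
    ∃ δ > 0, ∀ a ∈ s, ∀ b ∈ s, |a| < δ → |b| < δ → ‖γ b - γ a - (b - a) • v‖ ≤ ε * |b - a| := by
  obtain ⟨u, hu, h0u, hγu⟩ := hγ.contDiffOn' le_rfl (by simp)
  rw [Set.insert_eq_of_mem h0] at hγu
  have hsu : UniqueDiffOn ℝ (s ∩ u) := hs'.inter hu
  have hc := hγu.continuousOn_derivWithin hsu le_rfl 0 ⟨h0, h0u⟩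
  have hv0 : derivWithin γ (s ∩ u) 0 = v :=
    (hv.mono Set.inter_subset_left).derivWithin (hsu 0 ⟨h0, h0u⟩)
  rw [ContinuousWithinAt, hv0, Metric.tendsto_nhdsWithin_nhds] at hc
  obtain ⟨δ₁, hδ₁, h₁⟩ := hc ε hε
  obtain ⟨δ₂, hδ₂, h₂⟩ := Metric.isOpen_iff.1 hu 0 h0u
  refine ⟨min δ₁ δ₂, lt_min hδ₁ hδ₂, fun a ha b hb ha' hb' => ?_⟩
  set K : Set ℝ := s ∩ Metric.ball 0 (min δ₁ δ₂)
  have hK : Convex ℝ K := hs.inter (convex_ball _ _)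
  have hKu : K ⊆ s ∩ u := fun t ht =>
    ⟨ht.1, h₂ (Metric.ball_subset_ball (min_le_right _ _) ht.2)⟩
  -- Subtracting the linear motion leaves a curve whose derivative has norm at most ε on the convex
  -- set K; the mean value inequality then bounds its increments.
  have hd : ∀ t ∈ K, HasDerivWithinAt (fun t => γ t - t • v) (derivWithin γ (s ∩ u) t - v) K t := by
    intro t ht
    have h3 : HasDerivWithinAt γ (derivWithin γ (s ∩ u) t) K t :=
      ((hγu.differentiableOn (by simp) t (hKu ht)).hasDerivWithinAt).mono hKu
    have h4 : HasDerivWithinAt (fun t : ℝ => t • v) v K t := by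
      simpa using (hasDerivWithinAt_id t K).smul_const v
    exact h3.sub h4
  have hb2 : ∀ t ∈ K, ‖derivWithin γ (s ∩ u) t - v‖ ≤ ε := by
    intro t ht
    rw [← dist_eq_norm]
    exact (h₁ (hKu ht) (lt_of_lt_of_le ht.2 (min_le_left _ _))).le
  have := Convex.norm_image_sub_le_of_norm_hasDerivWithin_le hd hb2 hK
    (x := a) (y := b) ⟨ha, by simpa using ha'⟩ ⟨hb, by simpa using hb'⟩
  calc ‖γ b - γ a - (b - a) • v‖ = ‖γ b - b • v - (γ a - a • v)‖ := by
        congr 1; rw [sub_smul]; abel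
    _ ≤ _ := by simpa using this

/-- An injective linear map on a finite-dimensional space is bounded below. The factor 2 passes from
the sup norm of (a, -b) to |a| + |b|. -/
theorem exists_le_norm_smul_sub_smul {F : Type*} [NormedAddCommGroup F] [NormedSpace ℝ F]
    {v w : F} (h : LinearIndependent ℝ ![v, w]) :
    ∃ c > 0, ∀ a b : ℝ, c * (|a| + |b|) ≤ ‖a • v - b • w‖ := by
  have hinj := LinearIndependent.fintypeLinearCombination_injective h
  obtain ⟨K, hK, hA⟩ := LinearMap.exists_antilipschitzWith
    (Fintype.linearCombination ℝ ![v, w]) (LinearMap.ker_eq_bot.2 hinj)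
  have hK' : (0 : ℝ) < K := hK
  refine ⟨(2 * K)⁻¹, by positivity, fun a b => ?_⟩
  have h1 := hA.le_mul_dist ![a, -b] 0
  simp only [dist_zero_right, map_zero] at h1
  have h2 : Fintype.linearCombination ℝ ![v, w] ![a, -b] = a • v - b • w := by
    simp [Fintype.linearCombination_apply, Fin.sum_univ_two, sub_eq_add_neg]
  rw [h2] at h1
  have ha := norm_le_pi_norm (![a, -b] : Fin 2 → ℝ) 0
  have hb := norm_le_pi_norm (![a, -b] : Fin 2 → ℝ) 1
  simp only [Matrix.cons_val_zero, Matrix.cons_val_one, Real.norm_eq_abs, abs_neg] at ha hb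
  rw [inv_mul_le_iff₀ (by positivity)]
  linarith

section Surface

variable {S : Type*} [TopologicalSpace S] [ChartedSpace (EuclideanHalfSpace 2) S]

namespace Diagram

theorem Crossing.ext_of_upper {D : Diagram S m n} {c c' : D.Crossing} (h : c.upper = c'.upper) :
    c = c' := by
  rcases c with ⟨u, l, ne, eq, hu⟩
  rcases c' with ⟨u', l', ne', eq', hu'⟩
  obtain rfl : u = u' := h
  have : l = l' := by
    rcases D.double l u l' eq.symm eq' with h | h | h
    · exact absurd h.symm ne
    · exact absurd h ne'
    · exact h
  subst this
  rfl

theorem continuous (D : Diagram S m n) : Continuous D.f := by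
  rw [continuous_iff_continuousAt]
  intro x
  have := (D.smooth x 0 (zero_mem_shiftDom x)).continuousWithinAt
  rw [ContinuousWithinAt, shift_zero] at this
  rw [ContinuousAt, nhds_eq_map_shift_shiftDom, Filter.tendsto_map'_iff]
  exact this

theorem hasDerivWithinAt_extChartAt (D : Diagram S m n) (x : OneManifold m n) :
    HasDerivWithinAt (fun s => extChartAt (𝓡∂ 2) (D.f x) (D.f (shift x s))) (velocity D.f x)
      (shiftDom x) 0 := by
  have h := (D.smooth x 0 (zero_mem_shiftDom x)).mdifferentiableWithinAt (by simp)
  let L : ℝ →L[ℝ] EuclideanSpace ℝ (Fin 2) :=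
    mfderivWithin 𝓘(ℝ, ℝ) (𝓡∂ 2) (fun s : ℝ => D.f (shift x s)) (shiftDom x) 0
  have h2 : HasFDerivWithinAt (fun s => extChartAt (𝓡∂ 2) (D.f x) (D.f (shift x s))) L
      (shiftDom x) 0 := by
    have := h.hasMFDerivWithinAt.2
    simp only [mfld_simps, shift_zero] at this
    exact this
  exact h2.hasDerivWithinAt

theorem contDiffWithinAt_extChartAt (D : Diagram S m n) (x : OneManifold m n) :
    ContDiffWithinAt ℝ ∞ (fun s => extChartAt (𝓡∂ 2) (D.f x) (D.f (shift x s))) (shiftDom x) 0 := by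
  have h := (contMDiffWithinAt_iff.1 (D.smooth x 0 (zero_mem_shiftDom x))).2
  simp only [mfld_simps, shift_zero] at h
  exact h

theorem exists_norm_sub_sub_smul_velocity_le (D : Diagram S m n) (x : OneManifold m n) {p : S}
    (hp : D.f x = p) {ε : ℝ} (hε : 0 < ε) :
    ∃ δ > 0, ∀ a ∈ shiftDom x, ∀ b ∈ shiftDom x, |a| < δ → |b| < δ →
      ‖extChartAt (𝓡∂ 2) p (D.f (shift x b)) - extChartAt (𝓡∂ 2) p (D.f (shift x a))
        - (b - a) • velocity D.f x‖ ≤ ε * |b - a| := by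
  subst hp
  exact exists_norm_sub_sub_smul_le (convex_shiftDom x) (uniqueDiffOn_shiftDom x)
    (zero_mem_shiftDom x) ((D.contDiffWithinAt_extChartAt x).of_le (by simp))
    (D.hasDerivWithinAt_extChartAt x) hε

/-- Two curves through the same point separate at linear speed where their tangents do. -/
theorem exists_eq_zero_of_le_norm (D : Diagram S m n) (D' : Diagram S m' n')
    {x : OneManifold m n} {x' : OneManifold m' n'} (h : D.f x = D'.f x') {c : ℝ} (hc : 0 < c) :
    ∃ δ > 0, ∀ s ∈ shiftDom x, ∀ u ∈ shiftDom x', |s| < δ → |u| < δ →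
      D.f (shift x s) = D'.f (shift x' u) →
      c * (|s| + |u|) ≤ ‖s • velocity D.f x - u • velocity D'.f x'‖ → s = 0 ∧ u = 0 := by
  obtain ⟨δ₁, hδ₁, h₁⟩ := D.exists_norm_sub_sub_smul_velocity_le x rfl (half_pos hc)
  obtain ⟨δ₂, hδ₂, h₂⟩ := D'.exists_norm_sub_sub_smul_velocity_le x' h.symm (half_pos hc)
  refine ⟨min δ₁ δ₂, lt_min hδ₁ hδ₂, fun s hs u hu hs' hu' hsu hle => ?_⟩
  have e₁ := h₁ 0 (zero_mem_shiftDom x) s hs (by simpa using hδ₁)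
    (hs'.trans_le (min_le_left _ _))
  have e₂ := h₂ 0 (zero_mem_shiftDom x') u hu (by simpa using hδ₂)
    (hu'.trans_le (min_le_right _ _))
  rw [shift_zero, sub_zero] at e₁ e₂
  rw [← h, ← hsu] at e₂
  set A := extChartAt (𝓡∂ 2) (D.f x) (D.f (shift x s)) - extChartAt (𝓡∂ 2) (D.f x) (D.f x)
  -- Both branches produce the same chart displacement A, which is within c/2·|s| of s·v and within
  -- c/2·|u| of u·w. A gap of c(|s| + |u|) between s·v and u·w thus forces s = u = 0.
  have e₃ : ‖s • velocity D.f x - u • velocity D'.f x'‖ ≤ c / 2 * |s| + c / 2 * |u| := by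
    calc ‖s • velocity D.f x - u • velocity D'.f x'‖
        = ‖(A - u • velocity D'.f x') - (A - s • velocity D.f x)‖ := by congr 1; abel
      _ ≤ ‖A - u • velocity D'.f x'‖ + ‖A - s • velocity D.f x‖ := norm_sub_le _ _
      _ ≤ _ := by linarith
  have h0 : |s| + |u| ≤ 0 := by
    by_contra hcon
    push Not at hcon
    nlinarith
  have := abs_nonneg s
  have := abs_nonneg u
  exact ⟨abs_eq_zero.1 (by linarith), abs_eq_zero.1 (by linarith)⟩

/-- With error ε = ‖v‖/2, two parameters with equal image would satisfy ‖v‖·|b - a| ≤ ‖v‖/2·|b - a|: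
an immersion is locally injective. -/
theorem exists_injOn_shift (D : Diagram S m n) (x : OneManifold m n) :
    ∃ δ > 0, ∀ a ∈ shiftDom x, ∀ b ∈ shiftDom x, |a| < δ → |b| < δ →
      D.f (shift x a) = D.f (shift x b) → a = b := by
  have hv : 0 < ‖velocity D.f x‖ := norm_pos_iff.2 (D.immersion x)
  obtain ⟨δ, hδ, h⟩ := D.exists_norm_sub_sub_smul_velocity_le x rfl (half_pos hv)
  refine ⟨δ, hδ, fun a ha b hb ha' hb' hab => ?_⟩
  have := h a ha b hb ha' hb'
  rw [hab, sub_self, zero_sub, norm_neg, norm_smul, Real.norm_eq_abs] at this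
  by_contra hne
  have : 0 < |b - a| := abs_pos.2 (sub_ne_zero.2 (Ne.symm hne))
  nlinarith

variable [T2Space S]

/-- Every pair (a, b) has a neighbourhood containing at most one double pair: on the diagonal by
local injectivity, at a double point by transversality, and elsewhere because {f a = f b} is closed.
Compactness of the square of the source finishes the argument. -/
theorem finite_doublePairs (D : Diagram S m n) :
    {p : OneManifold m n × OneManifold m n | p.1 ≠ p.2 ∧ D.f p.1 = D.f p.2}.Finite := by
  have key : ∀ p : OneManifold m n × OneManifold m n, ∃ W ∈ 𝓝 p,
      (W ∩ {p : OneManifold m n × OneManifold m n | p.1 ≠ p.2 ∧ D.f p.1 = D.f p.2}).Finite := by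
    rintro ⟨a, b⟩
    by_cases hab : D.f a = D.f b
    · by_cases hne : a = b
      · subst hne
        obtain ⟨δ, hδ, h⟩ := D.exists_injOn_shift a
        refine ⟨_, prod_mem_nhds (shift_image_mem_nhds a hδ) (shift_image_mem_nhds a hδ), ?_⟩
        convert Set.finite_empty
        rw [Set.eq_empty_iff_forall_notMem]
        rintro ⟨-, -⟩ ⟨⟨⟨s, hs, rfl⟩, ⟨u, hu, rfl⟩⟩, h1, h2⟩
        exact h1 (congrArg (shift a) (h s hs.1 u hu.1 hs.2 hu.2 h2))
      · obtain ⟨c, hc, hc'⟩ := exists_le_norm_smul_sub_smul (D.transverse a b hne hab)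
        obtain ⟨δ, hδ, h⟩ := D.exists_eq_zero_of_le_norm D hab hc
        refine ⟨_, prod_mem_nhds (shift_image_mem_nhds a hδ) (shift_image_mem_nhds b hδ),
          (Set.finite_singleton (a, b)).subset ?_⟩
        rintro ⟨-, -⟩ ⟨⟨⟨s, hs, rfl⟩, ⟨u, hu, rfl⟩⟩, h1, h2⟩
        obtain ⟨rfl, rfl⟩ := h s hs.1 u hu.1 hs.2 hu.2 h2 (hc' s u)
        simp [shift_zero]
    · have hc : IsClosed {p : OneManifold m n × OneManifold m n | D.f p.1 = D.f p.2} :=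
        isClosed_eq (D.continuous.comp continuous_fst) (D.continuous.comp continuous_snd)
      refine ⟨_, hc.isOpen_compl.mem_nhds hab, ?_⟩
      convert Set.finite_empty
      rw [Set.eq_empty_iff_forall_notMem]
      rintro p ⟨h1, h2⟩
      exact h1 h2.2
  have := isCompact_univ (X := OneManifold m n × OneManifold m n) |>.induction_on
    (p := fun s => (s ∩ {p : OneManifold m n × OneManifold m n |
      p.1 ≠ p.2 ∧ D.f p.1 = D.f p.2}).Finite) (by simp)
    (fun s t hst ht => ht.subset (Set.inter_subset_inter_left _ hst))
    (fun s t hs ht => by rw [Set.union_inter_distrib_right]; exact hs.union ht)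
    (fun p _ => by rw [nhdsWithin_univ]; exact key p)
  simpa using this

theorem finite_doubleSet (D : Diagram S m n) : D.doubleSet.Finite := by
  refine (D.finite_doublePairs.image Prod.snd).subset ?_
  rintro x ⟨y, hy, h⟩
  exact ⟨(y, x), ⟨hy, h⟩, rfl⟩

instance finite_crossing (D : Diagram S m n) : Finite D.Crossing := by
  have := D.finite_doubleSet.to_subtype
  refine Finite.of_injective (β := D.doubleSet)
    (fun c => ⟨c.upper, c.lower, c.ne.symm, c.eq.symm⟩) fun c c' h => ?_
  exact Crossing.ext_of_upper (congrArg Subtype.val h)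

end Diagram

end Surface

end DoublePoints

/-! ### Counting the components of D(s) by colourings of half-branches -/

section StateColorings

variable {m n : ℕ}

/-- A two-colouring of the germs of half-branches of the source is locally constant if the colour of
the half-branch `(x, σ)` is the colour of all germs at the nearby points on the side `σ` of `x`. -/
def IsLocallyConstantColoring (χ : OneManifold m n × ℤˣ → Bool) : Prop :=
  ∀ x σ, ∀ᶠ y in halfBranch x σ, ∀ τ, χ (y, τ) = χ (x, σ)

theorem eventually_halfBranch_eq_or (x : OneManifold m n) (σ : ℤˣ) :
    (∀ᶠ y in halfBranch x σ, y ≠ x) ∨ x ∈ endPoints m n := by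
  by_cases hx : x ∈ endPoints m n
  · exact Or.inr hx
  left
  have hd := (mem_endPoints_iff x).1 hx
  rw [halfBranch, Filter.eventually_map]
  have h1 : Filter.Tendsto (fun s : ℝ => ((σ : ℤ) : ℝ) * s) (𝓝[>] 0) (𝓝 0) := by
    have : Continuous fun s : ℝ => ((σ : ℤ) : ℝ) * s := by fun_prop
    have := (this.tendsto 0).mono_left (nhdsWithin_le_nhds (s := Set.Ioi 0))
    simpa using this
  filter_upwards [h1 hd, h1 (Metric.ball_mem_nhds 0 one_pos), self_mem_nhdsWithin] with s hs hs1 hs2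
  intro h
  have h2 := shift_injOn x (u := 0) hs (zero_mem_shiftDom x) (by simpa using hs1)
    (by rw [h, shift_zero])
  rcases Int.units_eq_one_or σ with rfl | rfl <;> simp at h2 hs2 <;> linarith

section Surface

variable {S : Type*} [TopologicalSpace S] [ChartedSpace (EuclideanHalfSpace 2) S]

namespace Diagram

theorem Crossing.lower_notMem {D : Diagram S m n} (c : D.Crossing) : c.lower ∉ D.overSet :=
  (D.overSet_iff _ _ c.ne c.eq).1 c.upper_mem

theorem Crossing.upper_mem_doubleSet {D : Diagram S m n} (c : D.Crossing) :
    c.upper ∈ D.doubleSet :=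
  ⟨c.lower, c.ne.symm, c.eq.symm⟩

theorem Crossing.lower_mem_doubleSet {D : Diagram S m n} (c : D.Crossing) :
    c.lower ∈ D.doubleSet :=
  ⟨c.upper, c.ne, c.eq⟩

theorem Crossing.ext_of_lower {D : Diagram S m n} {c c' : D.Crossing} (h : c.lower = c'.lower) :
    c = c' := by
  refine Crossing.ext_of_upper ?_
  rcases D.double c.upper c.lower c'.upper c.eq (by rw [h, c'.eq]) with h' | h' | h'
  · exact absurd h' c.ne
  · exact absurd (h'.symm.trans h) c'.ne
  · exact h'

theorem exists_crossing (D : Diagram S m n) {x : OneManifold m n} (hx : x ∈ D.doubleSet) :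
    ∃ c : D.Crossing, (x ∈ D.overSet ∧ c.upper = x) ∨ (x ∉ D.overSet ∧ c.lower = x) := by
  obtain ⟨y, hy, h⟩ := hx
  by_cases hx : x ∈ D.overSet
  · exact ⟨⟨x, y, hy.symm, h.symm, hx⟩, Or.inl ⟨hx, rfl⟩⟩
  · exact ⟨⟨y, x, hy, h, (D.overSet_iff y x hy h).2 hx⟩, Or.inr ⟨hx, rfl⟩⟩

/-- A double point on ∂S would come from two end points, against injectivity there. Hence neither
half-branch at a preimage of a crossing is blocked. -/
theorem notMem_endPoints_of_mem_doubleSet (D : Diagram S m n) {x : OneManifold m n}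
    (hx : x ∈ D.doubleSet) : x ∉ endPoints m n := by
  obtain ⟨y, hy, h⟩ := hx
  intro hx
  have h1 : D.f x ∈ (𝓡∂ 2).boundary S := by
    rwa [← Set.mem_preimage, D.preimage_boundary]
  have h2 : y ∈ endPoints m n := by
    rw [← D.preimage_boundary, Set.mem_preimage, h]
    exact h1
  exact hy (D.injOn_boundary h2 hx h)

theorem eventually_notMem_doubleSet [T2Space S] (D : Diagram S m n) (x : OneManifold m n) :
    ∀ᶠ y in 𝓝 x, y ∈ D.doubleSet → y = x := by
  have : (D.doubleSet \ {x})ᶜ ∈ 𝓝 x :=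
    (D.finite_doubleSet.sdiff).isClosed.isOpen_compl.mem_nhds (by simp)
  filter_upwards [this] with y hy hy'
  by_contra h
  exact hy ⟨hy', h⟩

theorem eventually_halfBranch_notMem_doubleSet [T2Space S] (D : Diagram S m n) (x : OneManifold m n) (σ : ℤˣ)
    (hx : x ∈ D.doubleSet) : ∀ᶠ y in halfBranch x σ, y ∉ D.doubleSet := by
  rcases eventually_halfBranch_eq_or x σ with h | h
  · filter_upwards [h, halfBranch_le_nhds x σ (D.eventually_notMem_doubleSet x)] with y h1 h2 h3
    exact h1 (h2 h3)
  · exact absurd h (D.notMem_endPoints_of_mem_doubleSet hx)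

variable [IsManifold (𝓡∂ 2) ∞ S]

theorem splitEnd_eq_mul (o : SurfaceOrientation S) {D : Diagram S m n} (s : D.State)
    (c : D.Crossing) (σ : ℤˣ) : splitEnd o s c σ = splitEnd o s c 1 * σ := by
  unfold splitEnd
  cases s c <;> simp

theorem splitEnd_splitEnd (o : SurfaceOrientation S) {D : Diagram S m n} (s : D.State)
    (c : D.Crossing) (σ : ℤˣ) : splitEnd o s c (splitEnd o s c σ) = σ := by
  rw [splitEnd_eq_mul, splitEnd_eq_mul o s c σ, ← mul_assoc, Int.units_mul_self, one_mul]

/-- The locally constant colourings of the half-branches that are compatible with the splitting of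
the diagram by the state `s`. They are the locally constant colourings of `D(s)`. -/
def stateColorings (o : SurfaceOrientation S) (D : Diagram S m n) (s : D.State) :
    Set (OneManifold m n × ℤˣ → Bool) :=
  {χ | IsLocallyConstantColoring χ ∧ (∀ x ∉ D.doubleSet, χ (x, 1) = χ (x, -1)) ∧
    ∀ (c : D.Crossing) (σ : ℤˣ), χ (c.upper, σ) = χ (c.lower, splitEnd o s c σ)}

theorem stateColorings_apply {o : SurfaceOrientation S} {D : Diagram S m n} {s : D.State}
    {χ : OneManifold m n × ℤˣ → Bool} (hχ : χ ∈ D.stateColorings o s) {x : OneManifold m n}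
    (hx : x ∉ D.doubleSet) (σ : ℤˣ) : χ (x, σ) = χ (x, 1) := by
  rcases Int.units_eq_one_or σ with rfl | rfl
  · rfl
  · exact (hχ.2.1 x hx).symm

theorem Split.isOpen_iff {o : SurfaceOrientation S} {D : Diagram S m n} {s : D.State}
    {U : Set (D.Split o s)} :
    IsOpen U ↔ IsOpen {x : {x : OneManifold m n // x ∉ D.doubleSet} | Sum.inl x ∈ U} ∧
    ∀ c σ, Sum.inr (c, σ) ∈ U →
      (∀ᶠ x in halfBranch c.upper σ, ∀ h : x ∉ D.doubleSet, Sum.inl ⟨x, h⟩ ∈ U) ∧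
      (∀ᶠ x in halfBranch c.lower (splitEnd o s c σ),
        ∀ h : x ∉ D.doubleSet, Sum.inl ⟨x, h⟩ ∈ U) :=
  Iff.rfl

/-- The function on `D(s)` given by a colouring of the half-branches. -/
def splitColoring (o : SurfaceOrientation S) (D : Diagram S m n) (s : D.State)
    (χ : OneManifold m n × ℤˣ → Bool) : D.Split o s → Bool
  | .inl x => χ (x.1, 1)
  | .inr (c, σ) => χ (c.upper, σ)

/-- At a new point (c, σ) the topology asks for agreement along the two joined half-branches. Local
constancy of χ gives this along each of them, and the gluing condition makes the two colours equal.
-/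
theorem continuous_splitColoring {o : SurfaceOrientation S} {D : Diagram S m n} {s : D.State}
    {χ : OneManifold m n × ℤˣ → Bool} (hχ : χ ∈ D.stateColorings o s) :
    Continuous (splitColoring o D s χ) := by
  rw [continuous_discrete_rng]
  intro b
  rw [Split.isOpen_iff]
  refine ⟨?_, fun c σ h => ⟨?_, ?_⟩⟩
  · rw [isOpen_iff_mem_nhds]
    rintro ⟨x, hx⟩ hb
    change χ (x, 1) = b at hb
    have h2 : {y | χ (y, 1) = b} ∈ 𝓝 x := by
      rw [nhds_eq_sup_halfBranch]
      refine Filter.mem_sup.2 ⟨Filter.mem_sup.2 ⟨hb, ?_⟩, ?_⟩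
      · filter_upwards [hχ.1 x 1] with y hy
        rw [hy 1, hb]
      · filter_upwards [hχ.1 x (-1)] with y hy
        rw [hy 1, ← hχ.2.1 x hx, hb]
    exact continuousAt_subtype_val (x := (⟨x, hx⟩ : {x // x ∉ D.doubleSet})) h2
  · change χ (c.upper, σ) = b at h
    filter_upwards [hχ.1 c.upper σ] with y hy hy'
    change χ (y, 1) = b
    rw [hy 1, h]
  · change χ (c.upper, σ) = b at h
    filter_upwards [hχ.1 c.lower (splitEnd o s c σ)] with y hy hy'
    change χ (y, 1) = b
    rw [hy 1, ← hχ.2.2, h]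

open Classical in
/-- The colouring of the half-branches given by a function on `D(s)`. -/
def coloringOfSplit (o : SurfaceOrientation S) (D : Diagram S m n) (s : D.State)
    (F : D.Split o s → Bool) (g : OneManifold m n × ℤˣ) : Bool :=
  if h : g.1 ∈ D.doubleSet then
    F (.inr ((D.exists_crossing h).choose,
      if g.1 ∈ D.overSet then g.2 else splitEnd o s (D.exists_crossing h).choose g.2))
  else F (.inl ⟨g.1, h⟩)

theorem coloringOfSplit_upper (o : SurfaceOrientation S) (D : Diagram S m n) (s : D.State)
    (F : D.Split o s → Bool) (c : D.Crossing) (σ : ℤˣ) :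
    coloringOfSplit o D s F (c.upper, σ) = F (.inr (c, σ)) := by
  have h := c.upper_mem_doubleSet
  rw [coloringOfSplit, dif_pos h, if_pos c.upper_mem]
  rcases (D.exists_crossing h).choose_spec with ⟨-, h2⟩ | ⟨h2, -⟩
  · rw [Crossing.ext_of_upper h2]
  · exact absurd c.upper_mem h2

theorem coloringOfSplit_lower (o : SurfaceOrientation S) (D : Diagram S m n) (s : D.State)
    (F : D.Split o s → Bool) (c : D.Crossing) (σ : ℤˣ) :
    coloringOfSplit o D s F (c.lower, σ) = F (.inr (c, splitEnd o s c σ)) := by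
  have h := c.lower_mem_doubleSet
  rw [coloringOfSplit, dif_pos h, if_neg c.lower_notMem]
  rcases (D.exists_crossing h).choose_spec with ⟨h2, -⟩ | ⟨-, h2⟩
  · exact absurd h2 c.lower_notMem
  · rw [Crossing.ext_of_lower h2]

theorem coloringOfSplit_of_notMem (o : SurfaceOrientation S) (D : Diagram S m n) (s : D.State)
    (F : D.Split o s → Bool) {x : OneManifold m n} (hx : x ∉ D.doubleSet) (σ : ℤˣ) :
    coloringOfSplit o D s F (x, σ) = F (.inl ⟨x, hx⟩) := by
  rw [coloringOfSplit, dif_neg hx]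

/-- The points of `D(s)` away from the crossings. -/
def Split.regular (o : SurfaceOrientation S) (D : Diagram S m n) (s : D.State)
    (x : {x : OneManifold m n // x ∉ D.doubleSet}) : D.Split o s :=
  Sum.inl x

/-- The points of `D(s)` where the half-branches at the crossings are joined. -/
def Split.junction (o : SurfaceOrientation S) (D : Diagram S m n) (s : D.State)
    (p : D.Crossing × ℤˣ) : D.Split o s :=
  Sum.inr p

theorem Split.continuous_regular (o : SurfaceOrientation S) (D : Diagram S m n) (s : D.State) :
    Continuous (Split.regular o D s) :=
  ⟨fun _ hU => hU.1⟩

variable [T2Space S]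

theorem coloringOfSplit_mem (o : SurfaceOrientation S) (D : Diagram S m n) (s : D.State)
    {F : D.Split o s → Bool} (hF : Continuous F) :
    coloringOfSplit o D s F ∈ D.stateColorings o s := by
  have hF' := fun b => Split.isOpen_iff.1 ((continuous_discrete_rng.1 hF) b)
  refine ⟨fun x σ => ?_, fun x hx => ?_, fun c σ => ?_⟩
  · by_cases hx : x ∈ D.doubleSet
    · have h0 := D.eventually_halfBranch_notMem_doubleSet x σ hx
      obtain ⟨c, ⟨-, rfl⟩ | ⟨-, rfl⟩⟩ := D.exists_crossing hx
      · rw [coloringOfSplit_upper]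
        filter_upwards [h0, ((hF' (F (.inr (c, σ)))).2 c σ rfl).1] with y h1 h2 τ
        rw [coloringOfSplit_of_notMem _ _ _ _ h1]
        exact h2 h1
      · rw [coloringOfSplit_lower]
        have := ((hF' (F (.inr (c, splitEnd o s c σ)))).2 c _ rfl).2
        rw [splitEnd_splitEnd] at this
        filter_upwards [h0, this] with y h1 h2 τ
        rw [coloringOfSplit_of_notMem _ _ _ _ h1]
        exact h2 h1
    · rw [coloringOfSplit_of_notMem _ _ _ _ hx]
      have h1 := (hF' (F (.inl ⟨x, hx⟩))).1.mem_nhds (x := ⟨x, hx⟩) rfl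
      rw [nhds_subtype_eq_comap, Filter.mem_comap] at h1
      obtain ⟨V, hV, hV'⟩ := h1
      filter_upwards [halfBranch_le_nhds x σ hV, halfBranch_le_nhds x σ
        (D.finite_doubleSet.isClosed.isOpen_compl.mem_nhds hx)] with y h2 h3 τ
      rw [coloringOfSplit_of_notMem _ _ _ _ h3]
      exact hV' (show (⟨y, h3⟩ : {x : OneManifold m n // x ∉ D.doubleSet}) ∈ Subtype.val ⁻¹' V
        from h2)
  · rw [coloringOfSplit_of_notMem _ _ _ _ hx, coloringOfSplit_of_notMem _ _ _ _ hx]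
  · rw [coloringOfSplit_upper, coloringOfSplit_lower, splitEnd_splitEnd]

/-- The compatible colourings of the half-branches are the continuous functions `D(s) → Bool`. -/
def stateColoringsEquiv (o : SurfaceOrientation S) (D : Diagram S m n) (s : D.State) :
    D.stateColorings o s ≃ C(D.Split o s, Bool) where
  toFun χ := ⟨splitColoring o D s χ, continuous_splitColoring χ.2⟩
  invFun F := ⟨coloringOfSplit o D s F, coloringOfSplit_mem o D s F.continuous⟩
  left_inv := by
    rintro ⟨χ, hχ⟩
    ext ⟨x, σ⟩
    simp only [ContinuousMap.coe_mk]
    by_cases hx : x ∈ D.doubleSet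
    · obtain ⟨c, ⟨-, rfl⟩ | ⟨-, rfl⟩⟩ := D.exists_crossing hx
      · rw [coloringOfSplit_upper]; rfl
      · rw [coloringOfSplit_lower]
        change χ (c.upper, _) = _
        rw [hχ.2.2, splitEnd_splitEnd]
    · rw [coloringOfSplit_of_notMem _ _ _ _ hx]
      exact (stateColorings_apply hχ hx σ).symm
  right_inv := by
    intro F
    ext y
    rcases y with ⟨x, hx⟩ | ⟨c, σ⟩
    · exact coloringOfSplit_of_notMem _ _ _ _ hx _
    · exact coloringOfSplit_upper _ _ _ _ _ _

/-- The source is covered by finitely many sets, each consisting of a point and two short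
half-branches, and each such piece meets only finitely many components. The finitely many new points
add finitely many more. This avoids showing that D(s) is a compact 1-manifold. -/
instance finite_connectedComponents_split (o : SurfaceOrientation S) (D : Diagram S m n)
    (s : D.State) : Finite (ConnectedComponents (D.Split o s)) := by
  -- A sufficiently short half-branch, without its base point, contains no preimage of a double
  -- point, so it maps continuously from an interval into D(s) and lies in one component.
  have hbranch : ∀ (x : OneManifold m n) (σ : ℤˣ), ∃ δ > 0, ∀ (B : Set (D.Split o s)),
      B = {y | ∃ (u : ℝ) (h : shift x (((σ : ℤ) : ℝ) * u) ∉ D.doubleSet),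
        0 < u ∧ u < δ ∧ y = Split.regular o D s ⟨_, h⟩} →
      (ConnectedComponents.mk '' B).Finite := by
    intro x σ
    by_cases hfree : ∃ δ > 0, ∀ u : ℝ, 0 < u → u < δ → shift x (((σ : ℤ) : ℝ) * u) ∉ D.doubleSet
    · obtain ⟨δ, hδ, h⟩ := hfree
      refine ⟨δ, hδ, fun B hB => ?_⟩
      have hB' : IsPreconnected B := by
        let F : Set.Ioo (0 : ℝ) δ → D.Split o s := fun u =>
          Split.regular o D s ⟨shift x (((σ : ℤ) : ℝ) * u), h u u.2.1 u.2.2⟩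
        have hF : Continuous F := (Split.continuous_regular o D s).comp
          (Continuous.subtype_mk ((continuous_shift x).comp (by fun_prop)) _)
        have : B = Set.range F := by
          rw [hB]
          ext y
          constructor
          · rintro ⟨u, h, h1, h2, rfl⟩
            exact ⟨⟨u, h1, h2⟩, rfl⟩
          · rintro ⟨⟨u, h1, h2⟩, rfl⟩
            exact ⟨u, _, h1, h2, rfl⟩
        rw [this]
        have := Subtype.preconnectedSpace (isPreconnected_Ioo (a := (0 : ℝ)) (b := δ))
        exact isPreconnected_range hF
      refine Set.Subsingleton.finite ?_
      rintro _ ⟨y, hy, rfl⟩ _ ⟨z, hz, rfl⟩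
      rw [ConnectedComponents.coe_eq_coe']
      exact hB'.subset_connectedComponent hz hy
    · exfalso
      apply hfree
      have h1 : ∀ᶠ y in halfBranch x σ, y ∉ D.doubleSet := by
        by_cases hx : x ∈ D.doubleSet
        · exact D.eventually_halfBranch_notMem_doubleSet x σ hx
        · exact halfBranch_le_nhds x σ (D.finite_doubleSet.isClosed.isOpen_compl.mem_nhds hx)
      rw [halfBranch, Filter.eventually_map, eventually_nhdsWithin_iff,
        Metric.eventually_nhds_iff] at h1
      obtain ⟨δ, hδ, h⟩ := h1
      refine ⟨δ, hδ, fun u hu hu' => h (by simpa [abs_of_pos hu] using hu') hu⟩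
  have hloc : ∀ x : OneManifold m n, ∃ W ∈ 𝓝 x, (ConnectedComponents.mk ''
      {y : D.Split o s | ∃ z : {x : OneManifold m n // x ∉ D.doubleSet},
        z.1 ∈ W ∧ y = Split.regular o D s z}).Finite := by
    intro x
    obtain ⟨δ₁, hδ₁, h₁⟩ := hbranch x 1
    obtain ⟨δ₂, hδ₂, h₂⟩ := hbranch x (-1)
    refine ⟨_, shift_image_mem_nhds x (lt_min hδ₁ hδ₂), ?_⟩
    have h3 : (ConnectedComponents.mk '' {y : D.Split o s |
        ∃ h : x ∉ D.doubleSet, y = Split.regular o D s ⟨x, h⟩}).Finite := by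
      refine Set.Subsingleton.finite ?_
      rintro _ ⟨y, ⟨_, rfl⟩, rfl⟩ _ ⟨z, ⟨_, rfl⟩, rfl⟩
      rfl
    refine (((h₁ _ rfl).union (h₂ _ rfl)).union h3).subset ?_
    rw [← Set.image_union, ← Set.image_union]
    refine Set.image_mono ?_
    rintro _ ⟨⟨_, hz⟩, ⟨u, ⟨-, hu⟩, rfl⟩, rfl⟩
    rcases lt_trichotomy u 0 with hu0 | rfl | hu0
    · left; right
      rw [abs_of_neg hu0] at hu
      refine ⟨-u, by simpa using hz, by linarith, hu.trans_le (min_le_right _ _), ?_⟩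
      congr 2
      simp
    · right
      refine ⟨by simpa [shift_zero] using hz, ?_⟩
      congr 2
      exact shift_zero x
    · left; left
      rw [abs_of_pos hu0] at hu
      refine ⟨u, by simpa using hz, by linarith, hu.trans_le (min_le_left _ _), ?_⟩
      congr 2
      simp
  have hall := isCompact_univ (X := OneManifold m n) |>.induction_on
    (p := fun W => (ConnectedComponents.mk ''
      {y : D.Split o s | ∃ z : {x : OneManifold m n // x ∉ D.doubleSet},
        z.1 ∈ W ∧ y = Split.regular o D s z}).Finite) (by simp)
    (fun s t hst ht => ht.subset (Set.image_mono (by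
      rintro _ ⟨z, hz, rfl⟩; exact ⟨z, hst hz, rfl⟩)))
    (fun s t hs ht => by
      refine (hs.union ht).subset ?_
      rw [← Set.image_union]
      refine Set.image_mono ?_
      rintro _ ⟨z, hz | hz, rfl⟩
      · exact Or.inl ⟨z, hz, rfl⟩
      · exact Or.inr ⟨z, hz, rfl⟩)
    (fun x _ => by rw [nhdsWithin_univ]; exact hloc x)
  have hcr : (Set.range fun p : D.Crossing × ℤˣ =>
      ConnectedComponents.mk (Split.junction o D s p)).Finite := Set.finite_range _
  rw [← Set.finite_univ_iff]
  refine (hall.union hcr).subset ?_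
  intro k _
  obtain ⟨y, rfl⟩ := ConnectedComponents.surjective_coe k
  rcases y with z | p
  · exact Or.inl ⟨_, ⟨z, trivial, rfl⟩, rfl⟩
  · exact Or.inr ⟨p, rfl⟩

instance nonempty_split (o : SurfaceOrientation S) (D : Diagram S m n) (s : D.State) :
    Nonempty (D.Split o s) := by
  have : Nonempty (OneManifold m n) := by
    have := D.nonempty
    rcases Nat.eq_zero_or_pos m with h | h
    · exact ⟨.inr (⟨0, by omega⟩, 0)⟩
    · exact ⟨.inl (⟨0, h⟩, 0)⟩
  obtain ⟨x⟩ := this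
  by_cases hx : x ∈ D.doubleSet
  · obtain ⟨c, -⟩ := D.exists_crossing hx
    exact ⟨Sum.inr (c, 1)⟩
  · exact ⟨Sum.inl ⟨x, hx⟩⟩

/-- Positivity ensures that the truncated exponent `mu - 1` in the bracket is the true one, so that
one more circle really gives one more factor δ. -/
theorem mu_pos (o : SurfaceOrientation S) (D : Diagram S m n) (s : D.State) : 0 < D.mu o s :=
  Nat.card_pos_iff.2 ⟨inferInstance, inferInstance⟩

/-- Components are closed; if there are finitely many, each is also open as the complement of the
union of the others. So the space of components is discrete, and any Boolean function on it is
continuous. -/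
theorem _root_.GenLink.card_continuousMap_bool (Y : Type*) [TopologicalSpace Y]
    [Finite (ConnectedComponents Y)] :
    Nat.card C(Y, Bool) = 2 ^ Nat.card (ConnectedComponents Y) := by
  have : DiscreteTopology (ConnectedComponents Y) := by
    rw [ConnectedComponents.discreteTopology_iff]
    intro x
    rw [← connectedComponents_preimage_singleton]
    have hc : ∀ k : ConnectedComponents Y, IsClosed (ConnectedComponents.mk ⁻¹' {k}) := by
      intro k
      obtain ⟨y, rfl⟩ := ConnectedComponents.surjective_coe k
      rw [connectedComponents_preimage_singleton]
      exact isClosed_connectedComponent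
    rw [← isClosed_compl_iff]
    have : (ConnectedComponents.mk ⁻¹' {(x : ConnectedComponents Y)})ᶜ
        = ⋃ k : {k : ConnectedComponents Y // k ≠ x}, ConnectedComponents.mk ⁻¹' {k.1} := by
      ext y
      simp
    rw [this]
    exact isClosed_iUnion_of_finite fun k => hc _
  let e : C(Y, Bool) ≃ (ConnectedComponents Y → Bool) :=
    { toFun := fun F => F.continuous.connectedComponentsLift
      invFun := fun G => ⟨G ∘ ConnectedComponents.mk,
        continuous_of_discreteTopology.comp ConnectedComponents.continuous_coe⟩
      left_inv := fun F => by ext y; simp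
      right_inv := fun G => by
        ext k
        obtain ⟨y, rfl⟩ := ConnectedComponents.surjective_coe k
        simp }
  rw [Nat.card_congr e, Nat.card_fun]
  simp

theorem card_stateColorings (o : SurfaceOrientation S) (D : Diagram S m n) (s : D.State) :
    Nat.card (D.stateColorings o s) = 2 ^ D.mu o s := by
  rw [Nat.card_congr (stateColoringsEquiv o D s), card_continuousMap_bool]
  rfl

end Diagram

end Surface

end StateColorings

/-! ### Transport of brackets and writhes along bijections of half-branches -/

section GermIsomorphisms

variable {m n m' n' : ℕ}

section Surface

variable {S : Type*} [TopologicalSpace S] [ChartedSpace (EuclideanHalfSpace 2) S]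
  [IsManifold (𝓡∂ 2) ∞ S]

namespace Diagram

theorem bracket_eq_of_equiv {o : SurfaceOrientation S} {D : Diagram S m n} {D' : Diagram S m' n'}
    (e : D.Crossing ≃ D'.Crossing) (h : ∀ s : D'.State, D.mu o (s ∘ e) = D'.mu o s) :
    D.bracket o = D'.bracket o := by
  unfold bracket
  rw [← finsum_comp_equiv (e.symm.arrowCongr (Equiv.refl SplitType))]
  refine finsum_congr fun s => ?_
  have h0 : (e.symm.arrowCongr (Equiv.refl SplitType)) s = s ∘ e := by
    ext c; simp
  have hα : D.alpha (s ∘ e) = D'.alpha s :=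
    Nat.card_congr (e.subtypeEquiv fun c => Iff.rfl)
  have hβ : D.beta (s ∘ e) = D'.beta s :=
    Nat.card_congr (e.subtypeEquiv fun c => Iff.rfl)
  rw [h0, h, hα, hβ]

theorem writhe_eq_of_equiv {o : SurfaceOrientation S} {D : Diagram S m n} {D' : Diagram S m' n'}
    (e : D.Crossing ≃ D'.Crossing) (h : ∀ c : D.Crossing, (e c).sign o = c.sign o) :
    D.writhe o = D'.writhe o := by
  unfold writhe
  rw [← finsum_comp_equiv e]
  exact finsum_congr fun c => by rw [h]

/-- An identification of the sources of two diagrams that respects the half-branches, the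
crossings and, up to the change `ε` of the local orientations, their signs. -/
structure GermIso (o : SurfaceOrientation S) (D : Diagram S m n) (D' : Diagram S m' n') where
  φ : OneManifold m n ≃ OneManifold m' n'
  ε : OneManifold m n → ℤˣ
  tendsto : ∀ x σ, Filter.Tendsto φ (halfBranch x σ) (halfBranch (φ x) (ε x * σ))
  tendsto_symm : ∀ x σ, Filter.Tendsto φ.symm (halfBranch (φ x) (ε x * σ)) (halfBranch x σ)
  eq_iff : ∀ x y, D'.f (φ x) = D'.f (φ y) ↔ D.f x = D.f y
  over_iff : ∀ x ∈ D.doubleSet, φ x ∈ D'.overSet ↔ x ∈ D.overSet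
  sign : ∀ (c : D.Crossing) (c' : D'.Crossing), c'.upper = φ c.upper → c'.lower = φ c.lower →
    c'.sign o = ε c.upper * ε c.lower * c.sign o

namespace GermIso

variable {o : SurfaceOrientation S} {D : Diagram S m n} {D' : Diagram S m' n'}

theorem mem_doubleSet_iff (i : GermIso o D D') (x : OneManifold m n) :
    i.φ x ∈ D'.doubleSet ↔ x ∈ D.doubleSet := by
  constructor
  · rintro ⟨y, hy, h⟩
    refine ⟨i.φ.symm y, fun h' => hy ?_, (i.eq_iff _ _).1 (by simpa using h)⟩
    rw [← h', Equiv.apply_symm_apply]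
  · rintro ⟨y, hy, h⟩
    exact ⟨i.φ y, fun h' => hy (i.φ.injective h'), (i.eq_iff _ _).2 h⟩

/-- The induced bijection of the crossings. -/
def crossingEquiv (i : GermIso o D D') : D.Crossing ≃ D'.Crossing where
  toFun c := ⟨i.φ c.upper, i.φ c.lower, fun h => c.ne (i.φ.injective h), (i.eq_iff _ _).2 c.eq,
    (i.over_iff _ c.upper_mem_doubleSet).2 c.upper_mem⟩
  invFun c := ⟨i.φ.symm c.upper, i.φ.symm c.lower, fun h => c.ne (i.φ.symm.injective h),
    (i.eq_iff _ _).1 (by simpa using c.eq), by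
      rw [← i.over_iff _ ((i.mem_doubleSet_iff _).1 (by simpa using c.upper_mem_doubleSet))]
      simpa using c.upper_mem⟩
  left_inv c := Crossing.ext_of_upper (by simp)
  right_inv c := Crossing.ext_of_upper (by simp)

theorem sign_crossingEquiv (i : GermIso o D D') (c : D.Crossing) :
    (i.crossingEquiv c).sign o = i.ε c.upper * i.ε c.lower * c.sign o :=
  i.sign _ _ rfl rfl

/-- The induced bijection of the half-branches. -/
def germEquiv (i : GermIso o D D') : OneManifold m n × ℤˣ ≃ OneManifold m' n' × ℤˣ where
  toFun g := (i.φ g.1, i.ε g.1 * g.2)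
  invFun g := (i.φ.symm g.1, i.ε (i.φ.symm g.1) * g.2)
  left_inv g := by simp [← mul_assoc]
  right_inv g := by simp [← mul_assoc]

/-- Reversing an arc changes both the sign of the crossing and the names of the half-branches on
that arc. These effects cancel, so a splitting type joins the same half-branches whatever the
orientations. This is why the bracket needs no orientation of the diagram. -/
theorem splitEnd_crossingEquiv (i : GermIso o D D') (s : D'.State) (c : D.Crossing) (σ : ℤˣ) :
    splitEnd o s (i.crossingEquiv c) (i.ε c.upper * σ)
      = i.ε c.lower * splitEnd o (s ∘ i.crossingEquiv) c σ := by
  have h : i.ε c.upper * i.ε c.lower * c.sign o * (i.ε c.upper * σ)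
      = i.ε c.lower * (c.sign o * σ) := by
    calc _ = (i.ε c.upper * i.ε c.upper) * (i.ε c.lower * (c.sign o * σ)) := by ac_rfl
      _ = _ := by rw [Int.units_mul_self, one_mul]
  unfold splitEnd
  rw [sign_crossingEquiv, h, Function.comp_apply]
  cases s (i.crossingEquiv c)
  · simp
  · simp

theorem comp_germEquiv_mem_iff (i : GermIso o D D') (s : D'.State)
    (χ : OneManifold m' n' × ℤˣ → Bool) :
    χ ∘ i.germEquiv ∈ D.stateColorings o (s ∘ i.crossingEquiv) ↔ χ ∈ D'.stateColorings o s := by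
  refine and_congr ?_ (and_congr ?_ ?_)
  · constructor
    · intro h x' σ'
      obtain ⟨⟨x, σ⟩, hx⟩ := i.germEquiv.surjective (x', σ')
      obtain ⟨rfl, rfl⟩ := Prod.ext_iff.1 hx
      have := i.tendsto_symm x σ (h x σ)
      filter_upwards [this] with y hy τ
      have h2 := hy (i.ε (i.φ.symm y) * τ)
      simpa [germEquiv, ← mul_assoc] using h2
    · intro h x σ
      filter_upwards [i.tendsto x σ (h (i.φ x) (i.ε x * σ))] with y hy τ
      exact hy _
  · rw [← i.φ.forall_congr_right]
    refine forall_congr' fun x => ?_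
    rw [i.mem_doubleSet_iff]
    refine imp_congr_right fun _ => ?_
    simp only [Function.comp_apply, germEquiv, Equiv.coe_fn_mk, mul_one]
    rcases Int.units_eq_one_or (i.ε x) with h | h <;> rw [h] <;> simp [eq_comm]
  · rw [← i.crossingEquiv.forall_congr_right]
    refine forall_congr' fun c => ?_
    rw [← (Equiv.mulLeft (i.ε c.upper)).forall_congr_right (q := fun σ => χ (_, σ) = _)]
    refine forall_congr' fun σ => ?_
    rw [Equiv.coe_mulLeft, splitEnd_crossingEquiv]
    rfl

variable [T2Space S]

/-- Pulling back along `germEquiv` is a bijection of compatible colourings, so both sides have the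
same power of two. -/
theorem mu_eq (i : GermIso o D D') (s : D'.State) :
    D.mu o (s ∘ i.crossingEquiv) = D'.mu o s := by
  refine Nat.pow_right_injective le_rfl ?_
  change 2 ^ _ = 2 ^ _
  rw [← card_stateColorings, ← card_stateColorings]
  refine (Nat.card_congr ((i.germEquiv.symm.arrowCongr (Equiv.refl Bool)).subtypeEquiv
    fun χ => ?_)).symm
  rw [← i.comp_germEquiv_mem_iff]
  rfl

theorem bracket_eq (i : GermIso o D D') : D.bracket o = D'.bracket o :=
  bracket_eq_of_equiv i.crossingEquiv i.mu_eq

/-- Only the writhe depends on the orientations. With ε = 1 everywhere the crossing signs are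
preserved one by one. -/
theorem kauffmanJones_eq (i : GermIso o D D') (h : ∀ x, i.ε x = 1) :
    D.kauffmanJones o = D'.kauffmanJones o := by
  rw [kauffmanJones, kauffmanJones, i.bracket_eq, writhe_eq_of_equiv i.crossingEquiv]
  intro c
  rw [sign_crossingEquiv, h, h, one_mul, one_mul]

end GermIso

end Diagram

end Surface

end GermIsomorphisms

/-! ### Two presentations of the same diagram -/

section SameDiagrams

variable {m' n' m n : ℕ}

/-! ### End points and half-branches -/

theorem tendsto_unit_mul (σ : ℤˣ) :
    Filter.Tendsto (fun s : ℝ => ((σ : ℤ) : ℝ) * s) (𝓝[>] 0) (𝓝 0) := by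
  have : Continuous fun s : ℝ => ((σ : ℤ) : ℝ) * s := by fun_prop
  simpa using (this.tendsto 0).mono_left (nhdsWithin_le_nhds (s := Set.Ioi 0))

/-- The side σ is the one on which the movement is clamped at the end point; the other side is free.
-/
theorem exists_halfBranch_eq_pure {x : OneManifold m n} (hx : x ∈ endPoints m n) :
    ∃ σ : ℤˣ, halfBranch x σ = pure x ∧
      ∀ᶠ s : ℝ in 𝓝[>] 0, (((-σ : ℤˣ) : ℤ) : ℝ) * s ∈ shiftDom x := by
  have h1 : ∀ᶠ s : ℝ in 𝓝[>] 0, 0 < s ∧ s < 1 := Ioo_mem_nhdsGT one_pos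
  have hpure : ∀ (g : ℝ → OneManifold m n), (∀ᶠ s : ℝ in 𝓝[>] 0, g s = x) →
      Filter.map g (𝓝[>] 0) = pure x := fun g hg => by
    rw [Filter.map_congr (m₂ := fun _ => x) hg, Filter.map_const]
  obtain ⟨i, rfl | rfl⟩ := hx
  · refine ⟨-1, hpure _ ?_, ?_⟩
    · filter_upwards [h1] with s hs
      simp only [shift, Sum.inl.injEq, Prod.mk.injEq, true_and]
      refine Set.projIcc_of_le_left _ ?_
      simpa using hs.1.le
    · filter_upwards [h1] with s hs
      simp [shiftDom, hs.1.le, hs.2.le]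
  · refine ⟨1, hpure _ ?_, ?_⟩
    · filter_upwards [h1] with s hs
      simp only [shift, Sum.inl.injEq, Prod.mk.injEq, true_and]
      refine Set.projIcc_of_right_le _ ?_
      simpa using hs.1.le
    · filter_upwards [h1] with s hs
      simp [shiftDom, hs.1.le, hs.2.le]

theorem eventually_halfBranch_ne {x : OneManifold m n} {σ : ℤˣ}
    (h : ∀ᶠ s : ℝ in 𝓝[>] 0, ((σ : ℤ) : ℝ) * s ∈ shiftDom x) : ∀ᶠ y in halfBranch x σ, y ≠ x := by
  rw [halfBranch, Filter.eventually_map]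
  filter_upwards [h, tendsto_unit_mul σ (Metric.ball_mem_nhds 0 one_pos), self_mem_nhdsWithin]
    with s hs hs1 hs2 heq
  have h2 := shift_injOn x (u := 0) hs (zero_mem_shiftDom x) (by simpa using hs1)
    (by rw [heq, shift_zero])
  rcases Int.units_eq_one_or σ with rfl | rfl <;> simp at h2 hs2 <;> linarith

theorem eventually_mem_shiftDom_of_notMem_endPoints {x : OneManifold m n}
    (hx : x ∉ endPoints m n) (σ : ℤˣ) :
    ∀ᶠ s : ℝ in 𝓝[>] 0, ((σ : ℤ) : ℝ) * s ∈ shiftDom x :=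
  tendsto_unit_mul σ ((mem_endPoints_iff x).1 hx)

/-- At every point at least one half-branch is not blocked, so the source has no isolated points.
The limit argument in `exists_tangent` relies on this. -/
instance nhdsNE_neBot (x : OneManifold m n) : (𝓝[≠] x).NeBot := by
  obtain ⟨σ, hσ⟩ : ∃ σ : ℤˣ, ∀ᶠ s : ℝ in 𝓝[>] 0, ((σ : ℤ) : ℝ) * s ∈ shiftDom x := by
    by_cases hx : x ∈ endPoints m n
    · obtain ⟨σ, -, h⟩ := exists_halfBranch_eq_pure hx
      exact ⟨-σ, h⟩
    · exact ⟨1, eventually_mem_shiftDom_of_notMem_endPoints hx 1⟩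
  refine (halfBranch_neBot x σ).mono (le_inf (halfBranch_le_nhds x σ) ?_)
  rw [Filter.le_principal_iff]
  exact eventually_halfBranch_ne hσ

/-! ### Plane vectors -/

/-- The sign of a nonzero real number. -/
def unitSign (r : ℝ) : ℤˣ := if 0 < r then 1 else -1

theorem unitSign_of_pos {r : ℝ} (h : 0 < r) : unitSign r = 1 := if_pos h

theorem unitSign_of_neg {r : ℝ} (h : r < 0) : unitSign r = -1 := if_neg h.le.not_gt

theorem unitSign_mul {a b : ℝ} (ha : a ≠ 0) (hb : b ≠ 0) :
    unitSign (a * b) = unitSign a * unitSign b := by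
  rcases lt_or_gt_of_ne ha with ha | ha <;> rcases lt_or_gt_of_ne hb with hb | hb
  · rw [unitSign_of_pos (mul_pos_of_neg_of_neg ha hb), unitSign_of_neg ha, unitSign_of_neg hb]
    simp
  · rw [unitSign_of_neg (mul_neg_of_neg_of_pos ha hb), unitSign_of_neg ha, unitSign_of_pos hb]
    simp
  · rw [unitSign_of_neg (mul_neg_of_pos_of_neg ha hb), unitSign_of_pos ha, unitSign_of_neg hb]
    simp
  · rw [unitSign_of_pos (mul_pos ha hb), unitSign_of_pos ha, unitSign_of_pos hb]
    simp

theorem unitSign_intCast (σ : ℤˣ) : unitSign ((σ : ℤ) : ℝ) = σ := by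
  rcases Int.units_eq_one_or σ with rfl | rfl
  · exact unitSign_of_pos (by simp)
  · exact unitSign_of_neg (by simp)

theorem intCast_unit_ne_zero (σ : ℤˣ) : ((σ : ℤ) : ℝ) ≠ 0 := by
  rcases Int.units_eq_one_or σ with rfl | rfl <;> simp

theorem det2_ne_zero {v w : EuclideanSpace ℝ (Fin 2)} (h : LinearIndependent ℝ ![v, w]) :
    det2 v w ≠ 0 := by
  rw [LinearIndependent.pair_iff] at h
  intro hd
  unfold det2 at hd
  have h0 := h (w 0) (-v 0) (by
    ext i; fin_cases i
    · simp; ring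
    · simp; linarith)
  have h1 := h (w 1) (-v 1) (by
    ext i; fin_cases i
    · simp; linarith
    · simp; ring)
  have hw : w = 0 := by ext i; fin_cases i <;> simp [h0.1, h1.1]
  have := h 0 1 (by simp [hw])
  simp at this

theorem exists_smul_of_not_linearIndependent {F : Type*} [AddCommGroup F] [Module ℝ F] {v w : F}
    (hv : v ≠ 0) (hw : w ≠ 0) (h : ¬ LinearIndependent ℝ ![v, w]) :
    ∃ l : ℝ, l ≠ 0 ∧ w = l • v := by
  rw [LinearIndependent.pair_iff' hv] at h
  push Not at h
  obtain ⟨l, hl⟩ := h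
  refine ⟨l, ?_, hl.symm⟩
  rintro rfl
  exact hw (by rw [← hl, zero_smul])

open Classical in
/-- The sign that tells whether two parallel vectors point in the same direction. -/
def directionSign (v w : EuclideanSpace ℝ (Fin 2)) : ℤˣ := if SameRay ℝ v w then 1 else -1

theorem directionSign_comm (v w : EuclideanSpace ℝ (Fin 2)) :
    directionSign v w = directionSign w v := by
  unfold directionSign
  congr 1
  exact propext SameRay.sameRay_comm

theorem directionSign_smul {v : EuclideanSpace ℝ (Fin 2)} (hv : v ≠ 0) {l : ℝ} (hl : l ≠ 0) :
    directionSign v (l • v) = unitSign l := by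
  unfold directionSign unitSign
  split_ifs with h1 h2 h2
  · rfl
  · exfalso
    have hl' : l < 0 := lt_of_le_of_ne (not_lt.1 h2) hl
    have h3 : SameRay ℝ v (-v) := by
      have := h1.trans (SameRay.sameRay_nonneg_smul_left (l • v) (neg_pos.2 (inv_lt_zero.2 hl')).le).symm
        (fun h => by simp [hl, hv] at h)
      rwa [smul_smul, neg_mul, inv_mul_cancel₀ hl, neg_one_smul] at this
    exact hv (eq_zero_of_sameRay_self_neg h3)
  · exact absurd (SameRay.sameRay_nonneg_smul_right v h2.le) h1
  · rfl

theorem directionSign_eq_one {v w : EuclideanSpace ℝ (Fin 2)} (h : SameRay ℝ v w) :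
    directionSign v w = 1 := if_pos h

section Surface

variable {S : Type*} [TopologicalSpace S] [ChartedSpace (EuclideanHalfSpace 2) S]

namespace Diagram

theorem Crossing.sign_eq [IsManifold (𝓡∂ 2) ∞ S] (o : SurfaceOrientation S) {D : Diagram S m n}
    (c : D.Crossing) : c.sign o = o.sign (D.f c.upper) *
      unitSign (det2 (velocity D.f c.upper) (velocity D.f c.lower)) := by
  rw [← unitSign_intCast (o.sign _), ← unitSign_mul (intCast_unit_ne_zero _)
    (det2_ne_zero (D.transverse _ _ c.ne c.eq))]
  unfold Crossing.sign SurfaceOrientation.Positive unitSign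
  congr

/-- At `x` and `x'` the two diagrams pass through the same point with the same tangent line. -/
def Tangent (D : Diagram S m n) (D' : Diagram S m' n') (x : OneManifold m n)
    (x' : OneManifold m' n') : Prop :=
  D.f x = D'.f x' ∧ ¬ LinearIndependent ℝ ![velocity D.f x, velocity D'.f x']

variable {D : Diagram S m n} {D' : Diagram S m' n'}

theorem Tangent.exists_smul {x : OneManifold m n} {x' : OneManifold m' n'} (h : D.Tangent D' x x') :
    ∃ l : ℝ, l ≠ 0 ∧ velocity D'.f x' = l • velocity D.f x :=
  exists_smul_of_not_linearIndependent (D.immersion x) (D'.immersion x') h.2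

theorem Tangent.symm {x : OneManifold m n} {x' : OneManifold m' n'} (h : D.Tangent D' x x') :
    D'.Tangent D x' x :=
  ⟨h.1.symm, fun h' => h.2 (LinearIndependent.pair_symm_iff.1 h')⟩

/-- Two distinct points of the second source over the same point of S have independent velocities,
so they cannot both be parallel to one vector. -/
theorem Tangent.unique {x : OneManifold m n} {x' x'' : OneManifold m' n'} (h : D.Tangent D' x x')
    (h' : D.Tangent D' x x'') : x' = x'' := by
  by_contra hne
  have hli := D'.transverse x' x'' hne (h.1.symm.trans h'.1)
  obtain ⟨l, hl, e⟩ := h.exists_smul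
  obtain ⟨l', hl', e'⟩ := h'.exists_smul
  rw [e, e', LinearIndependent.pair_iff] at hli
  have := hli l' (-l) (by rw [smul_smul, smul_smul, ← add_smul]; simp [mul_comm])
  exact hl' this.1

theorem eventually_eq_of_linearIndependent {x : OneManifold m n} {x' : OneManifold m' n'}
    (h : D.f x = D'.f x') (h' : LinearIndependent ℝ ![velocity D.f x, velocity D'.f x']) :
    ∀ᶠ p : OneManifold m n × OneManifold m' n' in 𝓝 x ×ˢ 𝓝 x',
      D.f p.1 = D'.f p.2 → p.1 = x ∧ p.2 = x' := by
  obtain ⟨c, hc, hc'⟩ := exists_le_norm_smul_sub_smul h'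
  obtain ⟨δ, hδ, H⟩ := D.exists_eq_zero_of_le_norm D' h hc
  refine Filter.mem_of_superset (Filter.prod_mem_prod (shift_image_mem_nhds x hδ)
    (shift_image_mem_nhds x' hδ)) ?_
  rintro ⟨-, -⟩ ⟨⟨s, hs, rfl⟩, ⟨u, hu, rfl⟩⟩ he
  obtain ⟨rfl, rfl⟩ := H s hs.1 u hu.1 hs.2 hu.2 he (hc' s u)
  exact ⟨shift_zero _, shift_zero _⟩

/-- Let the velocities be v and l·v. If nearby parameters s and u have the same image but s and l·u
had opposite signs, then |s - l·u| = |s| + |l||u|, and the branches would separate at linear speed.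
So matched points lie on corresponding sides. -/
theorem Tangent.exists_mul_pos {x : OneManifold m n} {x' : OneManifold m' n'}
    (h : D.Tangent D' x x') :
    ∃ δ > 0, ∀ s ∈ shiftDom x, ∀ u ∈ shiftDom x', |s| < δ → |u| < δ → s ≠ 0 →
      D.f (shift x s) = D'.f (shift x' u) →
      0 < s * (((directionSign (velocity D.f x) (velocity D'.f x') : ℤ) : ℝ) * u) := by
  obtain ⟨l, hl, e⟩ := h.exists_smul
  have hv : 0 < ‖velocity D.f x‖ := norm_pos_iff.2 (D.immersion x)
  -- Chosen so that c(|s| + |u|) ≤ (|s| + |l||u|)·‖v‖, the separation that opposite signs would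
  -- force.
  set c := min 1 |l| * ‖velocity D.f x‖
  have hc : 0 < c := mul_pos (lt_min one_pos (abs_pos.2 hl)) hv
  obtain ⟨δ₁, hδ₁, h₁⟩ := D.exists_eq_zero_of_le_norm D' h.1 hc
  obtain ⟨δ₂, hδ₂, h₂⟩ := D.exists_injOn_shift x
  refine ⟨min δ₁ δ₂, lt_min hδ₁ hδ₂, fun s hs u hu hs' hu' hs0 he => ?_⟩
  have hu0 : u ≠ 0 := by
    rintro rfl
    refine hs0 (h₂ s hs 0 (zero_mem_shiftDom x) (hs'.trans_le (min_le_right _ _))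
      (by simpa using hδ₂) ?_)
    rw [he, shift_zero, shift_zero, h.1]
  have hpos : 0 < s * (l * u) := by
    by_contra hneg
    have hneg' : s * (l * u) < 0 :=
      lt_of_le_of_ne (not_lt.1 hneg) (mul_ne_zero hs0 (mul_ne_zero hl hu0))
    refine hs0 (h₁ s hs u hu (hs'.trans_le (min_le_left _ _)) (hu'.trans_le (min_le_left _ _))
      he ?_).1
    rw [e, smul_smul, ← sub_smul, norm_smul, Real.norm_eq_abs]
    have h3 : |s - u * l| = |s| + |l| * |u| := by
      rw [← abs_mul]
      rcases lt_or_gt_of_ne hs0 with h4 | h4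
      · have h5 : 0 < l * u := by nlinarith
        rw [abs_of_neg h4, abs_of_pos h5, abs_of_neg (by linarith)]; ring
      · have h5 : l * u < 0 := by nlinarith
        rw [abs_of_pos h4, abs_of_neg h5, abs_of_pos (by linarith)]; ring
    rw [h3]
    have h6 : min 1 |l| * (|s| + |u|) ≤ |s| + |l| * |u| := by
      have := mul_le_mul_of_nonneg_right (min_le_left 1 |l|) (abs_nonneg s)
      have := mul_le_mul_of_nonneg_right (min_le_right 1 |l|) (abs_nonneg u)
      linarith
    calc c * (|s| + |u|) = min 1 |l| * (|s| + |u|) * ‖velocity D.f x‖ := by ring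
      _ ≤ _ := mul_le_mul_of_nonneg_right h6 hv.le
  rw [e, directionSign_smul (D.immersion x) hl]
  rcases lt_or_gt_of_ne hl with hl1 | hl0
  rotate_left
  · rw [unitSign_of_pos hl0]
    simp only [Units.val_one, Int.cast_one, one_mul]
    by_contra h7
    nlinarith [mul_nonneg hl0.le (neg_nonneg.2 (not_lt.1 h7))]
  · rw [unitSign_of_neg hl1]
    simp only [Units.val_neg, Units.val_one, Int.cast_neg, Int.cast_one]
    by_contra h7
    nlinarith [mul_nonneg (neg_nonneg.2 hl1.le) (neg_nonneg.2 (not_lt.1 h7))]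

theorem mem_endPoints_of_eq (D : Diagram S m n) (D' : Diagram S m' n') {x : OneManifold m n}
    {x' : OneManifold m' n'} (h : D.f x = D'.f x') (hx : x ∈ endPoints m n) :
    x' ∈ endPoints m' n' := by
  rw [← D.preimage_boundary, Set.mem_preimage, h] at hx
  rwa [← D'.preimage_boundary]

variable [T2Space S]

/-- Points y ≠ x tending to x have the same images as points g y of the other source, and by
compactness these accumulate at some x'. Since S is Hausdorff, x and x' have the same image. If the
branches were transverse at x and x', they would meet nearby only there, although y and g y meet
with y ≠ x. -/
theorem exists_tangent (h : Set.range D.f ⊆ Set.range D'.f) (x : OneManifold m n) :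
    ∃ x', D.Tangent D' x x' := by
  choose g hg using fun y => h (Set.mem_range_self y)
  let F : Ultrafilter (OneManifold m n) := Ultrafilter.of (𝓝[≠] x)
  have hF : (F : Filter (OneManifold m n)) ≤ 𝓝[≠] x := Ultrafilter.of_le _
  have hF' : (F : Filter (OneManifold m n)) ≤ 𝓝 x := hF.trans inf_le_left
  let x' := (F.map g).lim
  have hx' : Filter.Tendsto g F (𝓝 x') := (F.map g).le_nhds_lim
  have h1 : Filter.Tendsto (D'.f ∘ g) F (𝓝 (D'.f x')) := (D'.continuous.tendsto x').comp hx'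
  have h2 : Filter.Tendsto (D'.f ∘ g) F (𝓝 (D.f x)) := by
    have : D'.f ∘ g = D.f := funext hg
    rw [this]
    exact (D.continuous.tendsto x).mono_left hF'
  have h3 := tendsto_nhds_unique h2 h1
  refine ⟨x', h3, fun hli => ?_⟩
  have h4 : Filter.Tendsto (fun y => (y, g y)) F (𝓝 x ×ˢ 𝓝 x') :=
    Filter.Tendsto.prodMk hF' hx'
  have h5 := h4.eventually (eventually_eq_of_linearIndependent h3 hli)
  have h6 : ∀ᶠ y in (F : Filter (OneManifold m n)), y ≠ x := hF self_mem_nhdsWithin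
  obtain ⟨y, hy, hy'⟩ := (h5.and h6).exists
  exact hy' (hy (hg y).symm).1

/-- Any ultrafilter limit x' of φ along 𝓝 x lies over the same point as φ x. It is tangent there,
and so equals φ x by uniqueness, or else transverse, and then matched pairs near (x, x') can only be
(x, x') itself, which again gives x' = φ x. -/
theorem tendsto_nhds_of_tangent {φ : OneManifold m n → OneManifold m' n'}
    (hφ : ∀ x, D.Tangent D' x (φ x)) (x : OneManifold m n) :
    Filter.Tendsto φ (𝓝 x) (𝓝 (φ x)) := by
  rw [Filter.tendsto_iff_ultrafilter]
  intro F hF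
  let x' := (F.map φ).lim
  have hx' : Filter.Tendsto φ F (𝓝 x') := (F.map φ).le_nhds_lim
  suffices x' = φ x by rwa [this] at hx'
  have h1 : Filter.Tendsto (D'.f ∘ φ) F (𝓝 (D'.f x')) := (D'.continuous.tendsto x').comp hx'
  have h2 : Filter.Tendsto (D'.f ∘ φ) F (𝓝 (D.f x)) := by
    have : D'.f ∘ φ = D.f := funext fun y => (hφ y).1.symm
    rw [this]
    exact (D.continuous.tendsto x).mono_left hF
  have h3 := tendsto_nhds_unique h2 h1
  by_cases hli : LinearIndependent ℝ ![velocity D.f x, velocity D'.f x']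
  · have h4 : Filter.Tendsto (fun y => (y, φ y)) F (𝓝 x ×ˢ 𝓝 x') :=
      Filter.Tendsto.prodMk hF hx'
    obtain ⟨y, hy⟩ :=
      (h4.eventually (eventually_eq_of_linearIndependent h3 hli)).exists
    obtain ⟨rfl, h6⟩ := hy (hφ y).1
    exact h6.symm
  · exact Tangent.unique ⟨h3, hli⟩ (hφ x)

theorem tendsto_halfBranch_of_tangent_of_mem_shiftDom {φ : OneManifold m n → OneManifold m' n'}
    (hφ : ∀ x, D.Tangent D' x (φ x)) {x : OneManifold m n} {σ : ℤˣ}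
    (hσ : ∀ᶠ s : ℝ in 𝓝[>] 0, ((σ : ℤ) : ℝ) * s ∈ shiftDom x) :
    Filter.Tendsto φ (halfBranch x σ)
      (halfBranch (φ x) (directionSign (velocity D.f x) (velocity D'.f (φ x)) * σ)) := by
  intro V hV
  obtain ⟨δ, hδ, H⟩ := (hφ x).exists_mul_pos
  set e := directionSign (velocity D.f x) (velocity D'.f (φ x))
  rw [halfBranch, Filter.mem_map, mem_nhdsWithin_iff_eventually, Metric.eventually_nhds_iff] at hV
  obtain ⟨δ', hδ', H'⟩ := hV
  have h1 := tendsto_nhds_of_tangent hφ x (shift_image_mem_nhds (φ x) (lt_min hδ hδ'))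
  have h2 := halfBranch_le_nhds x σ h1
  rw [halfBranch, Filter.mem_map] at h2
  rw [halfBranch, Filter.map_map, Filter.mem_map]
  filter_upwards [h2, hσ, tendsto_unit_mul σ (Metric.ball_mem_nhds 0 hδ), self_mem_nhdsWithin]
    with s hs hs1 hs2 hs3
  obtain ⟨u, hu, hu'⟩ := hs
  have hs0 : (0 : ℝ) < s := hs3
  have h3 := H _ hs1 u hu.1 (by simpa using hs2) (hu.2.trans_le (min_le_left _ _))
    (by rcases Int.units_eq_one_or σ with rfl | rfl <;> simp [hs0.ne'])
    (by rw [hu']; exact (hφ _).1)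
  change φ (shift x _) ∈ V
  rw [← hu']
  have hee : ((e : ℤ) : ℝ) * ((e : ℤ) : ℝ) = 1 := by
    rcases Int.units_eq_one_or e with h | h <;> rw [h] <;> simp
  have hss : ((σ : ℤ) : ℝ) * ((σ : ℤ) : ℝ) = 1 := by
    rcases Int.units_eq_one_or σ with h | h <;> rw [h] <;> simp
  have hr : 0 < ((e : ℤ) : ℝ) * ((σ : ℤ) : ℝ) * u := by
    by_contra hcon
    nlinarith [mul_nonneg hs0.le (neg_nonneg.2 (not_lt.1 hcon))]
  have habs : |((e : ℤ) : ℝ) * ((σ : ℤ) : ℝ) * u| = |u| := by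
    rw [abs_mul, abs_mul]
    rcases Int.units_eq_one_or e with h | h <;> rcases Int.units_eq_one_or σ with h' | h' <;>
      rw [h, h'] <;> simp
  have h4 := H' (y := ((e : ℤ) : ℝ) * ((σ : ℤ) : ℝ) * u)
    (by rw [Real.dist_eq, sub_zero, habs]; exact hu.2.trans_le (min_le_right _ _)) hr
  have h5 : (((e * σ : ℤˣ) : ℤ) : ℝ) * (((e : ℤ) : ℝ) * ((σ : ℤ) : ℝ) * u) = u := by
    push_cast
    linear_combination (((σ : ℤ) : ℝ) * ((σ : ℤ) : ℝ) * u) * hee + u * hss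
  rw [Set.mem_preimage, h5] at h4
  exact h4

/-- Only end points need extra care: the blocked half-branch at x must go to the blocked half-branch
at φ x. -/
theorem tendsto_halfBranch_of_tangent {φ : OneManifold m n → OneManifold m' n'}
    (hφ : ∀ x, D.Tangent D' x (φ x)) (hinj : Function.Injective φ) (x : OneManifold m n)
    (σ : ℤˣ) :
    Filter.Tendsto φ (halfBranch x σ)
      (halfBranch (φ x) (directionSign (velocity D.f x) (velocity D'.f (φ x)) * σ)) := by
  by_cases hx : x ∈ endPoints m n
  · obtain ⟨τ, h1, h2⟩ := exists_halfBranch_eq_pure hx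
    by_cases hστ : σ = τ
    · subst hστ
      obtain ⟨τ', h1', h2'⟩ := exists_halfBranch_eq_pure (D.mem_endPoints_of_eq D' (hφ x).1 hx)
      have h3 := tendsto_halfBranch_of_tangent_of_mem_shiftDom hφ h2
      set e := directionSign (velocity D.f x) (velocity D'.f (φ x))
      by_cases h4 : e * σ = τ'
      · rw [h4, h1', h1]
        exact Filter.tendsto_pure_pure φ x
      -- Otherwise the free side at x would go to the blocked side at φ x, hence to the single point
      -- φ x, against injectivity of φ.
      · exfalso
        have h5 : e * -σ = τ' := by
          rcases Int.units_eq_one_or (e * σ) with h | h <;>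
            rcases Int.units_eq_one_or τ' with h' | h' <;> rw [mul_neg, h, h'] <;>
            first | rfl | (exfalso; exact h4 (h.trans h'.symm))
        rw [h5, h1', Filter.tendsto_pure] at h3
        obtain ⟨y, hy, hy'⟩ := (h3.and (eventually_halfBranch_ne h2)).exists
        exact hy' (hinj hy)
    · have : σ = -τ := by
        rcases Int.units_eq_one_or σ with h | h <;>
          rcases Int.units_eq_one_or τ with h' | h' <;> rw [h, h'] <;>
          first | (exfalso; exact hστ (h.trans h'.symm)) | simp
      rw [this]
      exact tendsto_halfBranch_of_tangent_of_mem_shiftDom hφ h2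
  · exact tendsto_halfBranch_of_tangent_of_mem_shiftDom hφ
      (eventually_mem_shiftDom_of_notMem_endPoints hx σ)

variable [IsManifold (𝓡∂ 2) ∞ S]

/-- Two presentations of the same diagram. -/
def SameDiagram.germIso (o : SurfaceOrientation S) (h : D.SameDiagram D') :
    { i : GermIso o D D' // ∀ x, D.Tangent D' x (i.φ x) ∧
      i.ε x = directionSign (velocity D.f x) (velocity D'.f (i.φ x)) } := by
  have h1 := fun x => exists_tangent (D := D) (D' := D') h.1.subset x
  have h2 := fun x => exists_tangent (D := D') (D' := D) h.1.symm.subset x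
  let φ : OneManifold m n ≃ OneManifold m' n' :=
    { toFun := fun x => (h1 x).choose
      invFun := fun x => (h2 x).choose
      left_inv := fun x => Tangent.unique (h2 _).choose_spec (h1 x).choose_spec.symm
      right_inv := fun x => Tangent.unique (h1 _).choose_spec (h2 x).choose_spec.symm }
  have hφ : ∀ x, D.Tangent D' x (φ x) := fun x => (h1 x).choose_spec
  have hφ' : ∀ x, D'.Tangent D x (φ.symm x) := fun x => (h2 x).choose_spec
  refine ⟨⟨φ, fun x => directionSign (velocity D.f x) (velocity D'.f (φ x)),
    tendsto_halfBranch_of_tangent hφ φ.injective, fun x σ => ?_, fun x y => ?_, fun x hx => ?_,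
    fun c c' hu hlow => ?_⟩, fun x => ⟨hφ x, rfl⟩⟩
  · have := tendsto_halfBranch_of_tangent hφ' φ.symm.injective (φ x)
      (directionSign (velocity D.f x) (velocity D'.f (φ x)) * σ)
    rw [Equiv.symm_apply_apply, directionSign_comm, ← mul_assoc, Int.units_mul_self,
      one_mul] at this
    rwa [directionSign_comm]
  · rw [← (hφ x).1, ← (hφ y).1]
  · exact (h.2 x hx (φ x) (hφ x).1 (hφ x).2).symm
  · obtain ⟨l, hl, e⟩ := (hφ c.upper).exists_smul
    obtain ⟨l', hl', e'⟩ := (hφ c.lower).exists_smul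
    -- The velocities of the second presentation are l and l' times those of the first, and the
    -- signs of l and l' are the direction signs ε at the two arcs.
    have hd : det2 (l • velocity D.f c.upper) (l' • velocity D.f c.lower)
        = l * (l' * det2 (velocity D.f c.upper) (velocity D.f c.lower)) := by
      simp only [det2, PiLp.smul_apply, smul_eq_mul]; ring
    have h0 := det2_ne_zero (D.transverse _ _ c.ne c.eq)
    rw [Crossing.sign_eq, Crossing.sign_eq, hu, hlow, ← (hφ _).1, e, e', hd,
      directionSign_smul (D.immersion _) hl, directionSign_smul (D.immersion _) hl',
      unitSign_mul hl (mul_ne_zero hl' h0), unitSign_mul hl' h0]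
    ac_rfl

theorem SameDiagram.bracket_eq (o : SurfaceOrientation S) (h : D.SameDiagram D') :
    D.bracket o = D'.bracket o :=
  (h.germIso o).1.bracket_eq

theorem SameOrientedDiagram.kauffmanJones_eq (o : SurfaceOrientation S)
    (h : D.SameOrientedDiagram D') : D.kauffmanJones o = D'.kauffmanJones o := by
  refine (h.1.germIso o).1.kauffmanJones_eq fun x => ?_
  have := (h.1.germIso o).2 x
  rw [this.2, directionSign_eq_one (h.2 _ _ this.1.1 this.1.2)]

end Diagram

end Surface

end SameDiagrams

/-! ### Ambient isotopies preserve the orientation -/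

section Isotopies

variable {m n : ℕ}

section Surface

variable {S : Type*} [TopologicalSpace S] [ChartedSpace (EuclideanHalfSpace 2) S]

theorem det2_map (L : EuclideanSpace ℝ (Fin 2) →L[ℝ] EuclideanSpace ℝ (Fin 2))
    (v w : EuclideanSpace ℝ (Fin 2)) : det2 (L v) (L w) = L.det * det2 v w := by
  have hd : L.det = (LinearMap.toMatrix (EuclideanSpace.basisFun (Fin 2) ℝ).toBasis
      (EuclideanSpace.basisFun (Fin 2) ℝ).toBasis (L : _ →ₗ[ℝ] _)).det :=
    (LinearMap.det_toMatrix _ _).symm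
  have hL : ∀ u : EuclideanSpace ℝ (Fin 2), L u = u 0 • L (EuclideanSpace.single 0 1)
      + u 1 • L (EuclideanSpace.single 1 1) := by
    intro u
    rw [← map_smul, ← map_smul, ← map_add]
    congr 1
    ext i
    fin_cases i <;> simp
  rw [hd, Matrix.det_fin_two, hL v, hL w]
  simp only [LinearMap.toMatrix_apply, OrthonormalBasis.coe_toBasis, EuclideanSpace.basisFun_apply,
    OrthonormalBasis.coe_toBasis_repr_apply, EuclideanSpace.basisFun_repr, det2,
    ContinuousLinearMap.coe_coe, PiLp.add_apply, PiLp.smul_apply, smul_eq_mul]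
  ring

namespace AmbientIsotopy

/-- The derivative at `p` of the diffeomorphism at time `t`. -/
def tangentMap (h : AmbientIsotopy S) (p : S) (t : ℝ) :
    EuclideanSpace ℝ (Fin 2) →L[ℝ] EuclideanSpace ℝ (Fin 2) :=
  mfderiv (𝓡∂ 2) (𝓡∂ 2) (h.H t) p

theorem det_tangentMap_ne_zero (h : AmbientIsotopy S) (p : S) {t : ℝ}
    (ht : t ∈ Set.Icc (0 : ℝ) 1) : (h.tangentMap p t).det ≠ 0 := by
  obtain ⟨φ, hφ⟩ := h.diffeo t ht
  have h1 : h.H t = φ := funext fun p => (hφ p).symm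
  let e : EuclideanSpace ℝ (Fin 2) ≃L[ℝ] EuclideanSpace ℝ (Fin 2) :=
    φ.mfderivToContinuousLinearEquiv (by simp) p
  have h2 : h.tangentMap p t = e := by
    unfold tangentMap
    rw [h1]
    exact (φ.mfderivToContinuousLinearEquiv_coe (by simp)).symm
  rw [h2]
  exact (LinearEquiv.isUnit_det' e.toLinearEquiv).ne_zero

end AmbientIsotopy

theorem Isotopic.velocity_eq {D D' : Diagram S m n} (h : AmbientIsotopy S)
    (hf : ∀ x, D'.f x = h.H 1 (D.f x)) (x : OneManifold m n) :
    velocity D'.f x = h.tangentMap (D.f x) 1 (velocity D.f x) := by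
  obtain rfl' : D'.f = fun x => h.H 1 (D.f x) := funext hf
  obtain ⟨φ, hφ⟩ := h.diffeo 1 (by simp)
  have h1 : h.H 1 = φ := funext fun p => (hφ p).symm
  have hd : MDifferentiableAt (𝓡∂ 2) (𝓡∂ 2) (h.H 1) (D.f (shift x 0)) := by
    rw [h1]
    exact φ.mdifferentiable (by simp) _
  have h2 := (D.smooth x 0 (zero_mem_shiftDom x)).mdifferentiableWithinAt (by simp)
  have h3 := hd.hasMFDerivAt.comp_hasMFDerivWithinAt (0 : ℝ) h2.hasMFDerivWithinAt
  have h4 := h3.mfderivWithin ((uniqueDiffOn_shiftDom x 0 (zero_mem_shiftDom x)).uniqueMDiffWithinAt)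
  unfold velocity
  rw [rfl']
  have h5 : ∀ p, p = D.f x →
      (mfderiv (𝓡∂ 2) (𝓡∂ 2) (h.H 1) p : EuclideanSpace ℝ (Fin 2) →L[ℝ] EuclideanSpace ℝ (Fin 2))
        = h.tangentMap (D.f x) 1 := by
    rintro _ rfl; rfl
  have h6 := congrArg (fun L : ℝ →L[ℝ] EuclideanSpace ℝ (Fin 2) => L 1) h4
  refine h6.trans ?_
  rw [← h5 _ (congrArg D.f (shift_zero x))]
  rfl

variable [IsManifold (𝓡∂ 2) ∞ S]

namespace AmbientIsotopy

/-- The derivative of H t at p is written in the preferred chart at H t p, which may jump with t.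
Passing to the fixed chart at H t₀ p by a coordinate change restores continuity. -/
theorem continuousWithinAt_det (h : AmbientIsotopy S) (p : S) {t₀ : ℝ}
    (ht₀ : t₀ ∈ Set.Icc (0 : ℝ) 1) :
    ContinuousWithinAt (fun t => (tangentCoordChange (𝓡∂ 2) (h.H t p) (h.H t₀ p) (h.H t p)).det
      * (h.tangentMap p t).det) (Set.Icc 0 1) t₀ := by
  have h1 : ContMDiffWithinAt (𝓘(ℝ, ℝ).prod (𝓡∂ 2)) (𝓡∂ 2) ∞ (Function.uncurry h.H)
      (Set.Icc (0 : ℝ) 1 ×ˢ Set.univ) (t₀, p) := h.smooth (t₀, p) ⟨ht₀, trivial⟩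
  have : IsManifold (𝓡∂ 2) 1 S := IsManifold.of_le (n := ∞) (by simp)
  have h2 := ContMDiffWithinAt.mfderivWithin (m := 0) (g := fun _ : ℝ => p) h1
    contMDiffWithinAt_const ht₀ (fun _ _ => trivial) (by simp) uniqueMDiffOn_univ
  simp only [mfderivWithin_univ] at h2
  have h3 : ContinuousWithinAt (inTangentCoordinates (𝓡∂ 2) (𝓡∂ 2) (fun _ => p)
      (fun t => h.H t p) (h.tangentMap p) t₀) (Set.Icc 0 1) t₀ := h2.continuousWithinAt
  have h4 : ContinuousWithinAt (fun t => h.H t p) (Set.Icc 0 1) t₀ := by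
    have := h1.continuousWithinAt
    exact this.comp (f := fun t : ℝ => (t, p)) (by fun_prop)
      (fun t ht => ⟨ht, trivial⟩)
  have h5 := ContinuousLinearMap.continuous_det.continuousAt.comp_continuousWithinAt h3
  have h6 : ∀ᶠ t in 𝓝[Set.Icc 0 1] t₀,
      h.H t p ∈ (chartAt (EuclideanHalfSpace 2) (h.H t₀ p)).source :=
    h4 ((chartAt (EuclideanHalfSpace 2) (h.H t₀ p)).open_source.mem_nhds (mem_chart_source _ _))
  have key : ∀ t, h.H t p ∈ (chartAt (EuclideanHalfSpace 2) (h.H t₀ p)).source →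
      (tangentCoordChange (𝓡∂ 2) (h.H t p) (h.H t₀ p) (h.H t p)).det * (h.tangentMap p t).det =
      (inTangentCoordinates (𝓡∂ 2) (𝓡∂ 2) (fun _ => p) (fun t => h.H t p)
        (h.tangentMap p) t₀ t).det := by
    intro t ht
    rw [inTangentCoordinates_eq (fun _ => p) (fun t => h.H t p) (h.tangentMap p)
      (mem_chart_source _ _) ht]
    have h7 : (tangentBundleCore (𝓡∂ 2) S).coordChange (achart (EuclideanHalfSpace 2) p)
        (achart (EuclideanHalfSpace 2) p) p = ContinuousLinearMap.id ℝ _ := by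
      ext1 v
      exact tangentCoordChange_self (mem_extChartAt_source p)
    rw [h7, ContinuousLinearMap.comp_id]
    exact (LinearMap.det_comp _ _).symm
  refine h5.congr_of_eventuallyEq ?_ (key t₀ (mem_chart_source _ _))
  filter_upwards [h6] with t ht
  exact key t ht

/-- The sign of the derivative relative to the orientation is locally constant in t: the determinant
never vanishes, and it varies continuously once charts are corrected. At time 0 the derivative is
the identity, and [0,1] is connected. -/
theorem orientation_preserving (o : SurfaceOrientation S) (h : AmbientIsotopy S) (p : S) :
    0 < ((o.sign p : ℤ) : ℝ) * ((o.sign (h.H 1 p) : ℤ) : ℝ) * (h.tangentMap p 1).det := by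
  set F : ℝ → ℝ := fun t =>
    ((o.sign p : ℤ) : ℝ) * ((o.sign (h.H t p) : ℤ) : ℝ) * (h.tangentMap p t).det with hF
  have hF0 : 0 < F 0 := by
    have h1 : h.H 0 = id := funext h.start
    have h2 : h.tangentMap p 0 = ContinuousLinearMap.id ℝ _ := by
      unfold tangentMap
      rw [h1]
      exact mfderiv_id
    rw [hF]
    simp only [h2, h.start p]
    have : (ContinuousLinearMap.id ℝ (EuclideanSpace ℝ (Fin 2))).det = 1 := LinearMap.det_id
    rw [this]
    rcases Int.units_eq_one_or (o.sign p) with h | h <;> rw [h] <;> simp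
  have hc : ContinuousOn (fun t => decide (0 < F t)) (Set.Icc 0 1) := by
    intro t₀ ht₀
    refine continuousWithinAt_const.congr_of_eventuallyEq (f := fun _ => decide (0 < F t₀)) ?_ rfl
    have h1 := h.continuousWithinAt_det p ht₀
    set G : ℝ → ℝ := fun t =>
      (tangentCoordChange (𝓡∂ 2) (h.H t p) (h.H t₀ p) (h.H t p)).det * (h.tangentMap p t).det
      with hG
    have hG0 : G t₀ = (h.tangentMap p t₀).det := by
      have h7 : tangentCoordChange (𝓡∂ 2) (h.H t₀ p) (h.H t₀ p) (h.H t₀ p)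
          = ContinuousLinearMap.id ℝ _ := by
        ext1 v
        exact tangentCoordChange_self (mem_extChartAt_source (h.H t₀ p))
      have : (ContinuousLinearMap.id ℝ (EuclideanSpace ℝ (Fin 2))).det = 1 := LinearMap.det_id
      rw [hG]
      simp only [h7, this, one_mul]
    have hd := h.det_tangentMap_ne_zero p ht₀
    have h2 : ∀ᶠ t in 𝓝[Set.Icc 0 1] t₀, 0 < G t * G t₀ := by
      have h3 : ContinuousWithinAt (fun t => G t * G t₀) (Set.Icc 0 1) t₀ :=
        h1.mul continuousWithinAt_const
      refine h3 (lt_mem_nhds ?_)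
      change 0 < G t₀ * G t₀
      rw [hG0]
      exact mul_self_pos.2 hd
    have h4 : ContinuousWithinAt (fun t => h.H t p) (Set.Icc 0 1) t₀ := by
      have h5 := (h.smooth (t₀, p) ⟨ht₀, trivial⟩).continuousWithinAt
      exact h5.comp (f := fun t : ℝ => (t, p)) (by fun_prop) (fun t ht => ⟨ht, trivial⟩)
    have h5 := h4.eventually (o.compatible (h.H t₀ p))
    filter_upwards [h2, h5] with t ht ht'
    -- The same coordinate change, with determinant κ, occurs in the continuity of the derivative
    -- and in the compatibility of the orientation. Multiplying the two inequalities leaves κ² > 0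
    -- as the only trace of the charts.
    have hprod : 0 < F t * F t₀ := by
      rw [hG0] at ht
      simp only [hF, hG] at ht ⊢
      set κ := (tangentCoordChange (𝓡∂ 2) (h.H t p) (h.H t₀ p) (h.H t p)).det
      have hκ : κ ≠ 0 := by
        rintro h0
        simp [h0] at ht'
      have hsp : ((o.sign p : ℤ) : ℝ) * ((o.sign p : ℤ) : ℝ) = 1 := by
        rcases Int.units_eq_one_or (o.sign p) with h | h <;> rw [h] <;> simp
      have h8 := mul_pos ht ht'
      have h9 : 0 < κ * κ := mul_self_pos.2 hκ
      by_contra hcon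
      have h10 := mul_nonneg h9.le (neg_nonneg.2 (not_lt.1 hcon))
      have h11 : κ * κ * -(((o.sign p : ℤ) : ℝ) * ((o.sign (h.H t p) : ℤ) : ℝ) *
          (h.tangentMap p t).det * (((o.sign p : ℤ) : ℝ) * ((o.sign (h.H t₀ p) : ℤ) : ℝ) *
          (h.tangentMap p t₀).det)) = - ((κ * (h.tangentMap p t).det * (h.tangentMap p t₀).det) *
          (((o.sign (h.H t₀ p) : ℤ) : ℝ) * ((o.sign (h.H t p) : ℤ) : ℝ) * κ)) := by
        linear_combination (-(κ * κ * ((o.sign (h.H t p) : ℤ) : ℝ) * (h.tangentMap p t).det *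
          ((o.sign (h.H t₀ p) : ℤ) : ℝ) * (h.tangentMap p t₀).det)) * hsp
      linarith
    rw [decide_eq_decide]
    constructor
    · intro h0; exact pos_of_mul_pos_right hprod h0.le
    · intro h0; exact pos_of_mul_pos_left hprod h0.le
  have := isPreconnected_Icc.constant hc (Set.right_mem_Icc.2 zero_le_one)
    (Set.left_mem_Icc.2 zero_le_one)
  rw [decide_eq_decide] at this
  exact this.2 hF0

end AmbientIsotopy

/-- An isotopy identifies the crossings of the two diagrams, with their signs. -/
def Isotopic.germIso (o : SurfaceOrientation S) {D D' : Diagram S m n} (H : Isotopic D D') :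
    {i : D.GermIso o D' // ∀ x, i.ε x = 1} := by
  refine ⟨⟨Equiv.refl _, fun _ => 1, fun x σ => ?_, fun x σ => ?_, fun x y => ?_, fun x hx => ?_,
    fun c c' hu hl => ?_⟩, fun x => rfl⟩
  · rw [one_mul]; exact Filter.tendsto_id
  · rw [one_mul]; exact Filter.tendsto_id
  · obtain ⟨h, hf, -⟩ := H
    obtain ⟨φ, hφ⟩ := h.diffeo 1 (by simp)
    simp only [Equiv.refl_apply, hf, ← hφ]
    exact φ.injective.eq_iff
  · obtain ⟨h, -, ho⟩ := H
    rw [Equiv.refl_apply, ho]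
  · obtain ⟨h, hf, -⟩ := H
    simp only [Equiv.refl_apply] at hu hl
    have h1 := h.orientation_preserving o (D.f c.upper)
    have h0 := det2_ne_zero (D.transverse _ _ c.ne c.eq)
    have hdet : (h.tangentMap (D.f c.upper) 1).det ≠ 0 := fun h' => by simp [h'] at h1
    rw [Diagram.Crossing.sign_eq, Diagram.Crossing.sign_eq, hu, hl, Isotopic.velocity_eq h hf,
      Isotopic.velocity_eq h hf, ← c.eq, det2_map, hf, unitSign_mul hdet h0]
    have h2 := unitSign_of_pos h1
    rw [unitSign_mul (mul_ne_zero (intCast_unit_ne_zero _) (intCast_unit_ne_zero _)) hdet,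
      unitSign_mul (intCast_unit_ne_zero _) (intCast_unit_ne_zero _), unitSign_intCast,
      unitSign_intCast] at h2
    have h3 : o.sign (h.H 1 (D.f c.upper)) * unitSign (h.tangentMap (D.f c.upper) 1).det
        = o.sign (D.f c.upper) := by
      rw [mul_assoc] at h2
      rw [eq_comm, mul_eq_one_iff_eq_inv.1 h2, Int.units_inv_eq_self]
    rw [← mul_assoc, h3, one_mul, one_mul]

end Surface

end Isotopies

/-! ### Cutting and regluing colourings along strands -/

section Strands

variable {m n k : ℕ}

/-! ### Strands -/

/-- Disjoint arcs in the interior of the source, parametrized by `[-1, 1]` in the direction given by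
the sign `ς`. -/
structure StrandSystem (m n k : ℕ) where
  st : Fin k → ℝ → OneManifold m n
  ς : Fin k → ℤˣ
  continuous : ∀ i, Continuous (st i)
  injective : ∀ i j, ∀ s ∈ Set.Icc (-1 : ℝ) 1, ∀ t ∈ Set.Icc (-1 : ℝ) 1,
    st i s = st j t → i = j ∧ s = t
  halfBranch_eq : ∀ i, ∀ t ∈ Set.Icc (-1 : ℝ) 1, ∀ τ : ℤˣ, halfBranch (st i t) (ς i * τ) =
    Filter.map (fun s : ℝ => st i (t + ((τ : ℤ) : ℝ) * s)) (𝓝[>] 0)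
  outside : ∀ i, ∀ τ : ℤˣ, ∀ᶠ s : ℝ in 𝓝[>] 0, ∀ j, ∀ t ∈ Set.Icc (-1 : ℝ) 1,
    st i (((τ : ℤ) : ℝ) + ((τ : ℤ) : ℝ) * s) ≠ st j t

theorem unit_mem_Icc (τ : ℤˣ) : ((τ : ℤ) : ℝ) ∈ Set.Icc (-1 : ℝ) 1 := by
  rcases Int.units_eq_one_or τ with rfl | rfl <;> simp

theorem eventually_mem_Ioo {t : ℝ} (ht : t ∈ Set.Icc (-1 : ℝ) 1) {τ : ℤˣ}
    (h : t ≠ ((τ : ℤ) : ℝ)) :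
    ∀ᶠ s : ℝ in 𝓝[>] 0, t + ((τ : ℤ) : ℝ) * s ∈ Set.Ioo (-1 : ℝ) 1 := by
  rcases Int.units_eq_one_or τ with rfl | rfl
  · simp only [Units.val_one, Int.cast_one] at h ⊢
    have : 0 < 1 - t := sub_pos.2 (lt_of_le_of_ne ht.2 h)
    filter_upwards [Ioo_mem_nhdsGT this] with s hs
    constructor <;> linarith [hs.1, hs.2, ht.1]
  · simp only [Units.val_neg, Units.val_one, Int.cast_neg, Int.cast_one] at h ⊢
    have : 0 < t + 1 := by
      have := lt_of_le_of_ne ht.1 (Ne.symm h)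
      linarith
    filter_upwards [Ioo_mem_nhdsGT this] with s hs
    constructor <;> linarith [hs.1, hs.2, ht.2]

/-- The colour in the direction `τ` from the time `t` if the arc `[-1, 1]` has the colours `l`, `c`,
`r` before the time `u`, between the times `u` and `v`, and after the time `v`. -/
def arcColor (u v : ℝ) (l c r : Bool) (t : ℝ) (τ : ℤˣ) : Bool :=
  if t < u ∨ (t = u ∧ τ = -1) then l else if t < v ∨ (t = v ∧ τ = -1) then c else r

/-- A germ at t in direction τ lies before the time w exactly when t < w, or t = w and τ = -1. The
definition of `arcColor` uses this convention at both marked times. -/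
theorem eventually_arcColor_eq (u v : ℝ) (l c r : Bool) (t : ℝ) (τ : ℤˣ) :
    ∀ᶠ s : ℝ in 𝓝[>] 0, ∀ τ', arcColor u v l c r (t + ((τ : ℤ) : ℝ) * s) τ'
      = arcColor u v l c r t τ := by
  have hside : ∀ w : ℝ, ∀ᶠ s : ℝ in 𝓝[>] 0, t + ((τ : ℤ) : ℝ) * s ≠ w ∧
      (t + ((τ : ℤ) : ℝ) * s < w ↔ t < w ∨ (t = w ∧ τ = -1)) := by
    intro w
    have hτ := tendsto_unit_mul τ
    rcases lt_trichotomy t w with h | rfl | h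
    · have h1 : ∀ᶠ s : ℝ in 𝓝[>] 0, ((τ : ℤ) : ℝ) * s < w - t :=
        hτ (gt_mem_nhds (sub_pos.2 h))
      filter_upwards [h1] with s hs
      exact ⟨by linarith, ⟨fun _ => Or.inl h, fun _ => by linarith⟩⟩
    · filter_upwards [self_mem_nhdsWithin] with s hs
      have hs : (0 : ℝ) < s := hs
      rcases Int.units_eq_one_or τ with rfl | rfl
      · have : (1 : ℤˣ) ≠ -1 := by decide
        simp [hs.ne', this, hs.le]
      · simp [hs.ne', hs]
    · have h1 : ∀ᶠ s : ℝ in 𝓝[>] 0, w - t < ((τ : ℤ) : ℝ) * s :=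
        hτ (lt_mem_nhds (sub_neg.2 h))
      filter_upwards [h1] with s hs
      refine ⟨by linarith, ⟨fun h' => by linarith, ?_⟩⟩
      rintro (h' | ⟨h', -⟩) <;> linarith
  filter_upwards [hside u, hside v] with s hu hv τ'
  unfold arcColor
  simp only [hu.1, hv.1, false_and, or_false, hu.2, hv.2]

theorem arcColor_of_ne (u v : ℝ) (l c r : Bool) {t : ℝ} (hu : t ≠ u) (hv : t ≠ v) (τ τ' : ℤˣ) :
    arcColor u v l c r t τ = arcColor u v l c r t τ' := by
  simp [arcColor, hu, hv]

namespace StrandSystem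

variable (R : StrandSystem m n k)

/-- The points on the strands. -/
def support : Set (OneManifold m n) := {x | ∃ i, ∃ t ∈ Set.Icc (-1 : ℝ) 1, x = R.st i t}

theorem isClosed_support : IsClosed R.support := by
  have : R.support = ⋃ i, R.st i '' Set.Icc (-1) 1 := by
    ext x
    simp only [support, Set.mem_ofPred_eq, Set.mem_iUnion, Set.mem_image, eq_comm]
  rw [this]
  exact isClosed_iUnion_of_finite fun i =>
    (isCompact_Icc.image (R.continuous i)).isClosed

/-- The half-branches on the strands. -/
def Inner (g : OneManifold m n × ℤˣ) : Prop :=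
  ∃ i, ∃ t ∈ Set.Icc (-1 : ℝ) 1, ∃ τ : ℤˣ, t ≠ ((τ : ℤ) : ℝ) ∧ g = (R.st i t, R.ς i * τ)

variable {R}

/-- On the strands, only the outward germs at the times ±1 fail to be inner. They belong to the
outer colouring and carry the boundary colours. -/
theorem inner_iff {i : Fin k} {t : ℝ} (ht : t ∈ Set.Icc (-1 : ℝ) 1) (τ : ℤˣ) :
    R.Inner (R.st i t, R.ς i * τ) ↔ t ≠ ((τ : ℤ) : ℝ) := by
  constructor
  · rintro ⟨j, t', ht', τ', h, he⟩
    obtain ⟨h1, h2⟩ := Prod.ext_iff.1 he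
    obtain ⟨rfl, rfl⟩ := R.injective _ _ _ ht _ ht' h1
    rwa [mul_left_cancel h2]
  · exact fun h => ⟨i, t, ht, τ, h, rfl⟩

theorem not_inner_of_notMem {x : OneManifold m n} (hx : x ∉ R.support) (σ : ℤˣ) :
    ¬ R.Inner (x, σ) := by
  rintro ⟨i, t, ht, τ, -, he⟩
  exact hx ⟨i, t, ht, (Prod.ext_iff.1 he).1⟩

theorem eq_or_of_not_inner {x : OneManifold m n} {σ : ℤˣ} (h : ¬ R.Inner (x, σ)) :
    x ∉ R.support ∨ ∃ i τ, x = R.st i (((τ : ℤˣ) : ℤ) : ℝ) ∧ σ = R.ς i * τ := by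
  by_cases hx : x ∈ R.support
  · right
    obtain ⟨i, t, ht, rfl⟩ := hx
    have h1 : σ = R.ς i * (R.ς i * σ) := by rw [← mul_assoc, Int.units_mul_self, one_mul]
    rw [h1, inner_iff ht, not_not] at h
    exact ⟨i, R.ς i * σ, by rw [← h], h1⟩
  · exact Or.inl hx

theorem eventually_notMem_support {x : OneManifold m n} {σ : ℤˣ} (h : ¬ R.Inner (x, σ)) :
    ∀ᶠ y in halfBranch x σ, y ∉ R.support := by
  rcases eq_or_of_not_inner h with hx | ⟨i, τ, rfl, rfl⟩
  · exact halfBranch_le_nhds x σ (R.isClosed_support.isOpen_compl.mem_nhds hx)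
  · rw [R.halfBranch_eq i _ (unit_mem_Icc τ), Filter.eventually_map]
    filter_upwards [R.outside i τ] with s hs
    rintro ⟨j, t, ht, he⟩
    exact hs j t ht he

variable (R) in
/-- The colours of the half-branches that leave the strands. -/
def boundaryColor (χ : OneManifold m n × ℤˣ → Bool) (i : Fin k) (τ : ℤˣ) : Bool :=
  χ (R.st i ((τ : ℤ) : ℝ), R.ς i * τ)

/-- The colours of the half-branches at the marked times (the earlier one is `false`, the later
one is `true`) if `b` are the colours at the ends of the strands and `M` those in the middle. -/
def _root_.GenLink.markColor (b : Fin k → ℤˣ → Bool) (M : Fin k → Bool) (i : Fin k) (p : Bool)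
    (τ : ℤˣ) : Bool :=
  match p with
  | false => if τ = -1 then b i (-1) else M i
  | true => if τ = -1 then M i else b i 1

variable (R) in
/-- The colourings of the half-branches outside of the strands that are locally constant and satisfy
the condition `P`. -/
def outerColorings (P : (OneManifold m n × ℤˣ → Bool) → Prop) :
    Set (OneManifold m n × ℤˣ → Bool) :=
  {χ | (∀ g, R.Inner g → χ g = false) ∧
    (∀ x σ, ¬ R.Inner (x, σ) → ∀ᶠ y in halfBranch x σ, ∀ τ, χ (y, τ) = χ (x, σ)) ∧ P χ}

variable (R) in
/-- The pairs of a colouring outside of the strands and of colours of their middle parts that match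
according to the condition `Q` on the colours at the marked times. -/
def cutColorings (P : (OneManifold m n × ℤˣ → Bool) → Prop)
    (Q : (Fin k → Bool → ℤˣ → Bool) → Prop) :
    Set ((OneManifold m n × ℤˣ → Bool) × (Fin k → Bool)) :=
  {p | p.1 ∈ R.outerColorings P ∧ Q (markColor (R.boundaryColor p.1) p.2)}

open Classical in
variable (R) in
/-- The colouring of all half-branches given by a colouring outside of the strands and the colours
of the middle parts of the strands. -/
def extend (u v : Fin k → ℝ) (χ : OneManifold m n × ℤˣ → Bool) (M : Fin k → Bool)
    (g : OneManifold m n × ℤˣ) : Bool :=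
  if h : R.Inner g then
    arcColor (u h.choose) (v h.choose) (R.boundaryColor χ h.choose (-1)) (M h.choose)
      (R.boundaryColor χ h.choose 1) h.choose_spec.choose h.choose_spec.choose_spec.2.choose
  else χ g

theorem extend_of_not_inner {u v : Fin k → ℝ} {χ : OneManifold m n × ℤˣ → Bool}
    {M : Fin k → Bool} {g : OneManifold m n × ℤˣ} (h : ¬ R.Inner g) :
    R.extend u v χ M g = χ g := dif_neg h

theorem extend_of_ne {u v : Fin k → ℝ} {χ : OneManifold m n × ℤˣ → Bool}
    {M : Fin k → Bool} {i : Fin k} {t : ℝ} (ht : t ∈ Set.Icc (-1 : ℝ) 1) {τ : ℤˣ}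
    (h : t ≠ ((τ : ℤ) : ℝ)) :
    R.extend u v χ M (R.st i t, R.ς i * τ) = arcColor (u i) (v i) (R.boundaryColor χ i (-1))
      (M i) (R.boundaryColor χ i 1) t τ := by
  have h' := (inner_iff (R := R) (i := i) ht τ).2 h
  rw [extend, dif_pos h']
  have key : ∀ j, ∀ t' ∈ Set.Icc (-1 : ℝ) 1, ∀ τ' : ℤˣ,
      (R.st i t, R.ς i * τ) = (R.st j t', R.ς j * τ') →
      arcColor (u j) (v j) (R.boundaryColor χ j (-1)) (M j) (R.boundaryColor χ j 1) t' τ' =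
      arcColor (u i) (v i) (R.boundaryColor χ i (-1)) (M i) (R.boundaryColor χ i 1) t τ := by
    intro j t' ht' τ' he
    obtain ⟨h1, h2⟩ := Prod.ext_iff.1 he
    obtain ⟨rfl, rfl⟩ := R.injective _ _ _ ht _ ht' h1
    rw [mul_left_cancel h2]
  exact key _ _ h'.choose_spec.choose_spec.1 _ h'.choose_spec.choose_spec.2.choose_spec.2

theorem boundaryColor_extend {u v : Fin k → ℝ} {χ : OneManifold m n × ℤˣ → Bool}
    {M : Fin k → Bool} : R.boundaryColor (R.extend u v χ M) = R.boundaryColor χ := by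
  ext i τ
  refine extend_of_not_inner ?_
  rw [inner_iff (unit_mem_Icc τ)]
  simp

/-- A locally constant colouring is constant on the arcs of a strand without marked points. -/
theorem eq_of_forall_Ioo {χ : OneManifold m n × ℤˣ → Bool} (hχ : IsLocallyConstantColoring χ)
    {i : Fin k} {a b : ℝ} (ha : -1 ≤ a) (hab : a < b) (hb : b ≤ 1)
    (h : ∀ t ∈ Set.Ioo a b, χ (R.st i t, 1) = χ (R.st i t, -1)) :
    χ (R.st i a, R.ς i * 1) = χ (R.st i b, R.ς i * -1) ∧
    ∀ t ∈ Set.Ioo a b, ∀ σ, χ (R.st i t, σ) = χ (R.st i a, R.ς i * 1) := by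
  have hI : ∀ t ∈ Set.Ioo a b, t ∈ Set.Icc (-1 : ℝ) 1 := fun t ht =>
    ⟨ha.trans ht.1.le, ht.2.le.trans hb⟩
  have hσ : ∀ t ∈ Set.Ioo a b, ∀ σ, χ (R.st i t, σ) = χ (R.st i t, 1) := by
    intro t ht σ
    rcases Int.units_eq_one_or σ with rfl | rfl
    · rfl
    · exact (h t ht).symm
  have hlim : ∀ t ∈ Set.Icc (-1 : ℝ) 1, ∀ τ : ℤˣ, ∀ᶠ s : ℝ in 𝓝[>] 0,
      χ (R.st i (t + ((τ : ℤ) : ℝ) * s), 1) = χ (R.st i t, R.ς i * τ) := by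
    intro t ht τ
    have := hχ (R.st i t) (R.ς i * τ)
    rw [R.halfBranch_eq i t ht, Filter.eventually_map] at this
    exact this.mono fun s hs => hs 1
  -- Inside (a, b) the two germs at each point have the same colour and each determines the colour
  -- nearby on its side, so the colour is continuous on a connected interval.
  have hc : ContinuousOn (fun t => χ (R.st i t, 1)) (Set.Ioo a b) := by
    intro t ht
    refine ContinuousAt.continuousWithinAt ?_
    refine continuousAt_const.congr (f := fun _ => χ (R.st i t, 1)) ?_
    have h1 := hlim t (hI t ht) 1
    have h2 := hlim t (hI t ht) (-1)
    rw [hσ t ht] at h1 h2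
    simp only [Units.val_one, Int.cast_one, one_mul, Units.val_neg, Int.cast_neg,
      neg_mul, ← sub_eq_add_neg] at h1 h2
    rw [eventually_nhdsWithin_iff, Metric.eventually_nhds_iff] at h1 h2
    obtain ⟨δ₁, hδ₁, h1⟩ := h1
    obtain ⟨δ₂, hδ₂, h2⟩ := h2
    refine Metric.eventually_nhds_iff.2 ⟨min δ₁ δ₂, lt_min hδ₁ hδ₂, fun s hs => ?_⟩
    rw [Real.dist_eq] at hs
    rcases lt_trichotomy s t with hst | rfl | hst
    · have := h2 (y := t - s) (by
        rw [Real.dist_eq, sub_zero, abs_sub_comm]; exact hs.trans_le (min_le_right _ _))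
        (sub_pos.2 hst)
      simpa using this.symm
    · rfl
    · have := h1 (y := s - t) (by
        rw [Real.dist_eq, sub_zero]; exact hs.trans_le (min_le_left _ _))
        (sub_pos.2 hst)
      simpa using this.symm
  have hconst : ∀ t ∈ Set.Ioo a b, ∀ t' ∈ Set.Ioo a b,
      χ (R.st i t, 1) = χ (R.st i t', 1) := fun t ht t' ht' =>
    isPreconnected_Ioo.constant hc ht ht'
  have hab' : 0 < b - a := sub_pos.2 hab
  have hev : ∀ᶠ s : ℝ in 𝓝[>] 0, s ∈ Set.Ioo 0 (b - a) := Ioo_mem_nhdsGT hab'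
  obtain ⟨s₁, hs₁, h₁⟩ := (hev.and
    (hlim a ⟨ha, hab.le.trans hb⟩ 1)).exists
  obtain ⟨s₂, hs₂, h₂⟩ := (hev.and
    (hlim b ⟨ha.trans hab.le, hb⟩ (-1))).exists
  simp only [Units.val_one, Int.cast_one, one_mul, Units.val_neg, Int.cast_neg,
    neg_mul] at h₁ h₂
  have ha' : a + s₁ ∈ Set.Ioo a b := ⟨by linarith [hs₁.1], by linarith [hs₁.2]⟩
  have hb' : b + -s₂ ∈ Set.Ioo a b := ⟨by linarith [hs₂.2], by linarith [hs₂.1]⟩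
  refine ⟨by rw [← h₁, ← h₂]; exact hconst _ ha' _ hb', fun t ht σ => ?_⟩
  rw [hσ t ht, ← h₁]
  exact hconst _ ht _ ha'

open Classical in
/-- The locally constant colourings of all half-branches that satisfy a condition `P` outside of the
strands and a condition `Q` at the marked times correspond to the pairs that match. -/
theorem card_colorings_eq {u v : Fin k → ℝ} (hu : ∀ i, -1 < u i) (huv : ∀ i, u i < v i)
    (hv : ∀ i, v i < 1) {P : (OneManifold m n × ℤˣ → Bool) → Prop}
    (hP : ∀ χ χ', (∀ g, ¬ R.Inner g → χ g = χ' g) → P χ → P χ')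
    {Q : (Fin k → Bool → ℤˣ → Bool) → Prop} {C : Set (OneManifold m n × ℤˣ → Bool)}
    (hC : ∀ χ, χ ∈ C ↔ IsLocallyConstantColoring χ ∧ P χ ∧
      (∀ i, ∀ t ∈ Set.Icc (-1 : ℝ) 1, t ≠ u i → t ≠ v i →
        χ (R.st i t, 1) = χ (R.st i t, -1)) ∧
      Q fun i p τ => χ (R.st i (if p then v i else u i), R.ς i * τ)) :
    Nat.card C = Nat.card (R.cutColorings P Q) := by
  have hne : (1 : ℤˣ) ≠ -1 := by decide
  have huI : ∀ i, u i ∈ Set.Icc (-1 : ℝ) 1 := fun i => ⟨(hu i).le, ((huv i).trans (hv i)).le⟩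
  have hvI : ∀ i, v i ∈ Set.Icc (-1 : ℝ) 1 := fun i => ⟨((hu i).trans (huv i)).le, (hv i).le⟩
  have hu_ne : ∀ i (τ : ℤˣ), u i ≠ ((τ : ℤ) : ℝ) := by
    intro i τ
    have := hu i
    have := huv i
    have := hv i
    rcases Int.units_eq_one_or τ with rfl | rfl <;> simp <;> intro h <;> linarith
  have hv_ne : ∀ i (τ : ℤˣ), v i ≠ ((τ : ℤ) : ℝ) := by
    intro i τ
    have := hu i
    have := huv i
    have := hv i
    rcases Int.units_eq_one_or τ with rfl | rfl <;> simp <;> intro h <;> linarith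
  -- the colours on the strands
  have harc : ∀ χ ∈ C, ∀ i, ∀ t ∈ Set.Icc (-1 : ℝ) 1, ∀ τ : ℤˣ, t ≠ ((τ : ℤ) : ℝ) →
      χ (R.st i t, R.ς i * τ) = arcColor (u i) (v i) (R.boundaryColor χ i (-1))
        (χ (R.st i (u i), R.ς i * 1)) (R.boundaryColor χ i 1) t τ := by
    intro χ hχ i t ht τ htτ
    obtain ⟨h1, -, h3, -⟩ := (hC χ).1 hχ
    have hglue : ∀ t ∈ Set.Icc (-1 : ℝ) 1, t ≠ u i → t ≠ v i → ∀ σ σ',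
        χ (R.st i t, σ) = χ (R.st i t, σ') := by
      intro t ht htu htv σ σ'
      have := h3 i t ht htu htv
      rcases Int.units_eq_one_or σ with rfl | rfl <;>
        rcases Int.units_eq_one_or σ' with rfl | rfl <;> simp [this]
    have hui := hu i
    have huvi := huv i
    have hvi := hv i
    have hL := eq_of_forall_Ioo (R := R) (i := i) h1 le_rfl (hu i)
      ((huv i).trans (hv i)).le fun t ht => h3 i t ⟨ht.1.le, by linarith [ht.2]⟩ ht.2.ne
        (by linarith [ht.2] : t < v i).ne
    have hM := eq_of_forall_Ioo (R := R) (i := i) h1 (hu i).le (huv i)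
      (hv i).le fun t ht => h3 i t ⟨by linarith [ht.1], by linarith [ht.2]⟩ ht.1.ne' ht.2.ne
    have hR := eq_of_forall_Ioo (R := R) (i := i) h1 ((hu i).trans (huv i)).le (hv i)
      le_rfl fun t ht => h3 i t ⟨by linarith [ht.1], ht.2.le⟩ (by linarith [ht.1] : u i < t).ne'
        ht.1.ne'
    have hl : R.boundaryColor χ i (-1) = χ (R.st i (-1), R.ς i * 1) := by
      have := hglue (-1) (by simp) hui.ne (by linarith : -1 < v i).ne
        (R.ς i * -1) (R.ς i * 1)
      simpa [boundaryColor] using this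
    have hr : R.boundaryColor χ i 1 = χ (R.st i 1, R.ς i * -1) := by
      have := hglue 1 (by simp) (by linarith : u i < 1).ne' hvi.ne' (R.ς i * 1) (R.ς i * -1)
      simpa [boundaryColor] using this
    rw [hl, hr]
    unfold arcColor
    rcases lt_trichotomy t (u i) with h | h | h
    · rw [if_pos (Or.inl h)]
      rcases ht.1.eq_or_lt with rfl | h'
      · exact hglue _ ht h.ne (by linarith : -1 < v i).ne _ _
      · exact hL.2 t ⟨h', h⟩ _
    · subst h
      rcases Int.units_eq_one_or τ with rfl | rfl
      · rw [if_neg (by simp [hne]), if_pos (Or.inl (huv i))]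
      · rw [if_pos (Or.inr ⟨rfl, rfl⟩)]
        exact hL.1.symm
    · rw [if_neg (by rintro (h' | ⟨h', -⟩) <;> linarith)]
      rcases lt_trichotomy t (v i) with h' | h' | h'
      · rw [if_pos (Or.inl h')]
        exact hM.2 t ⟨h, h'⟩ _
      · subst h'
        rcases Int.units_eq_one_or τ with rfl | rfl
        · rw [if_neg (by simp [hne])]
          exact hR.1
        · rw [if_pos (Or.inr ⟨rfl, rfl⟩)]
          exact hM.1.symm
      · rw [if_neg (by rintro (h'' | ⟨h'', -⟩) <;> linarith)]
        rcases ht.2.eq_or_lt with rfl | h''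
        · exact hglue _ ht h.ne' h'.ne' _ _
        · rw [hR.2 t ⟨h', h''⟩ _, hR.1]
  have hmark : ∀ (χ : OneManifold m n × ℤˣ → Bool) (M : Fin k → Bool),
      (∀ i, ∀ t ∈ Set.Icc (-1 : ℝ) 1, ∀ τ : ℤˣ, t ≠ ((τ : ℤ) : ℝ) →
        χ (R.st i t, R.ς i * τ) = arcColor (u i) (v i) (R.boundaryColor χ i (-1)) (M i)
          (R.boundaryColor χ i 1) t τ) →
      (fun i p τ => χ (R.st i (if p then v i else u i), R.ς i * τ))
        = markColor (R.boundaryColor χ) M := by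
    intro χ M h
    funext i p τ
    cases p
    · simp only [Bool.false_eq_true, if_false]
      rw [h i _ (huI i) τ (hu_ne i τ)]
      rcases Int.units_eq_one_or τ with rfl | rfl <;> simp [arcColor, markColor, hne, huv i]
    · simp only [if_true]
      rw [h i _ (hvI i) τ (hv_ne i τ)]
      have := huv i
      rcases Int.units_eq_one_or τ with rfl | rfl <;>
        simp [arcColor, markColor, hne, this.not_gt, this.ne']
  -- Inner germs get the dummy colour `false`, so that each outer colouring has a single
  -- representative and cutting becomes a bijection.
  let restr : (OneManifold m n × ℤˣ → Bool) → OneManifold m n × ℤˣ → Bool :=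
    fun χ g => if R.Inner g then false else χ g
  have hrestr : ∀ χ g, ¬ R.Inner g → restr χ g = χ g := fun χ g h => if_neg h
  have hb : ∀ χ, R.boundaryColor (restr χ) = R.boundaryColor χ := by
    intro χ
    ext i τ
    refine hrestr χ _ ?_
    rw [inner_iff (unit_mem_Icc τ)]
    simp
  have hto : ∀ χ ∈ C, (restr χ, fun i => χ (R.st i (u i), R.ς i * 1)) ∈
      R.cutColorings P Q := by
    intro χ hχ
    obtain ⟨h1, h2, h3, h4⟩ := (hC χ).1 hχ
    refine ⟨⟨fun g hg => if_pos hg, fun x σ hx => ?_, hP _ _ (fun g hg => (hrestr χ g hg).symm) h2⟩,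
      ?_⟩
    · filter_upwards [eventually_notMem_support hx, h1 x σ] with y hy hy' τ
      rw [hrestr _ _ hx, hrestr _ _ (not_inner_of_notMem hy τ), hy']
    · rw [hb, ← hmark χ _ (harc χ hχ)]
      exact h4
  have hfrom : ∀ p ∈ R.cutColorings P Q, R.extend u v p.1 p.2 ∈ C := by
    rintro ⟨χ, M⟩ ⟨⟨h1, h2, h3⟩, h4⟩
    rw [hC]
    refine ⟨fun x σ => ?_, hP _ _ (fun g hg => (extend_of_not_inner hg).symm) h3,
      fun i t ht htu htv => ?_, ?_⟩
    · by_cases hx : R.Inner (x, σ)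
      · obtain ⟨i, t, ht, τ, htτ, he⟩ := hx
        obtain ⟨rfl, rfl⟩ := Prod.ext_iff.1 he
        rw [extend_of_ne ht htτ, R.halfBranch_eq i t ht, Filter.eventually_map]
        filter_upwards [eventually_mem_Ioo ht htτ, eventually_arcColor_eq (u i) (v i) _ _ _ t τ]
          with s hs hs' τ'
        have h5 : τ' = R.ς i * (R.ς i * τ') := by
          rw [← mul_assoc, Int.units_mul_self, one_mul]
        rw [h5, extend_of_ne ⟨hs.1.le, hs.2.le⟩, hs']
        rcases Int.units_eq_one_or (R.ς i * τ') with h | h <;> rw [h]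
        · simpa using hs.2.ne
        · simpa using hs.1.ne'
      · rw [extend_of_not_inner hx]
        filter_upwards [eventually_notMem_support hx, h2 x σ hx] with y hy hy' τ
        rw [extend_of_not_inner (not_inner_of_notMem hy τ), hy']
    -- Away from the marked times both germs must have the colour of the arc. At an end of the
    -- strand the outward germ is not inner, and its boundary colour is by construction the colour
    -- of the adjacent arc.
    · have hkey : ∀ τ : ℤˣ, R.extend u v χ M (R.st i t, R.ς i * τ) =
          arcColor (u i) (v i) (R.boundaryColor χ i (-1)) (M i) (R.boundaryColor χ i 1) t 1 := by
        intro τ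
        have hui := hu i
        have huvi := huv i
        have hvi := hv i
        by_cases htτ : t = ((τ : ℤ) : ℝ)
        · subst htτ
          rw [extend_of_not_inner (by rw [inner_iff (unit_mem_Icc τ)]; simp)]
          rcases Int.units_eq_one_or τ with rfl | rfl
          · have a1 : ¬ (1 : ℝ) < u i := by linarith
            have a2 : ¬ (1 : ℝ) < v i := by linarith
            simp [arcColor, a1, a2, hne, boundaryColor]
          · simp [arcColor, hui, boundaryColor]
        · rw [extend_of_ne ht htτ]
          exact arcColor_of_ne _ _ _ _ _ htu htv _ _
      have h6 := hkey (R.ς i * 1)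
      have h7 := hkey (R.ς i * -1)
      rw [← mul_assoc, Int.units_mul_self, one_mul] at h6 h7
      rw [h6, h7]
    · rw [hmark _ M fun i t ht τ htτ => by rw [boundaryColor_extend]; exact extend_of_ne ht htτ]
      rwa [boundaryColor_extend]
  refine Nat.card_congr
    { toFun := fun χ => ⟨_, hto χ.1 χ.2⟩
      invFun := fun p => ⟨_, hfrom p.1 p.2⟩
      left_inv := ?_
      right_inv := ?_ }
  · rintro ⟨χ, hχ⟩
    ext ⟨x, σ⟩
    by_cases hx : R.Inner (x, σ)
    · obtain ⟨i, t, ht, τ, htτ, he⟩ := hx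
      obtain ⟨rfl, rfl⟩ := Prod.ext_iff.1 he
      simp only
      rw [extend_of_ne ht htτ, hb, harc χ hχ i t ht τ htτ]
    · simp only
      rw [extend_of_not_inner hx, hrestr _ _ hx]
  · rintro ⟨⟨χ, M⟩, ⟨⟨h1, h2, h3⟩, h4⟩⟩
    refine Subtype.ext (Prod.ext ?_ ?_)
    · ext g
      by_cases hg : R.Inner g
      · simp only [restr, if_pos hg]
        exact (h1 g hg).symm
      · simp only [restr, if_neg hg]
        exact extend_of_not_inner hg
    · ext i
      simp only
      rw [extend_of_ne (huI i) (hu_ne i 1)]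
      simp [arcColor, hne, huv i]

/-- The cut colourings fibre over the outer colourings, with fibre depending only on the boundary
colours. Fibrewise bijections glue, and the base need not be known to be finite. -/
theorem card_cutColorings_congr {P : (OneManifold m n × ℤˣ → Bool) → Prop}
    {Q Q' : (Fin k → Bool → ℤˣ → Bool) → Prop}
    (h : ∀ b : Fin k → ℤˣ → Bool, Nat.card {M : Fin k → Bool // Q (markColor b M)}
      = Nat.card {M : Fin k → Bool // Q' (markColor b M)}) :
    Nat.card (R.cutColorings P Q) = Nat.card (R.cutColorings P Q') := by
  have e : ∀ Q : (Fin k → Bool → ℤˣ → Bool) → Prop, R.cutColorings P Q ≃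
      Σ χ : R.outerColorings P, {M : Fin k → Bool // Q (markColor (R.boundaryColor χ) M)} :=
    fun Q =>
    { toFun := fun p => ⟨⟨p.1.1, p.2.1⟩, ⟨p.1.2, p.2.2⟩⟩
      invFun := fun q => ⟨(q.1.1, q.2.1), q.1.2, q.2.2⟩
      left_inv := fun p => rfl
      right_inv := fun q => rfl }
  rw [Nat.card_congr (e Q), Nat.card_congr (e Q')]
  refine Nat.card_congr (Equiv.sigmaCongrRight fun χ => ?_)
  exact (Finite.card_eq.1 (h _)).some

/-- The fibrewise version of one more closed circle: its colour is a free choice in `Bool`. -/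
theorem card_cutColorings_two_mul {P : (OneManifold m n × ℤˣ → Bool) → Prop}
    {Q Q' : (Fin k → Bool → ℤˣ → Bool) → Prop}
    (h : ∀ b : Fin k → ℤˣ → Bool, Nat.card {M : Fin k → Bool // Q (markColor b M)}
      = 2 * Nat.card {M : Fin k → Bool // Q' (markColor b M)}) :
    Nat.card (R.cutColorings P Q) = 2 * Nat.card (R.cutColorings P Q') := by
  have e : ∀ Q : (Fin k → Bool → ℤˣ → Bool) → Prop, R.cutColorings P Q ≃
      Σ χ : R.outerColorings P, {M : Fin k → Bool // Q (markColor (R.boundaryColor χ) M)} :=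
    fun Q =>
    { toFun := fun p => ⟨⟨p.1.1, p.2.1⟩, ⟨p.1.2, p.2.2⟩⟩
      invFun := fun q => ⟨(q.1.1, q.2.1), q.1.2, q.2.2⟩
      left_inv := fun p => rfl
      right_inv := fun q => rfl }
  have h2 : 2 = Nat.card Bool := by simp
  rw [h2, ← Nat.card_prod, Nat.card_congr (e Q),
    Nat.card_congr ((Equiv.prodComm _ _).trans ((e Q').prodCongr (Equiv.refl Bool)))]
  have e2 : ∀ χ : R.outerColorings P, Nonempty
      ({M : Fin k → Bool // Q (markColor (R.boundaryColor χ) M)} ≃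
      {M : Fin k → Bool // Q' (markColor (R.boundaryColor χ) M)} × Bool) := fun χ => by
    refine Finite.card_eq.1 ?_
    rw [h, Nat.card_prod, mul_comm]
    simp
  refine Nat.card_congr ((Equiv.sigmaCongrRight fun χ => (e2 χ).some).trans ?_)
  exact
    { toFun := fun q => (⟨q.1, q.2.1⟩, q.2.2)
      invFun := fun q => ⟨q.1.1, q.1.2, q.2⟩
      left_inv := fun q => rfl
      right_inv := fun q => rfl }

end StrandSystem

end Strands

/-! ### State sums localized on strands -/

section Tangles

variable {q' m n k q : ℕ}

/-! ### Sums over states -/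

instance : DecidableEq SplitType := Classical.decEq _

/-- The two splittings of a crossing, in terms of the sign `η` that compares the directions of the
joined half-branches, if `ε` is the sign of the crossing with respect to these directions. -/
def splitTypeEquiv (ε : ℤˣ) : SplitType ≃ ℤˣ where
  toFun
    | .A => -ε
    | .B => ε
  invFun η := if η = ε then .B else .A
  left_inv s := by
    cases s
    · have : -ε ≠ ε := by rcases Int.units_eq_one_or ε with rfl | rfl <;> decide
      simp [this]
    · simp
  right_inv η := by
    by_cases h : η = ε
    · simp [h]
    · simp only [h, if_false]
      rcases Int.units_eq_one_or ε with rfl | rfl <;>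
        rcases Int.units_eq_one_or η with rfl | rfl <;> simp_all

instance : Fintype SplitType := Fintype.ofEquiv _ (splitTypeEquiv 1).symm

/-- The exponent of `A` that a splitting contributes. -/
def SplitType.weight : SplitType → ℤ
  | .A => 1
  | .B => -1

/-- This records that, once splittings are encoded by signs η, the exponent of A contributed by a
crossing is -εη. -/
theorem weight_splitTypeEquiv_symm (ε η : ℤˣ) :
    ((splitTypeEquiv ε).symm η).weight = -((ε : ℤ) * (η : ℤ)) := by
  obtain ⟨s, rfl⟩ := (splitTypeEquiv ε).surjective η
  rw [Equiv.symm_apply_apply]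
  cases s <;> rcases Int.units_eq_one_or ε with rfl | rfl <;> simp [splitTypeEquiv, SplitType.weight]

open LaurentPolynomial in
/-- The contribution of the crossings on the strands to the bracket polynomial: `ε` are the signs of
the crossings with respect to the directions of the strands, and `N η` is the number of
components of the result of the splitting described by `η`. -/
def localSum (ε : Fin q → ℤˣ) (N : (Fin q → ℤˣ) → ℕ) : LaurentPolynomial ℤ :=
  ∑ η : Fin q → ℤˣ, T (-∑ a, (ε a : ℤ) * (η a : ℤ)) * (-T 2 - T (-2)) ^ (N η - 1)

section Surface

variable {S : Type*} [TopologicalSpace S] [ChartedSpace (EuclideanHalfSpace 2) S]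

namespace Diagram

theorem alpha_sub_beta (D : Diagram S m n) [Fintype D.Crossing] (s : D.State) :
    (D.alpha s : ℤ) - (D.beta s : ℤ) = ∑ c, (s c).weight := by
  classical
  have h1 : (D.alpha s : ℤ) = ∑ c, if s c = .A then 1 else 0 := by
    rw [alpha, Nat.card_eq_fintype_card, Fintype.card_subtype]
    simp
  have h2 : (D.beta s : ℤ) = ∑ c, if s c = .B then 1 else 0 := by
    rw [beta, Nat.card_eq_fintype_card, Fintype.card_subtype]
    simp
  rw [h1, h2, ← Finset.sum_sub_distrib]
  refine Finset.sum_congr rfl fun c _ => ?_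
  cases s c <;> simp [SplitType.weight]

end Diagram

/-! ### Diagrams in a system of strands -/

/-- The colours at the marked times of the strands match: the marked time `pos a false` is joined
with the marked time `pos a true` so that the directions correspond under `η a`, and at the other
marked times nothing happens. -/
def Matching (pos : Fin q → Bool → Fin k × Bool) (η : Fin q → ℤˣ)
    (κ : Fin k → Bool → ℤˣ → Bool) : Prop :=
  (∀ j : Fin k × Bool, (∀ a p, pos a p ≠ j) → κ j.1 j.2 1 = κ j.1 j.2 (-1)) ∧
  ∀ a τ, κ (pos a false).1 (pos a false).2 τ = κ (pos a true).1 (pos a true).2 (η a * τ)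

/-- A description of the crossings of a diagram on the strands: there are two marked times on each
strand, and the crossing `a` takes place at the marked times `pos a false` and `pos a true`. -/
structure TanglePresentation (R : StrandSystem m n k) (D : Diagram S m n) (q : ℕ) where
  mark : Fin k → Bool → ℝ
  neg_one_lt : ∀ i, -1 < mark i false
  mark_lt : ∀ i, mark i false < mark i true
  lt_one : ∀ i, mark i true < 1
  crossing : Fin q → D.Crossing
  pos : Fin q → Bool → Fin k × Bool
  pos_injective : ∀ a p b p', pos a p = pos b p' → a = b ∧ p = p'
  place : ∀ a,
    ((crossing a).upper = R.st (pos a false).1 (mark (pos a false).1 (pos a false).2) ∧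
      (crossing a).lower = R.st (pos a true).1 (mark (pos a true).1 (pos a true).2)) ∨
    ((crossing a).lower = R.st (pos a false).1 (mark (pos a false).1 (pos a false).2) ∧
      (crossing a).upper = R.st (pos a true).1 (mark (pos a true).1 (pos a true).2))
  exists_crossing : ∀ c : D.Crossing, c.upper ∈ R.support ∨ c.lower ∈ R.support →
    ∃ a, c = crossing a

namespace TanglePresentation

variable {R : StrandSystem m n k} {D : Diagram S m n}

theorem mark_mem (t : TanglePresentation R D q) (i : Fin k) (p : Bool) :
    t.mark i p ∈ Set.Icc (-1 : ℝ) 1 := by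
  have h1 := t.neg_one_lt i
  have h2 := t.mark_lt i
  have h3 := t.lt_one i
  cases p <;> constructor <;> linarith

theorem mark_injective (t : TanglePresentation R D q) {i : Fin k} {p p' : Bool}
    (h : t.mark i p = t.mark i p') : p = p' := by
  have h2 := t.mark_lt i
  cases p <;> cases p' <;> first | rfl | (exfalso; linarith)

/-- The point of the source at a marked time. -/
def point (t : TanglePresentation R D q) (j : Fin k × Bool) : OneManifold m n :=
  R.st j.1 (t.mark j.1 j.2)

theorem point_injective (t : TanglePresentation R D q) : Function.Injective t.point := by
  rintro ⟨i, p⟩ ⟨j, p'⟩ h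
  obtain ⟨h1, h2⟩ := R.injective _ _ _ (t.mark_mem i p) _ (t.mark_mem j p') h
  simp only at h1
  subst h1
  rw [t.mark_injective h2]

theorem point_mem_support (t : TanglePresentation R D q) (j : Fin k × Bool) :
    t.point j ∈ R.support :=
  ⟨j.1, _, t.mark_mem j.1 j.2, rfl⟩

theorem upper_crossing_mem_support (t : TanglePresentation R D q) (a : Fin q) :
    (t.crossing a).upper ∈ R.support := by
  rcases t.place a with h | h
  · rw [h.1]; exact t.point_mem_support _
  · rw [h.2]; exact t.point_mem_support _

theorem crossing_injective (t : TanglePresentation R D q) : Function.Injective t.crossing := by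
  intro a b h
  have key : ∀ a, ∃ p, (t.crossing a).upper = t.point (t.pos a p) := fun a => by
    rcases t.place a with h | h
    · exact ⟨false, h.1⟩
    · exact ⟨true, h.2⟩
  obtain ⟨p, hp⟩ := key a
  obtain ⟨p', hp'⟩ := key b
  rw [h, hp'] at hp
  exact (t.pos_injective _ _ _ _ (t.point_injective hp)).1.symm

theorem point_pos_mem_doubleSet (t : TanglePresentation R D q) (a : Fin q) (p : Bool) :
    t.point (t.pos a p) ∈ D.doubleSet := by
  rcases t.place a with h | h <;> cases p
  · rw [point, ← h.1]; exact (t.crossing a).upper_mem_doubleSet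
  · rw [point, ← h.2]; exact (t.crossing a).lower_mem_doubleSet
  · rw [point, ← h.1]; exact (t.crossing a).lower_mem_doubleSet
  · rw [point, ← h.2]; exact (t.crossing a).upper_mem_doubleSet

theorem exists_pos (t : TanglePresentation R D q) {x : OneManifold m n} (hx : x ∈ D.doubleSet)
    (hx' : x ∈ R.support) : ∃ a p, x = t.point (t.pos a p) := by
  obtain ⟨c, ⟨-, rfl⟩ | ⟨-, rfl⟩⟩ := D.exists_crossing hx
  · obtain ⟨a, rfl⟩ := t.exists_crossing c (Or.inl hx')
    rcases t.place a with h | h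
    · exact ⟨a, false, h.1⟩
    · exact ⟨a, true, h.2⟩
  · obtain ⟨a, rfl⟩ := t.exists_crossing c (Or.inr hx')
    rcases t.place a with h | h
    · exact ⟨a, true, h.2⟩
    · exact ⟨a, false, h.1⟩

end TanglePresentation

variable [IsManifold (𝓡∂ 2) ∞ S]

namespace Diagram

open LaurentPolynomial in
theorem bracket_eq_sum (o : SurfaceOrientation S) (D : Diagram S m n) {ι κ : Type*} [Fintype ι]
    [DecidableEq ι] [Fintype κ] [DecidableEq κ] (e : ι ⊕ κ ≃ D.Crossing) :
    D.bracket o = ∑ so : ι → SplitType, T (∑ c, (so c).weight) *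
      ∑ si : κ → SplitType, T (∑ c, (si c).weight) *
        (-T 2 - T (-2)) ^ (D.mu o (Sum.elim so si ∘ e.symm) - 1) := by
  classical
  let _ : Fintype D.Crossing := Fintype.ofEquiv _ e
  unfold bracket
  rw [finsum_eq_sum_of_fintype]
  let E : (ι → SplitType) × (κ → SplitType) ≃ D.State :=
    (Equiv.sumArrowEquivProdArrow ι κ SplitType).symm.trans (e.arrowCongr (Equiv.refl _))
  rw [← E.sum_comp, Fintype.sum_prod_type]
  refine Finset.sum_congr rfl fun so _ => ?_
  rw [Finset.mul_sum]
  refine Finset.sum_congr rfl fun si _ => ?_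
  have hE : E (so, si) = Sum.elim so si ∘ e.symm := rfl
  rw [hE, alpha_sub_beta, ← e.sum_comp, Fintype.sum_sum_type, T_add, mul_assoc]
  simp

theorem writhe_eq_sum (o : SurfaceOrientation S) (D : Diagram S m n) {ι κ : Type*} [Fintype ι]
    [Fintype κ] (e : ι ⊕ κ ≃ D.Crossing) :
    D.writhe o = ∑ c, ((e (.inl c)).sign o : ℤ) + ∑ c, ((e (.inr c)).sign o : ℤ) := by
  let _ : Fintype D.Crossing := Fintype.ofEquiv _ e
  unfold writhe
  rw [finsum_eq_sum_of_fintype, ← e.sum_comp, Fintype.sum_sum_type]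

end Diagram

/-- The conditions outside of the strands for a colouring to be compatible with a state. -/
def OuterCondition (o : SurfaceOrientation S) (R : StrandSystem m n k) (D : Diagram S m n)
    (s : D.State) (χ : OneManifold m n × ℤˣ → Bool) : Prop :=
  (∀ x ∉ R.support, x ∉ D.doubleSet → χ (x, 1) = χ (x, -1)) ∧
  ∀ c : D.Crossing, c.upper ∉ R.support → c.lower ∉ R.support → ∀ σ,
    χ (c.upper, σ) = χ (c.lower, Diagram.splitEnd o s c σ)

namespace TanglePresentation

variable {R : StrandSystem m n k} {D : Diagram S m n}

/-- The sign of the crossing `a` with respect to the directions of the strands. -/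
def strandSign (o : SurfaceOrientation S) (t : TanglePresentation R D q) (a : Fin q) : ℤˣ :=
  (t.crossing a).sign o * R.ς (t.pos a false).1 * R.ς (t.pos a true).1

/-- The splitting of the crossing `a` by the state `s`, with respect to the directions of the
strands. -/
def smoothing (o : SurfaceOrientation S) (t : TanglePresentation R D q) (s : D.State)
    (a : Fin q) : ℤˣ :=
  splitTypeEquiv (t.strandSign o a) (s (t.crossing a))

/-- The factors ς translate directions of the source into directions of the strands, so the
splitting is described by η alone, however the strands are traversed. -/
theorem splitEnd_crossing (o : SurfaceOrientation S) (t : TanglePresentation R D q) (s : D.State)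
    (a : Fin q) (σ : ℤˣ) : Diagram.splitEnd o s (t.crossing a) σ =
      t.smoothing o s a * R.ς (t.pos a false).1 * R.ς (t.pos a true).1 * σ := by
  have h : t.strandSign o a * R.ς (t.pos a false).1 * R.ς (t.pos a true).1
      = (t.crossing a).sign o := by
    unfold strandSign
    calc _ = (t.crossing a).sign o * (R.ς (t.pos a false).1 * R.ς (t.pos a false).1) *
          (R.ς (t.pos a true).1 * R.ς (t.pos a true).1) := by ac_rfl
      _ = _ := by simp
  unfold Diagram.splitEnd smoothing splitTypeEquiv
  cases s (t.crossing a)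
  · simp [h]
  · simp [h]

/-- The joining relation is symmetric because η is its own inverse, so it does not matter which of
the two strands is the upper one. After this translation, over and under are remembered only by
`strandSign`. -/
theorem crossing_glue_iff (o : SurfaceOrientation S) (t : TanglePresentation R D q) (s : D.State)
    (a : Fin q) (χ : OneManifold m n × ℤˣ → Bool) :
    (∀ σ, χ ((t.crossing a).upper, σ) =
      χ ((t.crossing a).lower, Diagram.splitEnd o s (t.crossing a) σ)) ↔
    ∀ τ, χ (t.point (t.pos a false), R.ς (t.pos a false).1 * τ) =
      χ (t.point (t.pos a true), R.ς (t.pos a true).1 * (t.smoothing o s a * τ)) := by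
  rcases t.place a with h | h
  · rw [← (Equiv.mulLeft (R.ς (t.pos a false).1)).forall_congr_right
      (q := fun σ => χ ((t.crossing a).upper, σ) = _)]
    refine forall_congr' fun τ => ?_
    rw [splitEnd_crossing, h.1, h.2, Equiv.coe_mulLeft]
    have : t.smoothing o s a * R.ς (t.pos a false).1 * R.ς (t.pos a true).1 *
        (R.ς (t.pos a false).1 * τ) = R.ς (t.pos a true).1 * (t.smoothing o s a * τ) := by
      calc _ = (R.ς (t.pos a false).1 * R.ς (t.pos a false).1) *
            (R.ς (t.pos a true).1 * (t.smoothing o s a * τ)) := by ac_rfl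
        _ = _ := by simp
    rw [this]
    rfl
  · rw [← (Equiv.mulLeft (R.ς (t.pos a true).1 * t.smoothing o s a)).forall_congr_right
      (q := fun σ => χ ((t.crossing a).upper, σ) = _)]
    refine forall_congr' fun τ => ?_
    rw [splitEnd_crossing, h.1, h.2, Equiv.coe_mulLeft, eq_comm]
    have : t.smoothing o s a * R.ς (t.pos a false).1 * R.ς (t.pos a true).1 *
        (R.ς (t.pos a true).1 * t.smoothing o s a * τ) = R.ς (t.pos a false).1 * τ := by
      calc _ = (t.smoothing o s a * t.smoothing o s a) * ((R.ς (t.pos a true).1 *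
            R.ς (t.pos a true).1) * (R.ς (t.pos a false).1 * τ)) := by ac_rfl
        _ = _ := by simp
    rw [this]
    simp only [mul_assoc]
    rfl

/-- The gluing conditions separate into those off the strands, those at unmarked times and those at
marked times; this is the form in which colourings can be cut. -/
theorem mem_stateColorings_iff (o : SurfaceOrientation S) (t : TanglePresentation R D q)
    (s : D.State) (χ : OneManifold m n × ℤˣ → Bool) :
    χ ∈ D.stateColorings o s ↔ IsLocallyConstantColoring χ ∧ OuterCondition o R D s χ ∧
      (∀ i, ∀ r ∈ Set.Icc (-1 : ℝ) 1, r ≠ t.mark i false → r ≠ t.mark i true →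
        χ (R.st i r, 1) = χ (R.st i r, -1)) ∧
      Matching t.pos (t.smoothing o s)
        fun i p τ => χ (R.st i (if p then t.mark i true else t.mark i false), R.ς i * τ) := by
  have hpt : ∀ (j : Fin k × Bool),
      R.st j.1 (if j.2 then t.mark j.1 true else t.mark j.1 false) = t.point j := by
    rintro ⟨i, p⟩
    cases p <;> rfl
  refine and_congr_right fun _ => ?_
  constructor
  · rintro ⟨h1, h2⟩
    refine ⟨⟨fun x _ => h1 x, fun c _ _ => h2 c⟩, fun i r hr hr1 hr2 => h1 _ fun hd => ?_,
      fun j hj => ?_, fun a => ?_⟩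
    · obtain ⟨a, p, h⟩ := t.exists_pos hd ⟨i, r, hr, rfl⟩
      obtain ⟨rfl, h5⟩ := R.injective _ _ _ hr _ (t.mark_mem _ _) h
      cases hp : (t.pos a p).2
      · exact hr1 (by rw [h5, hp])
      · exact hr2 (by rw [h5, hp])
    · simp only [hpt]
      have hj' : t.point j ∉ D.doubleSet := fun hd => by
        obtain ⟨a, p, h⟩ := t.exists_pos hd (t.point_mem_support j)
        exact hj a p (t.point_injective h).symm
      have := h1 _ hj'
      rcases Int.units_eq_one_or (R.ς j.1) with h | h <;> simp [h, this]
    · simp only [hpt]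
      exact (t.crossing_glue_iff o s a χ).1 (h2 _)
  · rintro ⟨h1, h2, h3, h4⟩
    simp only [hpt] at h3 h4
    refine ⟨fun x hx => ?_, fun c => ?_⟩
    · by_cases hx' : x ∈ R.support
      · obtain ⟨i, r, hr, rfl⟩ := hx'
        by_cases hm : ∃ p, r = t.mark i p
        · obtain ⟨p, rfl⟩ := hm
          have := h3 (i, p) fun a p' ha => hx (by
            have := t.point_pos_mem_doubleSet a p'
            rwa [ha] at this)
          change χ (R.st i (t.mark i p), R.ς i * 1) = χ (R.st i (t.mark i p), R.ς i * -1) at this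
          rcases Int.units_eq_one_or (R.ς i) with h | h
          · simpa [h] using this
          · simpa [h] using this.symm
        · push Not at hm
          exact h2 i r hr (hm false) (hm true)
      · exact h1.1 x hx' hx
    · by_cases hc : c.upper ∈ R.support ∨ c.lower ∈ R.support
      · obtain ⟨a, rfl⟩ := t.exists_crossing c hc
        exact (t.crossing_glue_iff o s a χ).2 (h4 a)
      · push Not at hc
        exact h1.2 c hc.1 hc.2

variable [T2Space S]

theorem two_pow_mu (o : SurfaceOrientation S) (t : TanglePresentation R D q) (s : D.State) :
    2 ^ D.mu o s = Nat.card
      (R.cutColorings (OuterCondition o R D s) (Matching t.pos (t.smoothing o s))) := by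
  rw [← Diagram.card_stateColorings]
  refine StrandSystem.card_colorings_eq (u := fun i => t.mark i false)
    (v := fun i => t.mark i true) t.neg_one_lt t.mark_lt t.lt_one ?_
    (t.mem_stateColorings_iff o s)
  rintro χ χ' h ⟨h1, h2⟩
  refine ⟨fun x hx hx' => ?_, fun c hu hl σ => ?_⟩
  · rw [← h _ (StrandSystem.not_inner_of_notMem hx _), ← h _ (StrandSystem.not_inner_of_notMem hx _)]
    exact h1 x hx hx'
  · rw [← h _ (StrandSystem.not_inner_of_notMem hu _), ← h _ (StrandSystem.not_inner_of_notMem hl _)]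
    exact h2 c hu hl σ

open Classical in
/-- The crossings on the strands and the other ones. -/
def crossingEquiv (t : TanglePresentation R D q) :
    {c : D.Crossing // c.upper ∉ R.support} ⊕ Fin q ≃ D.Crossing where
  toFun := Sum.elim Subtype.val t.crossing
  invFun c := if h : c.upper ∈ R.support then .inr (t.exists_crossing c (Or.inl h)).choose
    else .inl ⟨c, h⟩
  left_inv := by
    rintro (⟨c, hc⟩ | a)
    · simp [hc]
    · have h := t.upper_crossing_mem_support a
      refine (dif_pos h).trans ?_
      exact congrArg Sum.inr
        (t.crossing_injective (t.exists_crossing _ (Or.inl h)).choose_spec.symm)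
  right_inv c := by
    by_cases h : c.upper ∈ R.support
    · simp only [dif_pos h, Sum.elim_inr]
      exact (t.exists_crossing c (Or.inl h)).choose_spec.symm
    · simp [h]

end TanglePresentation

/-- The diagrams `D` and `D'` have the same crossings outside of the strands. -/
structure AgreeOutside (o : SurfaceOrientation S) (R : StrandSystem m n k)
    (D D' : Diagram S m n) where
  equiv : {c : D.Crossing // c.upper ∉ R.support} ≃ {c : D'.Crossing // c.upper ∉ R.support}
  upper_eq : ∀ c, (equiv c).1.upper = c.1.upper
  lower_eq : ∀ c, (equiv c).1.lower = c.1.lower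
  sign_eq : ∀ c, (equiv c).1.sign o = c.1.sign o
  mem_doubleSet_iff : ∀ x ∉ R.support, x ∈ D'.doubleSet ↔ x ∈ D.doubleSet

namespace AgreeOutside

variable {o : SurfaceOrientation S} {R : StrandSystem m n k} {D D' : Diagram S m n}

theorem outerCondition_iff (h : AgreeOutside o R D D') {s : D.State} {s' : D'.State}
    (hs : ∀ c, s' (h.equiv c).1 = s c.1) (χ : OneManifold m n × ℤˣ → Bool) :
    OuterCondition o R D' s' χ ↔ OuterCondition o R D s χ := by
  refine and_congr ?_ ?_
  · refine forall₂_congr fun x hx => ?_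
    rw [h.mem_doubleSet_iff x hx]
  · have key : ∀ {D : Diagram S m n} (P : D.Crossing → Prop), (∀ c : D.Crossing,
        c.upper ∉ R.support → P c) ↔ ∀ c : {c : D.Crossing // c.upper ∉ R.support}, P c.1 :=
      fun P => ⟨fun H c => H c.1 c.2, fun H c hc => H ⟨c, hc⟩⟩
    rw [key, key, ← h.equiv.forall_congr_right]
    refine forall_congr' fun c => ?_
    rw [h.upper_eq, h.lower_eq]
    refine imp_congr_right fun _ => forall_congr' fun σ => ?_
    have : Diagram.splitEnd o s' (h.equiv c).1 σ = Diagram.splitEnd o s c.1 σ := by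
      unfold Diagram.splitEnd
      rw [hs, h.sign_eq]
    rw [this]

variable [T2Space S]

/-- The comparison of the bracket polynomials of two diagrams that differ on the strands only. -/
theorem bracket_eq_mul (h : AgreeOutside o R D D') (t : TanglePresentation R D q)
    (t' : TanglePresentation R D' q') (z : LaurentPolynomial ℤ)
    (H : ∀ (P : (OneManifold m n × ℤˣ → Bool) → Prop) (N : (Fin q → ℤˣ) → ℕ)
      (N' : (Fin q' → ℤˣ) → ℕ), (∀ η, 0 < N η) → (∀ η, 0 < N' η) →
      (∀ η, 2 ^ N η = Nat.card (R.cutColorings P (Matching t.pos η))) →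
      (∀ η, 2 ^ N' η = Nat.card (R.cutColorings P (Matching t'.pos η))) →
      localSum (t'.strandSign o) N' = z * localSum (t.strandSign o) N) :
    D'.bracket o = z * D.bracket o := by
  classical
  let _ : Fintype {c : D.Crossing // c.upper ∉ R.support} := Fintype.ofFinite _
  let _ : Fintype {c : D'.Crossing // c.upper ∉ R.support} := Fintype.ofFinite _
  rw [D.bracket_eq_sum o t.crossingEquiv, D'.bracket_eq_sum o t'.crossingEquiv]
  let E : ({c : D.Crossing // c.upper ∉ R.support} → SplitType) ≃
      ({c : D'.Crossing // c.upper ∉ R.support} → SplitType) :=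
    h.equiv.arrowCongr (Equiv.refl _)
  rw [← E.sum_comp, Finset.mul_sum]
  refine Finset.sum_congr rfl fun so _ => ?_
  have hw : ∑ c, (E so c).weight = ∑ c, (so c).weight := by
    rw [← h.equiv.sum_comp]
    simp [E]
  rw [hw, mul_left_comm]
  congr 1
  -- The states that restrict to `so` outside the strands, indexed by the splittings η on the
  -- strands.
  let st : (Fin q → ℤˣ) → D.State := fun η =>
    Sum.elim so (fun a => (splitTypeEquiv (t.strandSign o a)).symm (η a)) ∘ t.crossingEquiv.symm
  let st' : (Fin q' → ℤˣ) → D'.State := fun η =>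
    Sum.elim (E so) (fun a => (splitTypeEquiv (t'.strandSign o a)).symm (η a)) ∘
      t'.crossingEquiv.symm
  have hst : ∀ η a, st η (t.crossing a) = (splitTypeEquiv (t.strandSign o a)).symm (η a) := by
    intro η a
    have : t.crossingEquiv.symm (t.crossing a) = .inr a := by
      rw [Equiv.symm_apply_eq]; rfl
    simp [st, this]
  have hst' : ∀ η a, st' η (t'.crossing a) =
      (splitTypeEquiv (t'.strandSign o a)).symm (η a) := by
    intro η a
    have : t'.crossingEquiv.symm (t'.crossing a) = .inr a := by
      rw [Equiv.symm_apply_eq]; rfl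
    simp [st', this]
  have hso : ∀ η (c : {c : D.Crossing // c.upper ∉ R.support}), st η c.1 = so c := by
    intro η c
    have : t.crossingEquiv.symm c.1 = .inl c := by
      rw [Equiv.symm_apply_eq]; rfl
    simp [st, this]
  have hso' : ∀ η (c : {c : D'.Crossing // c.upper ∉ R.support}), st' η c.1 = E so c := by
    intro η c
    have : t'.crossingEquiv.symm c.1 = .inl c := by
      rw [Equiv.symm_apply_eq]; rfl
    simp [st', this]
  -- The outer condition does not see η, so the reference value η = 1 yields one condition P shared
  -- by all local splittings of both diagrams.
  have hP : ∀ η, OuterCondition o R D (st η) = OuterCondition o R D (st 1) := by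
    intro η
    funext χ
    refine propext (and_congr Iff.rfl (forall_congr' fun c => forall_congr' fun hc => ?_))
    have : ∀ σ, Diagram.splitEnd o (st η) c σ = Diagram.splitEnd o (st 1) c σ := by
      intro σ
      unfold Diagram.splitEnd
      rw [hso η ⟨c, hc⟩, hso 1 ⟨c, hc⟩]
    simp only [this]
  have hP' : ∀ η, OuterCondition o R D' (st' η) = OuterCondition o R D (st 1) := by
    intro η
    funext χ
    refine propext (h.outerCondition_iff (fun c => ?_) χ)
    rw [hso', hso]
    simp [E]
  have hη : ∀ η, t.smoothing o (st η) = η := by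
    intro η
    ext a
    rw [TanglePresentation.smoothing, hst, Equiv.apply_symm_apply]
  have hη' : ∀ η, t'.smoothing o (st' η) = η := by
    intro η
    ext a
    rw [TanglePresentation.smoothing, hst', Equiv.apply_symm_apply]
  have key := H (OuterCondition o R D (st 1)) (fun η => D.mu o (st η)) (fun η => D'.mu o (st' η))
    (fun η => D.mu_pos o _) (fun η => D'.mu_pos o _)
    (fun η => by rw [t.two_pow_mu, hP, hη]) (fun η => by rw [t'.two_pow_mu, hP', hη'])
  unfold localSum at key
  have hsum : ∀ η : Fin q → ℤˣ, -∑ a, (t.strandSign o a : ℤ) * (η a : ℤ)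
      = ∑ a, ((splitTypeEquiv (t.strandSign o a)).symm (η a)).weight := by
    intro η
    simp only [weight_splitTypeEquiv_symm, Finset.sum_neg_distrib]
  have hsum' : ∀ η : Fin q' → ℤˣ, -∑ a, (t'.strandSign o a : ℤ) * (η a : ℤ)
      = ∑ a, ((splitTypeEquiv (t'.strandSign o a)).symm (η a)).weight := by
    intro η
    simp only [weight_splitTypeEquiv_symm, Finset.sum_neg_distrib]
  simp only [hsum, hsum'] at key
  rw [← (Equiv.piCongrRight fun a => (splitTypeEquiv (t.strandSign o a)).symm).sum_comp,
    ← (Equiv.piCongrRight fun a => (splitTypeEquiv (t'.strandSign o a)).symm).sum_comp]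
  exact key

theorem writhe_sub_writhe (h : AgreeOutside o R D D') (t : TanglePresentation R D q)
    (t' : TanglePresentation R D' q') :
    D'.writhe o = D.writhe o + (∑ a, ((t'.crossing a).sign o : ℤ) -
      ∑ a, ((t.crossing a).sign o : ℤ)) := by
  let _ : Fintype {c : D.Crossing // c.upper ∉ R.support} := Fintype.ofFinite _
  let _ : Fintype {c : D'.Crossing // c.upper ∉ R.support} := Fintype.ofFinite _
  rw [D.writhe_eq_sum o t.crossingEquiv, D'.writhe_eq_sum o t'.crossingEquiv,
    ← h.equiv.sum_comp]
  have : ∀ c, (t'.crossingEquiv (.inl (h.equiv c))).sign o = (t.crossingEquiv (.inl c)).sign o :=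
    h.sign_eq
  simp only [this]
  change _ + ∑ a, ((t'.crossing a).sign o : ℤ) = _ + ∑ a, ((t.crossing a).sign o : ℤ) + _
  ring

end AgreeOutside

end Surface

end Tangles

section Discs

variable {m n k : ℕ}

/-! ### Strands in a disc -/

theorem mem_shiftDom_of_shift_notMem_endPoints {x : OneManifold m n} {s : ℝ}
    (h : shift x s ∉ endPoints m n) : s ∈ shiftDom x := by
  rcases x with ⟨i, t⟩ | ⟨i, z⟩
  · by_contra hs
    simp only [shiftDom, Set.mem_ofPred_eq, Set.mem_Icc, not_and_or, not_le] at hs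
    refine h ⟨i, ?_⟩
    rcases hs with hs | hs
    · left
      simp only [shift, Set.projIcc_of_le_left zero_le_one hs.le]
      rfl
    · right
      simp only [shift, Set.projIcc_of_right_le zero_le_one hs.le]
      rfl
  · trivial

theorem map_mul_nhdsGT_zero {a : ℝ} (ha : 0 < a) :
    Filter.map (fun s : ℝ => a * s) (𝓝[>] 0) = 𝓝[>] 0 := by
  have := (Homeomorph.mulLeft₀ a ha.ne').isEmbedding.map_nhdsWithin_eq (Set.Ioi 0) 0
  have h2 : (fun s : ℝ => a * s) '' Set.Ioi 0 = Set.Ioi 0 := by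
    rw [Set.image_mul_left_Ioi ha, mul_zero]
  simpa [h2] using this

theorem unitSign_mul_abs (a : ℝ) : ((unitSign a : ℤ) : ℝ) * |a| = a := by
  unfold unitSign
  split_ifs with h
  · simp [abs_of_pos h]
  · simp [abs_of_nonpos (not_lt.1 h)]

/-- The arcs that are traversed with constant speed. -/
def StrandSystem.ofShift (center : Fin k → OneManifold m n) (speed : Fin k → ℝ)
    (injective : ∀ i j, ∀ s ∈ Set.Icc (-1 : ℝ) 1, ∀ t ∈ Set.Icc (-1 : ℝ) 1,
      shift (center i) (speed i * s) = shift (center j) (speed j * t) → i = j ∧ s = t)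
    (notMem : ∀ i, ∀ t ∈ Set.Icc (-1 : ℝ) 1, shift (center i) (speed i * t) ∉ endPoints m n) :
    StrandSystem m n k where
  st i t := shift (center i) (speed i * t)
  ς i := unitSign (speed i)
  continuous i := (continuous_shift _).comp (by fun_prop)
  injective := injective
  halfBranch_eq i t ht τ := by
    have hs : speed i ≠ 0 := fun h => by
      have := (injective i i (-1) (by simp) 1 (by simp) (by simp [h])).2
      norm_num at this
    unfold halfBranch
    -- Rescaling the parameter by |speed| does not change the one-sided filter and turns unit speed
    -- into the speed of the strand.
    conv_lhs => rw [← map_mul_nhdsGT_zero (abs_pos.2 hs), Filter.map_map]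
    congr 1
    funext s
    simp only [Function.comp_apply]
    rw [shift_shift (mem_shiftDom_of_shift_notMem_endPoints (notMem i t ht))]
    congr 1
    push_cast
    linear_combination ((τ : ℤ) : ℝ) * s * unitSign_mul_abs (speed i)
  outside i τ := by
    have hs : speed i ≠ 0 := fun h => by
      have := (injective i i (-1) (by simp) 1 (by simp) (by simp [h])).2
      norm_num at this
    -- Within this distance of the end time, two times on the same strand correspond to source
    -- parameters less than 1 apart, the range in which `shift` is injective even on a circle. Times
    -- farther away, and all other strands, are handled by compactness.
    have hδ : 0 < (2 * |speed i|)⁻¹ := by positivity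
    have hτ := unit_mem_Icc τ
    have hc : Filter.Tendsto (fun s : ℝ => shift (center i)
        (speed i * (((τ : ℤ) : ℝ) + ((τ : ℤ) : ℝ) * s))) (𝓝[>] 0)
        (𝓝 (shift (center i) (speed i * ((τ : ℤ) : ℝ)))) := by
      have h : Continuous fun s : ℝ => shift (center i)
          (speed i * (((τ : ℤ) : ℝ) + ((τ : ℤ) : ℝ) * s)) :=
        (continuous_shift _).comp (by fun_prop)
      simpa using (h.tendsto 0).mono_left nhdsWithin_le_nhds
    have hfar : ∀ j (K : Set ℝ), IsCompact K → K ⊆ Set.Icc (-1) 1 →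
        (j = i → ((τ : ℤ) : ℝ) ∉ K) → ∀ᶠ s : ℝ in 𝓝[>] 0, ∀ t ∈ K, shift (center i)
          (speed i * (((τ : ℤ) : ℝ) + ((τ : ℤ) : ℝ) * s)) ≠ shift (center j) (speed j * t) := by
      intro j K hK hK1 hK2
      have hcl : IsClosed ((fun t => shift (center j) (speed j * t)) '' K) :=
        (hK.image ((continuous_shift _).comp (by fun_prop))).isClosed
      have hn : shift (center i) (speed i * ((τ : ℤ) : ℝ)) ∉
          (fun t => shift (center j) (speed j * t)) '' K := by
        rintro ⟨t, ht, he⟩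
        obtain ⟨rfl, rfl⟩ := injective _ _ _ (hK1 ht) _ hτ he
        exact hK2 rfl ht
      filter_upwards [hc (hcl.isOpen_compl.mem_nhds hn)] with s hs t ht he
      exact hs ⟨t, ht, he.symm⟩
    have hdom : ∀ᶠ s : ℝ in 𝓝[>] 0,
        speed i * (((τ : ℤ) : ℝ) + ((τ : ℤ) : ℝ) * s) ∈ shiftDom (center i) := by
      have hx := notMem i _ hτ
      have h0 := mem_shiftDom_of_shift_notMem_endPoints hx
      have h1 := (mem_endPoints_iff _).1 hx
      have h2 : Filter.Tendsto (fun s : ℝ => speed i * (((τ : ℤ) : ℝ) * s)) (𝓝[>] 0) (𝓝 0) := by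
        simpa using (tendsto_unit_mul τ).const_mul (speed i)
      filter_upwards [h2 h1] with s hs
      rw [mul_add]
      exact (mem_shiftDom_shift h0 _).1 hs
    rw [Filter.eventually_all]
    intro j
    by_cases hij : j = i
    · subst hij
      have hK : IsCompact (Set.Icc (-1 : ℝ) 1 \ Metric.ball ((τ : ℤ) : ℝ) (2 * |speed j|)⁻¹) :=
        isCompact_Icc.diff Metric.isOpen_ball
      filter_upwards [hfar j _ hK Set.sdiff_subset fun _ h => h.2 (Metric.mem_ball_self hδ),
        hdom, Ioo_mem_nhdsGT hδ] with s h1 h2 h3 t ht he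
      by_cases htb : t ∈ Metric.ball ((τ : ℤ) : ℝ) (2 * |speed j|)⁻¹
      · have h4 := shift_injOn (center j) h2
          (mem_shiftDom_of_shift_notMem_endPoints (notMem j t ht)) (by
            rw [← mul_sub, abs_mul]
            have h5 : |((τ : ℤ) : ℝ) + ((τ : ℤ) : ℝ) * s - t| < 2 * (2 * |speed j|)⁻¹ := by
              rw [Metric.mem_ball, Real.dist_eq] at htb
              calc |((τ : ℤ) : ℝ) + ((τ : ℤ) : ℝ) * s - t|
                  = |((τ : ℤ) : ℝ) * s - (t - ((τ : ℤ) : ℝ))| := by congr 1; ring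
                _ ≤ |((τ : ℤ) : ℝ) * s| + |t - ((τ : ℤ) : ℝ)| := abs_sub _ _
                _ < _ := by
                  have : |((τ : ℤ) : ℝ) * s| = s := by
                    rcases Int.units_eq_one_or τ with rfl | rfl <;> simp [abs_of_pos h3.1]
                  rw [this]
                  linarith [h3.2]
            calc _ < |speed j| * (2 * (2 * |speed j|)⁻¹) :=
                  mul_lt_mul_of_pos_left h5 (abs_pos.2 hs)
              _ = 1 := by
                have := abs_ne_zero.2 hs
                field_simp) he
        have h6 := mul_left_cancel₀ hs h4
        have h7 := h3.1
        rw [← h6] at ht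
        rcases Int.units_eq_one_or τ with rfl | rfl
        · have := ht.2
          simp at this
          linarith
        · have := ht.1
          simp at this
          linarith
      · exact h1 t ⟨ht, htb⟩ he
    · exact hfar j _ isCompact_Icc subset_rfl fun h => absurd h hij

section Surface

variable {S : Type*} [TopologicalSpace S] [ChartedSpace (EuclideanHalfSpace 2) S]

theorem velocity_congr {f g : OneManifold m n → S} {x : OneManifold m n}
    (h : f =ᶠ[𝓝 x] g) : velocity f x = velocity g x := by
  have h1 : ∀ᶠ s : ℝ in 𝓝 0, f (shift x s) = g (shift x s) := by
    rw [nhds_eq_map_shift] at h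
    exact Filter.eventually_map.1 h
  unfold velocity
  rw [Filter.EventuallyEq.mfderivWithin_eq (h1.filter_mono nhdsWithin_le_nhds)
    (by simpa [shift_zero] using h.self_of_nhds)]
  rfl

variable [IsManifold (𝓡∂ 2) ∞ S] {o : SurfaceOrientation S}

namespace OrientedDisc

variable (d : OrientedDisc o)

/-- The derivative of `ψ` at `p`, as a linear map between model spaces. -/
def derivative (p : ℝ × ℝ) : ℝ × ℝ →L[ℝ] EuclideanSpace ℝ (Fin 2) :=
  mfderiv 𝓘(ℝ, ℝ × ℝ) (𝓡∂ 2) d.ψ p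

theorem hasFDerivAt_extChartAt (p : ℝ × ℝ) :
    HasFDerivAt (fun q => extChartAt (𝓡∂ 2) (d.ψ p) (d.ψ q)) (d.derivative p) p := by
  have h := (d.smooth p).mdifferentiableAt (by simp)
  have := h.hasMFDerivAt.2
  simp only [mfld_simps] at this
  rw [← hasFDerivWithinAt_univ]
  exact this

theorem positive_derivative (p : ℝ × ℝ) :
    0 < ((o.sign (d.ψ p) : ℤ) : ℝ) * det2 (d.derivative p (1, 0)) (d.derivative p (0, 1)) :=
  d.positive p

/-- At a boundary point the first chart coordinate, which is never negative, would have a minimum 0.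
Its derivative along the disc would then vanish, against the positive determinant. -/
theorem notMem_boundary (p : ℝ × ℝ) : d.ψ p ∉ (𝓡∂ 2).boundary S := by
  intro hp
  have hp' : (extChartAt (𝓡∂ 2) (d.ψ p) (d.ψ p)) 0 = 0 := by
    have : extChartAt (𝓡∂ 2) (d.ψ p) (d.ψ p) ∈ frontier (Set.range (𝓡∂ 2)) := hp
    rw [frontier_range_modelWithCornersEuclideanHalfSpace] at this
    exact this.symm
  have hnn : ∀ q, 0 ≤ (extChartAt (𝓡∂ 2) (d.ψ p) (d.ψ q)) 0 := by
    intro q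
    have : extChartAt (𝓡∂ 2) (d.ψ p) (d.ψ q) ∈ Set.range (𝓡∂ 2) := by
      rw [extChartAt_coe]
      exact Set.mem_range_self _
    rw [range_modelWithCornersEuclideanHalfSpace] at this
    exact this
  have hd : HasFDerivAt (fun q => (extChartAt (𝓡∂ 2) (d.ψ p) (d.ψ q)) 0)
      ((EuclideanSpace.proj (0 : Fin 2) : EuclideanSpace ℝ (Fin 2) →L[ℝ] ℝ).comp
        (d.derivative p)) p :=
    (EuclideanSpace.proj (0 : Fin 2) : EuclideanSpace ℝ (Fin 2) →L[ℝ] ℝ).hasFDerivAt.comp p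
      (d.hasFDerivAt_extChartAt p)
  have hmin : IsLocalMin (fun q => (extChartAt (𝓡∂ 2) (d.ψ p) (d.ψ q)) 0) p :=
    Filter.Eventually.of_forall fun q => hp'.trans_le (hnn q)
  have hz := hmin.hasFDerivAt_eq_zero hd
  have hz' : ∀ v, (d.derivative p v) 0 = 0 := fun v => by
    simpa using DFunLike.congr_fun hz v
  have := d.positive_derivative p
  simp [det2, hz'] at this

end OrientedDisc

/-- The diagram `D` draws the curves `c i` in the disc `d` on the strands, and does not meet the image
of the square elsewhere. -/
structure DrawnBy (R : StrandSystem m n k) (speed : Fin k → ℝ) (d : OrientedDisc o)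
    (D : Diagram S m n) (c : Fin k → ℝ → ℝ × ℝ) : Prop where
  speed_ne_zero : ∀ i, speed i ≠ 0
  ς_eq : ∀ i, R.ς i = unitSign (speed i)
  shift_st : ∀ i, ∀ t ∈ Set.Icc (-1 : ℝ) 1, ∀ s,
    shift (R.st i t) (speed i * s) = R.st i (t + s)
  mem_square : ∀ i, ∀ t ∈ Set.Icc (-1 : ℝ) 1, c i t ∈ square
  inside : ∀ i, ∀ t ∈ Set.Icc (-1 : ℝ) 1, D.f (R.st i t) = d.ψ (c i t)
  outside : ∀ x ∉ R.support, D.f x ∉ d.ψ '' square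

namespace DrawnBy

variable {R : StrandSystem m n k} {speed : Fin k → ℝ} {d : OrientedDisc o}
  {D D' : Diagram S m n} {c c' : Fin k → ℝ → ℝ × ℝ}

theorem notMem_endPoints (h : DrawnBy R speed d D c) (i : Fin k) {t : ℝ}
    (ht : t ∈ Set.Icc (-1 : ℝ) 1) : R.st i t ∉ endPoints m n := by
  rw [← D.preimage_boundary, Set.mem_preimage, h.inside i t ht]
  exact d.notMem_boundary _

theorem mem_support_iff (h : DrawnBy R speed d D c) (x : OneManifold m n) :
    x ∈ R.support ↔ D.f x ∈ d.ψ '' square := by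
  refine ⟨?_, fun hx => by_contra fun hx' => h.outside x hx' hx⟩
  rintro ⟨i, t, ht, rfl⟩
  exact ⟨_, h.mem_square i t ht, (h.inside i t ht).symm⟩

theorem mem_support_of_eq (h : DrawnBy R speed d D c) {x y : OneManifold m n} (hxy : D.f x = D.f y)
    (hx : x ∈ R.support) : y ∈ R.support := by
  rw [h.mem_support_iff] at hx ⊢
  rwa [← hxy]

theorem eq_iff (h : DrawnBy R speed d D c) {i j : Fin k} {s t : ℝ} (hs : s ∈ Set.Icc (-1 : ℝ) 1)
    (ht : t ∈ Set.Icc (-1 : ℝ) 1) : D.f (R.st i s) = D.f (R.st j t) ↔ c i s = c j t := by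
  rw [h.inside i s hs, h.inside j t ht]
  exact d.openEmbedding.injective.eq_iff

/-- Strand time runs `(speed i)⁻¹` times as fast as source time; the rest is the chain rule in the
chart. -/
theorem velocity_eq (h : DrawnBy R speed d D c) {i : Fin k} {t : ℝ} (ht : t ∈ Set.Ioo (-1 : ℝ) 1)
    {v : ℝ × ℝ} (hv : HasDerivAt (c i) v t) :
    velocity D.f (R.st i t) = (speed i)⁻¹ • d.derivative (c i t) v := by
  have ht' := Set.Ioo_subset_Icc_self ht
  have h1 := (D.hasDerivWithinAt_extChartAt (R.st i t)).hasDerivAt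
    ((mem_endPoints_iff _).1 (h.notMem_endPoints i ht'))
  have h2 : HasDerivAt (fun s => c i (t + (speed i)⁻¹ * s)) ((speed i)⁻¹ • v) 0 := by
    have h3 : HasDerivAt (fun s => t + (speed i)⁻¹ * s) (speed i)⁻¹ 0 := by
      simpa using ((hasDerivAt_id (0 : ℝ)).const_mul (speed i)⁻¹).const_add t
    have h4 : HasDerivAt (c i) v (t + (speed i)⁻¹ * 0) := by simpa using hv
    exact h4.scomp 0 h3
  have h5 : HasFDerivAt (fun q => extChartAt (𝓡∂ 2) (d.ψ (c i t)) (d.ψ q)) (d.derivative (c i t))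
      (c i (t + (speed i)⁻¹ * 0)) := by simpa using d.hasFDerivAt_extChartAt (c i t)
  have h6 := h5.comp_hasDerivAt 0 h2
  rw [map_smul] at h6
  refine h1.unique (h6.congr_of_eventuallyEq ?_)
  have h7 : ∀ᶠ s : ℝ in 𝓝 0, t + (speed i)⁻¹ * s ∈ Set.Ioo (-1 : ℝ) 1 := by
    have : Continuous fun s : ℝ => t + (speed i)⁻¹ * s := by fun_prop
    exact (this.tendsto 0) (by simpa using isOpen_Ioo.mem_nhds ht)
  filter_upwards [h7] with s hs
  have h8 := h.shift_st i t ht' ((speed i)⁻¹ * s)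
  rw [mul_inv_cancel_left₀ (h.speed_ne_zero i)] at h8
  simp only [Function.comp_apply]
  rw [h8, h.inside i _ (Set.Ioo_subset_Icc_self hs), h.inside i t ht']

/-- The sign of a crossing of two curves in the disc. -/
theorem sign_eq (h : DrawnBy R speed d D c) (x : D.Crossing) {i j : Fin k} {s t : ℝ}
    (hs : s ∈ Set.Ioo (-1 : ℝ) 1) (ht : t ∈ Set.Ioo (-1 : ℝ) 1) (hu : x.upper = R.st i s)
    (hl : x.lower = R.st j t) {v w : ℝ × ℝ} (hv : HasDerivAt (c i) v s)
    (hw : HasDerivAt (c j) w t) :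
    v.1 * w.2 - v.2 * w.1 ≠ 0 ∧
    x.sign o * R.ς i * R.ς j = unitSign (v.1 * w.2 - v.2 * w.1) := by
  have he : c i s = c j t := by
    rw [← h.eq_iff (Set.Ioo_subset_Icc_self hs) (Set.Ioo_subset_Icc_self ht), ← hu, ← hl]
    exact x.eq
  have hne := det2_ne_zero (D.transverse _ _ x.ne x.eq)
  have hsign := x.sign_eq o
  have hpos := d.positive_derivative (c i s)
  rw [hu, hl, h.velocity_eq hs hv, h.velocity_eq ht hw, ← he] at hne hsign
  rw [h.inside i s (Set.Ioo_subset_Icc_self hs)] at hsign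
  set L := d.derivative (c i s)
  have hlin : ∀ u : ℝ × ℝ, L u = u.1 • L (1, 0) + u.2 • L (0, 1) := by
    intro u
    rw [← map_smul, ← map_smul, ← map_add]
    simp
  -- Three independent factors: the inverse speeds, whose signs are the ς; the determinant in the
  -- plane; and the Jacobian of the disc, whose sign cancels against the orientation of S.
  have hdet : det2 ((speed i)⁻¹ • L v) ((speed j)⁻¹ • L w) = (speed i)⁻¹ * (speed j)⁻¹ *
      ((v.1 * w.2 - v.2 * w.1) * det2 (L (1, 0)) (L (0, 1))) := by
    rw [hlin v, hlin w]
    simp only [det2, PiLp.smul_apply, PiLp.add_apply, smul_eq_mul]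
    ring
  rw [hdet] at hne hsign
  have hinv : ∀ a : ℝ, a ≠ 0 → unitSign a⁻¹ = unitSign a := by
    intro a ha
    rcases lt_or_gt_of_ne ha with ha | ha
    · rw [unitSign_of_neg ha, unitSign_of_neg (inv_lt_zero.2 ha)]
    · rw [unitSign_of_pos ha, unitSign_of_pos (inv_pos.2 ha)]
  have hi := inv_ne_zero (h.speed_ne_zero i)
  have hj := inv_ne_zero (h.speed_ne_zero j)
  have h1 := right_ne_zero_of_mul hne
  have h2 := left_ne_zero_of_mul h1
  have h3 := right_ne_zero_of_mul h1
  refine ⟨h2, ?_⟩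
  have h4 := unitSign_of_pos hpos
  rw [unitSign_mul (intCast_unit_ne_zero _) h3, unitSign_intCast] at h4
  rw [hsign, unitSign_mul (mul_ne_zero hi hj) h1, unitSign_mul hi hj, unitSign_mul h2 h3,
    hinv _ (h.speed_ne_zero i), hinv _ (h.speed_ne_zero j), ← h.ς_eq, ← h.ς_eq]
  calc _ = (o.sign (d.ψ (c i s)) * unitSign (det2 (L (1, 0)) (L (0, 1)))) *
        ((R.ς i * R.ς i) * (R.ς j * R.ς j)) * unitSign (v.1 * w.2 - v.2 * w.1) := by ac_rfl
    _ = _ := by rw [h4]; simp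

/-- The crossings outside of the strands are the same if the diagrams agree there. -/
def agreeOutside (h : DrawnBy R speed d D c) (h' : DrawnBy R speed d D' c')
    (H : ∀ x ∉ R.support, D'.f x = D.f x ∧ (x ∈ D'.overSet ↔ x ∈ D.overSet)) :
    AgreeOutside o R D D' where
  equiv :=
    { toFun := fun x => ⟨⟨x.1.upper, x.1.lower, x.1.ne, by
          rw [(H _ x.2).1, (H _ fun hl => x.2 (h.mem_support_of_eq x.1.eq.symm hl)).1, x.1.eq],
          (H _ x.2).2.2 x.1.upper_mem⟩, x.2⟩
      invFun := fun x => ⟨⟨x.1.upper, x.1.lower, x.1.ne, by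
          rw [← (H _ x.2).1, ← (H _ fun hl => x.2 (h'.mem_support_of_eq x.1.eq.symm hl)).1,
            x.1.eq], (H _ x.2).2.1 x.1.upper_mem⟩, x.2⟩
      left_inv := fun x => rfl
      right_inv := fun x => rfl }
  upper_eq x := rfl
  lower_eq x := rfl
  sign_eq x := by
    have hv : ∀ y ∉ R.support, velocity D'.f y = velocity D.f y := fun y hy =>
      velocity_congr (Filter.mem_of_superset (R.isClosed_support.isOpen_compl.mem_nhds hy)
        fun z hz => (H z hz).1)
    rw [Diagram.Crossing.sign_eq, Diagram.Crossing.sign_eq]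
    simp only [Equiv.coe_fn_mk]
    rw [(H _ x.2).1, hv _ x.2, hv _ fun hl => x.2 (h.mem_support_of_eq x.1.eq.symm hl)]
  mem_doubleSet_iff x hx := by
    constructor
    · rintro ⟨y, hne, he⟩
      have hy : y ∉ R.support := fun hy => hx (h'.mem_support_of_eq he hy)
      exact ⟨y, hne, by rw [← (H x hx).1, ← (H y hy).1, he]⟩
    · rintro ⟨y, hne, he⟩
      have hy : y ∉ R.support := fun hy => hx (h.mem_support_of_eq he hy)
      exact ⟨y, hne, by rw [(H x hx).1, (H y hy).1, he]⟩

end DrawnBy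

namespace LocalReplacement

variable {D D' : Diagram S m n} {c c' : Fin k → ℝ → ℝ × ℝ}

theorem strand_notMem_endPoints (r : LocalReplacement o D D' k c c') (i : Fin k) (t : ℝ)
    (ht : t ∈ Set.Icc (-1 : ℝ) 1) : shift (r.center i) (r.speed i * t) ∉ endPoints m n := by
  rw [← D.preimage_boundary, Set.mem_preimage, r.inside i t ht]
  exact r.disc.notMem_boundary _

/-- The strands of a replacement. -/
def strands (r : LocalReplacement o D D' k c c') : StrandSystem m n k :=
  .ofShift r.center r.speed r.injective r.strand_notMem_endPoints

theorem speed_ne_zero (r : LocalReplacement o D D' k c c') (i : Fin k) : r.speed i ≠ 0 := fun h => by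
  have := (r.injective i i (-1) (by simp) 1 (by simp) (by simp [h])).2
  norm_num at this

theorem shift_strands (r : LocalReplacement o D D' k c c') (i : Fin k) (t : ℝ)
    (ht : t ∈ Set.Icc (-1 : ℝ) 1) (s : ℝ) :
    shift (r.strands.st i t) (r.speed i * s) = r.strands.st i (t + s) := by
  change shift (shift _ _) _ = shift _ _
  rw [shift_shift (mem_shiftDom_of_shift_notMem_endPoints (r.strand_notMem_endPoints i t ht)),
    mul_add]

theorem eq_of_notMem_support (r : LocalReplacement o D D' k c c') (x : OneManifold m n)
    (hx : x ∉ r.strands.support) : D'.f x = D.f x ∧ (x ∈ D'.overSet ↔ x ∈ D.overSet) :=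
  r.outside x fun i t ht he => hx ⟨i, t, Set.Ioo_subset_Icc_self ht, he⟩

theorem notMem_image (r : LocalReplacement o D D' k c c') (x : OneManifold m n)
    (hx : x ∉ r.strands.support) : D.f x ∉ r.disc.ψ '' square :=
  fun h => hx (r.only_strands x h)

theorem drawnBy (r : LocalReplacement o D D' k c c') :
    DrawnBy r.strands r.speed r.disc D c where
  speed_ne_zero := r.speed_ne_zero
  ς_eq _ := rfl
  shift_st := r.shift_strands
  mem_square := r.mem_square
  inside := r.inside
  outside := r.notMem_image

theorem drawnBy' (r : LocalReplacement o D D' k c c') :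
    DrawnBy r.strands r.speed r.disc D' c' where
  speed_ne_zero := r.speed_ne_zero
  ς_eq _ := rfl
  shift_st := r.shift_strands
  mem_square := r.mem_square'
  inside := r.inside'
  outside x hx := by
    rw [(r.eq_of_notMem_support x hx).1]
    exact r.notMem_image x hx

/-- The two diagrams have the same crossings outside of the strands. -/
def agreeOutside (r : LocalReplacement o D D' k c c') : AgreeOutside o r.strands D D' :=
  r.drawnBy.agreeOutside r.drawnBy' r.eq_of_notMem_support

/-- The curves have the same end points. -/
theorem curve_unit_eq (r : LocalReplacement o D D' k c c') (i : Fin k) (τ : ℤˣ) :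
    c' i ((τ : ℤ) : ℝ) = c i ((τ : ℤ) : ℝ) := by
  have hτ := unit_mem_Icc τ
  refine r.disc.openEmbedding.injective ?_
  rw [← r.inside i _ hτ, ← r.inside' i _ hτ]
  refine (r.outside _ fun j t ht he => ?_).1
  obtain ⟨-, rfl⟩ := r.injective _ _ _ hτ _ (Set.Ioo_subset_Icc_self ht) he
  rcases Int.units_eq_one_or τ with rfl | rfl <;> simp at ht

end LocalReplacement

end Surface

end Discs

section LocalSums

variable {m n k q : ℕ}

/-! ### Local sums of the Reidemeister moves -/

theorem sum_fin_one_fun {α β : Type*} [Fintype α] [AddCommMonoid β] (g : (Fin 1 → α) → β) :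
    ∑ f, g f = ∑ x, g ![x] := by
  refine Fintype.sum_equiv (Equiv.funUnique (Fin 1) α) _ _ fun f => congrArg g ?_
  ext i
  fin_cases i
  rfl

theorem sum_fin_two_fun {α β : Type*} [Fintype α] [AddCommMonoid β] (g : (Fin 2 → α) → β) :
    ∑ f, g f = ∑ x, ∑ y, g ![x, y] := by
  rw [← Fintype.sum_prod_type']
  refine Fintype.sum_equiv (finTwoArrowEquiv α) _ _ fun f => congrArg g ?_
  ext i
  fin_cases i <;> rfl

theorem sum_fin_three_fun {α β : Type*} [Fintype α] [AddCommMonoid β] (g : (Fin 3 → α) → β) :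
    ∑ f, g f = ∑ x, ∑ y, ∑ z, g ![x, y, z] := by
  simp_rw [← Fintype.sum_prod_type']
  let e : (Fin 3 → α) ≃ α × α × α :=
    { toFun := fun f => (f 0, f 1, f 2)
      invFun := fun p => ![p.1, p.2.1, p.2.2]
      left_inv := fun f => by ext i; fin_cases i <;> rfl
      right_inv := fun p => rfl }
  refine Fintype.sum_equiv e _ _ fun f => congrArg g ?_
  ext i
  fin_cases i <;> rfl

theorem sum_units_int {β : Type*} [AddCommMonoid β] (g : ℤˣ → β) : ∑ x, g x = g 1 + g (-1) := by
  rw [UnitsInt.univ, Finset.sum_pair (by decide)]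

theorem forall_units_int {P : ℤˣ → Prop} : (∀ τ, P τ) ↔ P 1 ∧ P (-1) :=
  ⟨fun h => ⟨h 1, h (-1)⟩, fun h τ => by rcases Int.units_eq_one_or τ with rfl | rfl; exacts [h.1, h.2]⟩

/-- The condition that two arcs with the colours `x₁` before and `x₂` after the first marked time,
`y₁` before and `y₂` after the second one, match after a splitting (`e` tells whether the splitting
disrespects the directions). -/
def joined (e x₁ x₂ y₁ y₂ : Bool) : Bool :=
  if e then x₁ == y₁ && x₂ == y₂ else x₁ == y₂ && x₂ == y₁

/-- The sign that encodes a splitting. -/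
def splitSign (e : Bool) : ℤˣ := if e then 1 else -1

theorem glue_iff_joined (e : Bool) (f g : ℤˣ → Bool) :
    (∀ τ, f τ = g (splitSign e * τ)) ↔ joined e (f (-1)) (f 1) (g (-1)) (g 1) = true := by
  rw [forall_units_int]
  cases e <;> simp [joined, splitSign, and_comm]

/-- A condition on a finite type is satisfied as often as the corresponding test succeeds. -/
theorem card_eq_sum_toNat {α : Type*} [Fintype α] {P : α → Prop} {f : α → Bool}
    (h : ∀ x, P x ↔ f x = true) : Nat.card {x // P x} = ∑ x, (f x).toNat := by
  classical
  rw [Nat.card_eq_fintype_card, Fintype.card_subtype, Finset.card_filter]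
  refine Finset.sum_congr rfl fun x _ => ?_
  cases hx : f x <;> simp [h, hx]

/-- The marked times of the crossings in the move `R₃`, before the move. -/
def triangle : Fin 3 → Bool → Fin 3 × Bool :=
  ![fun p => if p then (1, false) else (0, false), fun p => if p then (2, false) else (0, true),
    fun p => if p then (2, true) else (1, true)]

/-- The marked times of the crossings in the move `R₃`, after the move. -/
def triangle' : Fin 3 → Bool → Fin 3 × Bool :=
  ![fun p => if p then (1, true) else (0, true), fun p => if p then (2, true) else (0, false),
    fun p => if p then (2, false) else (1, false)]

theorem matching_triangle_iff (e₀ e₁ e₂ : Bool) (b : Fin 3 → ℤˣ → Bool) (M : Fin 3 → Bool) :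
    Matching triangle ![splitSign e₀, splitSign e₁, splitSign e₂] (markColor b M) ↔
      (joined e₀ (b 0 (-1)) (M 0) (b 1 (-1)) (M 1) && (joined e₁ (M 0) (b 0 1) (b 2 (-1)) (M 2) &&
        joined e₂ (M 1) (b 1 1) (M 2) (b 2 1))) = true := by
  have h : ∀ j : Fin 3 × Bool, ¬ ∀ a p, triangle a p ≠ j := by decide
  simp only [Matching, h, false_imp_iff, implies_true, true_and, Bool.and_eq_true]
  rw [Fin.forall_fin_succ, Fin.forall_fin_two]
  exact and_congr (glue_iff_joined _ _ _) (and_congr (glue_iff_joined _ _ _)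
    (glue_iff_joined _ _ _))

theorem matching_triangle'_iff (e₀ e₁ e₂ : Bool) (b : Fin 3 → ℤˣ → Bool) (M : Fin 3 → Bool) :
    Matching triangle' ![splitSign e₀, splitSign e₁, splitSign e₂] (markColor b M) ↔
      (joined e₀ (M 0) (b 0 1) (M 1) (b 1 1) && (joined e₁ (b 0 (-1)) (M 0) (M 2) (b 2 1) &&
        joined e₂ (b 1 (-1)) (M 1) (b 2 (-1)) (M 2))) = true := by
  have h : ∀ j : Fin 3 × Bool, ¬ ∀ a p, triangle' a p ≠ j := by decide
  simp only [Matching, h, false_imp_iff, implies_true, true_and, Bool.and_eq_true]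
  rw [Fin.forall_fin_succ, Fin.forall_fin_two]
  exact and_congr (glue_iff_joined _ _ _) (and_congr (glue_iff_joined _ _ _)
    (glue_iff_joined _ _ _))

/-- The number of colourings of the middle parts of the strands before the move `R₃`. -/
def triangleCount (e₀ e₁ e₂ l₀ l₁ l₂ r₀ r₁ r₂ : Bool) : ℕ :=
  ∑ x, ∑ y, ∑ z, (joined e₀ l₀ x l₁ y && (joined e₁ x r₀ l₂ z && joined e₂ y r₁ z r₂)).toNat

/-- The number of colourings of the middle parts of the strands after the move `R₃`. -/
def triangleCount' (e₀ e₁ e₂ l₀ l₁ l₂ r₀ r₁ r₂ : Bool) : ℕ :=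
  ∑ x, ∑ y, ∑ z, (joined e₀ x r₀ y r₁ && (joined e₁ l₀ x z r₂ && joined e₂ l₁ y l₂ z)).toNat

theorem card_matching_triangle (e₀ e₁ e₂ : Bool) (b : Fin 3 → ℤˣ → Bool) :
    Nat.card {M : Fin 3 → Bool //
      Matching triangle ![splitSign e₀, splitSign e₁, splitSign e₂] (markColor b M)} =
    triangleCount e₀ e₁ e₂ (b 0 (-1)) (b 1 (-1)) (b 2 (-1)) (b 0 1) (b 1 1) (b 2 1) := by
  rw [card_eq_sum_toNat (matching_triangle_iff e₀ e₁ e₂ b), sum_fin_three_fun]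
  rfl

theorem card_matching_triangle' (e₀ e₁ e₂ : Bool) (b : Fin 3 → ℤˣ → Bool) :
    Nat.card {M : Fin 3 → Bool //
      Matching triangle' ![splitSign e₀, splitSign e₁, splitSign e₂] (markColor b M)} =
    triangleCount' e₀ e₁ e₂ (b 0 (-1)) (b 1 (-1)) (b 2 (-1)) (b 0 1) (b 1 1) (b 2 1) := by
  rw [card_eq_sum_toNat (matching_triangle'_iff e₀ e₁ e₂ b), sum_fin_three_fun]
  rfl

/-- Three splittings look the same before and after the move. Three others each join the ends like
the splitting (false, true, false) on the opposite side of the move, and (true, false, true) does so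
too but leaves the inner triangle as an extra circle. -/
theorem triangleCount_relations : ∀ l₀ l₁ l₂ r₀ r₁ r₂ : Bool,
    (∀ e₀ e₁ e₂, (e₀, e₁, e₂) ∈ [(false, false, false), (true, true, false), (false, true, true)] →
      triangleCount e₀ e₁ e₂ l₀ l₁ l₂ r₀ r₁ r₂ = triangleCount' e₀ e₁ e₂ l₀ l₁ l₂ r₀ r₁ r₂) ∧
    (∀ e₀ e₁ e₂, (e₀, e₁, e₂) ∈ [(true, false, false), (false, false, true), (true, true, true)] →
      triangleCount e₀ e₁ e₂ l₀ l₁ l₂ r₀ r₁ r₂ = triangleCount' false true false l₀ l₁ l₂ r₀ r₁ r₂ ∧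
      triangleCount' e₀ e₁ e₂ l₀ l₁ l₂ r₀ r₁ r₂ =
        triangleCount false true false l₀ l₁ l₂ r₀ r₁ r₂) ∧
    triangleCount true false true l₀ l₁ l₂ r₀ r₁ r₂ =
      2 * triangleCount' false true false l₀ l₁ l₂ r₀ r₁ r₂ ∧
    triangleCount' true false true l₀ l₁ l₂ r₀ r₁ r₂ =
      2 * triangleCount false true false l₀ l₁ l₂ r₀ r₁ r₂ := by
  decide +kernel

/-- The marked times of the crossing after the move `R₁`. -/
def kink : Fin 1 → Bool → Fin 1 × Bool := ![fun p => (0, p)]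

/-- The marked times of the crossings after the move `R₂`. -/
def bigon : Fin 2 → Bool → Fin 2 × Bool :=
  ![fun p => if p then (1, false) else (0, false), fun p => if p then (1, true) else (0, true)]

theorem matching_empty_iff (pos : Fin 0 → Bool → Fin k × Bool) (η : Fin 0 → ℤˣ)
    (b : Fin k → ℤˣ → Bool) (M : Fin k → Bool) :
    Matching pos η (markColor b M) ↔ ∀ i, M i = b i (-1) ∧ M i = b i 1 := by
  simp only [Matching, IsEmpty.forall_iff, true_imp_iff, and_true]
  constructor
  · exact fun h i => ⟨h (i, false), (h (i, true)).symm⟩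
  · rintro h ⟨i, p⟩
    cases p
    · exact (h i).1
    · exact (h i).2.symm

theorem matching_kink_iff (e : Bool) (b : Fin 1 → ℤˣ → Bool) (M : Fin 1 → Bool) :
    Matching kink ![splitSign e] (markColor b M) ↔
      joined e (b 0 (-1)) (M 0) (M 0) (b 0 1) = true := by
  have h : ∀ j : Fin 1 × Bool, ¬ ∀ a p, kink a p ≠ j := by decide
  simp only [Matching, h, false_imp_iff, implies_true, true_and]
  rw [Fin.forall_fin_one]
  exact glue_iff_joined _ _ _

theorem matching_bigon_iff (e₀ e₁ : Bool) (b : Fin 2 → ℤˣ → Bool) (M : Fin 2 → Bool) :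
    Matching bigon ![splitSign e₀, splitSign e₁] (markColor b M) ↔
      (joined e₀ (b 0 (-1)) (M 0) (b 1 (-1)) (M 1) &&
        joined e₁ (M 0) (b 0 1) (M 1) (b 1 1)) = true := by
  have h : ∀ j : Fin 2 × Bool, ¬ ∀ a p, bigon a p ≠ j := by decide
  simp only [Matching, h, false_imp_iff, implies_true, true_and, Bool.and_eq_true]
  rw [Fin.forall_fin_two]
  exact and_congr (glue_iff_joined _ _ _) (glue_iff_joined _ _ _)

theorem card_matching_empty_one (pos : Fin 0 → Bool → Fin 1 × Bool) (η : Fin 0 → ℤˣ)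
    (b : Fin 1 → ℤˣ → Bool) : Nat.card {M : Fin 1 → Bool // Matching pos η (markColor b M)} =
      ∑ x, (x == b 0 (-1) && x == b 0 1).toNat := by
  rw [card_eq_sum_toNat (f := fun M => M 0 == b 0 (-1) && M 0 == b 0 1) fun M => by
    rw [matching_empty_iff, Fin.forall_fin_one]; simp, sum_fin_one_fun]
  rfl

theorem card_matching_empty_two (pos : Fin 0 → Bool → Fin 2 × Bool) (η : Fin 0 → ℤˣ)
    (b : Fin 2 → ℤˣ → Bool) : Nat.card {M : Fin 2 → Bool // Matching pos η (markColor b M)} =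
      ∑ x, ∑ y, ((x == b 0 (-1) && x == b 0 1) && (y == b 1 (-1) && y == b 1 1)).toNat := by
  rw [card_eq_sum_toNat (f := fun M => (M 0 == b 0 (-1) && M 0 == b 0 1) &&
    (M 1 == b 1 (-1) && M 1 == b 1 1)) fun M => by
    rw [matching_empty_iff, Fin.forall_fin_two]; simp, sum_fin_two_fun]
  rfl

theorem card_matching_kink (e : Bool) (b : Fin 1 → ℤˣ → Bool) :
    Nat.card {M : Fin 1 → Bool // Matching kink ![splitSign e] (markColor b M)} =
      ∑ x, (joined e (b 0 (-1)) x x (b 0 1)).toNat := by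
  rw [card_eq_sum_toNat (matching_kink_iff e b), sum_fin_one_fun]
  rfl

theorem card_matching_bigon (e₀ e₁ : Bool) (b : Fin 2 → ℤˣ → Bool) :
    Nat.card {M : Fin 2 → Bool //
      Matching bigon ![splitSign e₀, splitSign e₁] (markColor b M)} =
      ∑ x, ∑ y, (joined e₀ (b 0 (-1)) x (b 1 (-1)) y && joined e₁ x (b 0 1) y (b 1 1)).toNat := by
  rw [card_eq_sum_toNat (matching_bigon_iff e₀ e₁ b), sum_fin_two_fun]
  rfl

/-- One splitting of a kink straightens the strand, the other cuts off the loop as a circle. -/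
theorem kinkCount_relations : ∀ l r : Bool,
    (∑ x, (joined true l x x r).toNat) = ∑ x, (x == l && x == r).toNat ∧
    (∑ x, (joined false l x x r).toNat) = 2 * ∑ x, (x == l && x == r).toNat := by
  decide +kernel

/-- Splitting both crossings along the strands restores the picture before the move. The three other
splittings join the ends in one and the same way, and the last of them also closes up the bigon. -/
theorem bigonCount_relations : ∀ l₀ l₁ r₀ r₁ : Bool,
    (∑ x, ∑ y, (joined false l₀ x l₁ y && joined false x r₀ y r₁).toNat) =
      (∑ x, ∑ y, ((x == l₀ && x == r₀) && (y == l₁ && y == r₁)).toNat) ∧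
    (∑ x, ∑ y, (joined false l₀ x l₁ y && joined true x r₀ y r₁).toNat) =
      (∑ x, ∑ y, (joined true l₀ x l₁ y && joined false x r₀ y r₁).toNat) ∧
    (∑ x, ∑ y, (joined true l₀ x l₁ y && joined true x r₀ y r₁).toNat) =
      2 * ∑ x, ∑ y, (joined true l₀ x l₁ y && joined false x r₀ y r₁).toNat := by
  decide +kernel

theorem eq_of_two_pow_eq {a b : ℕ} (h : 2 ^ a = 2 ^ b) : a = b := Nat.pow_right_injective le_rfl h

theorem eq_succ_of_two_pow_eq {a b : ℕ} (h : 2 ^ a = 2 * 2 ^ b) : a = b + 1 :=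
  eq_of_two_pow_eq (by rw [h, pow_succ, mul_comm])

open LaurentPolynomial

section LocalSum

variable {R : StrandSystem m n k} {P : (OneManifold m n × ℤˣ → Bool) → Prop}

theorem localSum_zero (ε : Fin 0 → ℤˣ) (N : (Fin 0 → ℤˣ) → ℕ) :
    localSum ε N = (-T 2 - T (-2)) ^ (N ![] - 1) := by
  rw [localSum, Fintype.sum_subsingleton _ ![]]
  simp

/-- With x the power of δ before the move, the two splittings give A^(-ε)·x + A^ε·δ·x = -A^(3ε)·x.
-/
theorem localSum_kink {R : StrandSystem m n 1} {pos : Fin 0 → Bool → Fin 1 × Bool}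
    {N : (Fin 0 → ℤˣ) → ℕ} {N' : (Fin 1 → ℤˣ) → ℕ} (hN : ∀ η, 0 < N η)
    (h : ∀ η, 2 ^ N η = Nat.card (R.cutColorings P (Matching pos η)))
    (h' : ∀ η, 2 ^ N' η = Nat.card (R.cutColorings P (Matching kink η)))
    (ε : Fin 0 → ℤˣ) (ε' : Fin 1 → ℤˣ) :
    localSum ε' N' = -T (3 * (ε' 0 : ℤ)) * localSum ε N := by
  have h1 : N' ![1] = N ![] := eq_of_two_pow_eq (by
    rw [h, h']
    refine StrandSystem.card_cutColorings_congr fun b => ?_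
    rw [card_matching_empty_one]
    exact (card_matching_kink true b).trans (kinkCount_relations _ _).1)
  have h2 : N' ![-1] = N ![] + 1 := eq_succ_of_two_pow_eq (by
    rw [h, h']
    refine StrandSystem.card_cutColorings_two_mul fun b => ?_
    rw [card_matching_empty_one]
    exact (card_matching_kink false b).trans (kinkCount_relations _ _).2)
  obtain ⟨p, hp⟩ := Nat.exists_eq_succ_of_ne_zero (hN ![]).ne'
  rw [localSum_zero, localSum, sum_fin_one_fun, sum_units_int, h1, h2, hp]
  simp only [Fin.sum_univ_one, Matrix.cons_val_zero, Nat.succ_eq_add_one, Nat.add_sub_cancel,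
    pow_succ]
  generalize (-T 2 - T (-2) : LaurentPolynomial ℤ) ^ p = x
  rcases Int.units_eq_one_or (ε' 0) with he | he <;> rw [he] <;>
    simp only [mul_sub, mul_neg, neg_mul, mul_left_comm _ x, ← T_add] <;>
    norm_num
  ring

/-- Opposite signs make the exponents 0, 2, -2, 0. The last three terms share a power of δ with
coefficient A² + A⁻² + δ = 0, so only the splitting along the strands survives. -/
theorem localSum_bigon {R : StrandSystem m n 2} {pos : Fin 0 → Bool → Fin 2 × Bool}
    {N : (Fin 0 → ℤˣ) → ℕ} {N' : (Fin 2 → ℤˣ) → ℕ} (hN' : ∀ η, 0 < N' η)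
    (h : ∀ η, 2 ^ N η = Nat.card (R.cutColorings P (Matching pos η)))
    (h' : ∀ η, 2 ^ N' η = Nat.card (R.cutColorings P (Matching bigon η)))
    (ε : Fin 0 → ℤˣ) (ε' : Fin 2 → ℤˣ) (hε : ε' 1 = -ε' 0) :
    localSum ε' N' = localSum ε N := by
  have h1 : N' ![-1, -1] = N ![] := eq_of_two_pow_eq (by
    rw [h, h']
    refine StrandSystem.card_cutColorings_congr fun b => ?_
    rw [card_matching_empty_two]
    exact (card_matching_bigon false false b).trans (bigonCount_relations _ _ _ _).1)
  have h2 : N' ![-1, 1] = N' ![1, -1] := eq_of_two_pow_eq (by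
    rw [h', h']
    refine StrandSystem.card_cutColorings_congr fun b => ?_
    exact ((card_matching_bigon false true b).trans (bigonCount_relations _ _ _ _).2.1).trans
      (card_matching_bigon true false b).symm)
  have h3 : N' ![1, 1] = N' ![1, -1] + 1 := eq_succ_of_two_pow_eq (by
    rw [h', h']
    refine StrandSystem.card_cutColorings_two_mul fun b => ?_
    exact ((card_matching_bigon true true b).trans (bigonCount_relations _ _ _ _).2.2).trans
      (congrArg _ (card_matching_bigon true false b).symm))
  obtain ⟨p, hp⟩ := Nat.exists_eq_succ_of_ne_zero (hN' ![1, -1]).ne'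
  rw [localSum_zero, localSum, sum_fin_two_fun, sum_units_int, sum_units_int, sum_units_int, h1, h2,
    h3, hp]
  simp only [Fin.sum_univ_two, Matrix.cons_val_zero, Matrix.cons_val_one, Nat.succ_eq_add_one,
    Nat.add_sub_cancel, pow_succ, hε]
  generalize (-T 2 - T (-2) : LaurentPolynomial ℤ) ^ p = x
  rcases Int.units_eq_one_or (ε' 0) with he | he <;> rw [he] <;>
    simp only [mul_sub, mul_neg, mul_left_comm _ x, ← T_add] <;>
    norm_num
  ring

/-- The first three splittings match term by term. The four splittings with the ends joined as by
(-1, 1, -1) on the other side must add up to the weight of that single splitting, the circle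
contributing δ. This holds for six of the eight sign patterns and fails for the two that are
excluded. -/
theorem localSum_triangle {R : StrandSystem m n 3} {N N' : (Fin 3 → ℤˣ) → ℕ}
    (hN : ∀ η, 0 < N η) (hN' : ∀ η, 0 < N' η)
    (h : ∀ η, 2 ^ N η = Nat.card (R.cutColorings P (Matching triangle η)))
    (h' : ∀ η, 2 ^ N' η = Nat.card (R.cutColorings P (Matching triangle' η)))
    (ε : Fin 3 → ℤˣ) (hε : ¬ (ε 0 = ε 2 ∧ ε 0 = -ε 1)) :
    localSum ε N' = localSum ε N := by
  have hs : ∀ e₀ e₁ e₂, (e₀, e₁, e₂) ∈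
      [(false, false, false), (true, true, false), (false, true, true)] →
      N' ![splitSign e₀, splitSign e₁, splitSign e₂] =
        N ![splitSign e₀, splitSign e₁, splitSign e₂] :=
    fun e₀ e₁ e₂ he => eq_of_two_pow_eq (by
      rw [h, h']
      refine StrandSystem.card_cutColorings_congr fun b => ?_
      rw [card_matching_triangle, card_matching_triangle']
      exact ((triangleCount_relations _ _ _ _ _ _).1 e₀ e₁ e₂ he).symm)
  have ht : ∀ e₀ e₁ e₂, (e₀, e₁, e₂) ∈
      [(true, false, false), (false, false, true), (true, true, true)] →
      N ![splitSign e₀, splitSign e₁, splitSign e₂] = N' ![-1, 1, -1] :=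
    fun e₀ e₁ e₂ he => eq_of_two_pow_eq (by
      rw [h, h']
      refine StrandSystem.card_cutColorings_congr fun b => ?_
      rw [card_matching_triangle]
      exact ((triangleCount_relations _ _ _ _ _ _).2.1 e₀ e₁ e₂ he).1.trans
        (card_matching_triangle' false true false b).symm)
  have ht' : ∀ e₀ e₁ e₂, (e₀, e₁, e₂) ∈
      [(true, false, false), (false, false, true), (true, true, true)] →
      N' ![splitSign e₀, splitSign e₁, splitSign e₂] = N ![-1, 1, -1] :=
    fun e₀ e₁ e₂ he => eq_of_two_pow_eq (by
      rw [h, h']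
      refine StrandSystem.card_cutColorings_congr fun b => ?_
      rw [card_matching_triangle']
      exact ((triangleCount_relations _ _ _ _ _ _).2.1 e₀ e₁ e₂ he).2.trans
        (card_matching_triangle false true false b).symm)
  have hd : N ![1, -1, 1] = N' ![-1, 1, -1] + 1 := eq_succ_of_two_pow_eq (by
    rw [h, h']
    refine StrandSystem.card_cutColorings_two_mul fun b => ?_
    exact ((card_matching_triangle true false true b).trans
      (triangleCount_relations _ _ _ _ _ _).2.2.1).trans
      (congrArg _ (card_matching_triangle' false true false b).symm))
  have hd' : N' ![1, -1, 1] = N ![-1, 1, -1] + 1 := eq_succ_of_two_pow_eq (by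
    rw [h, h']
    refine StrandSystem.card_cutColorings_two_mul fun b => ?_
    exact ((card_matching_triangle' true false true b).trans
      (triangleCount_relations _ _ _ _ _ _).2.2.2).trans
      (congrArg _ (card_matching_triangle false true false b).symm))
  have s1 : N' ![-1, -1, -1] = N ![-1, -1, -1] := hs false false false (by decide)
  have s2 : N' ![1, 1, -1] = N ![1, 1, -1] := hs true true false (by decide)
  have s3 : N' ![-1, 1, 1] = N ![-1, 1, 1] := hs false true true (by decide)
  have t1 : N ![1, -1, -1] = N' ![-1, 1, -1] := ht true false false (by decide)
  have t2 : N ![-1, -1, 1] = N' ![-1, 1, -1] := ht false false true (by decide)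
  have t3 : N ![1, 1, 1] = N' ![-1, 1, -1] := ht true true true (by decide)
  have t1' : N' ![1, -1, -1] = N ![-1, 1, -1] := ht' true false false (by decide)
  have t2' : N' ![-1, -1, 1] = N ![-1, 1, -1] := ht' false false true (by decide)
  have t3' : N' ![1, 1, 1] = N ![-1, 1, -1] := ht' true true true (by decide)
  obtain ⟨p, hp⟩ := Nat.exists_eq_succ_of_ne_zero (hN ![-1, 1, -1]).ne'
  obtain ⟨p', hp'⟩ := Nat.exists_eq_succ_of_ne_zero (hN' ![-1, 1, -1]).ne'
  simp only [localSum, sum_fin_three_fun, sum_units_int, s1, s2, s3, t1, t2, t3, t1', t2', t3', hd,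
    hd', hp, hp', Fin.sum_univ_three, Matrix.cons_val_zero, Matrix.cons_val_one, Matrix.cons_val,
    Nat.succ_eq_add_one, Nat.add_sub_cancel, pow_succ]
  generalize (-T 2 - T (-2) : LaurentPolynomial ℤ) ^ p = x
  generalize (-T 2 - T (-2) : LaurentPolynomial ℤ) ^ p' = x'
  rcases Int.units_eq_one_or (ε 0) with h0 | h0 <;> rcases Int.units_eq_one_or (ε 1) with h1 | h1 <;>
    rcases Int.units_eq_one_or (ε 2) with h2 | h2 <;>
    simp only [h0, h1, h2, neg_neg, and_self, not_true_eq_false] at hε ⊢ <;>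
    simp only [mul_sub, mul_neg, mul_left_comm _ x, mul_left_comm _ x', ← T_add] <;>
    norm_num <;> ring

end LocalSum

end LocalSums

section Graphs

variable {m n k q : ℕ}

/-! ### Crossings of graphs -/

/-- Before its first zero h stays positive by the intermediate value theorem, so slopes taken from
the left are nonpositive. Transversality later makes the inequality strict. -/
theorem deriv_nonpos_of_first_zero {h : ℝ → ℝ} {t₀ d : ℝ} (hc : ContinuousOn h (Set.Icc (-1) 1))
    (ht₀ : t₀ ∈ Set.Ioo (-1 : ℝ) 1) (h0 : h t₀ = 0)
    (hz : ∀ t ∈ Set.Icc (-1 : ℝ) 1, h t = 0 → t₀ ≤ t) (hpos : 0 < h (-1))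
    (hd : HasDerivAt h d t₀) : d ≤ 0 := by
  have key : ∀ t ∈ Set.Ioo (-1 : ℝ) t₀, 0 < h t := by
    intro t ht
    by_contra hneg
    push Not at hneg
    have hsub : Set.Icc (-1) t ⊆ Set.Icc (-1 : ℝ) 1 :=
      Set.Icc_subset_Icc_right (ht.2.trans ht₀.2).le
    obtain ⟨u, hu, hu0⟩ := intermediate_value_Icc' ht.1.le (hc.mono hsub) ⟨hneg, hpos.le⟩
    have := hz u (hsub hu) hu0
    linarith [hu.2, ht.2]
  have hs := (hasDerivWithinAt_iff_tendsto_slope' (s := Set.Iio t₀) (by simp)).1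
    hd.hasDerivWithinAt
  refine le_of_tendsto hs ?_
  filter_upwards [Ioo_mem_nhdsLT ht₀.1] with t ht
  rw [slope_def_field, h0, sub_zero]
  exact div_nonpos_of_nonneg_of_nonpos (key t ht).le (by linarith [ht.2])

/-- Obtained from the first zero by time reversal. -/
theorem deriv_nonneg_of_last_zero {h : ℝ → ℝ} {t₀ d : ℝ} (hc : ContinuousOn h (Set.Icc (-1) 1))
    (ht₀ : t₀ ∈ Set.Ioo (-1 : ℝ) 1) (h0 : h t₀ = 0)
    (hz : ∀ t ∈ Set.Icc (-1 : ℝ) 1, h t = 0 → t ≤ t₀) (hpos : 0 < h 1)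
    (hd : HasDerivAt h d t₀) : 0 ≤ d := by
  have hd' : HasDerivAt (fun t => h (-t)) (-d) (-t₀) := by
    have h1 : HasDerivAt h d (- -t₀) := by rwa [neg_neg]
    have h2 := h1.scomp (-t₀) (hasDerivAt_neg (-t₀))
    rwa [neg_one_smul] at h2
  have := deriv_nonpos_of_first_zero (h := fun t => h (-t)) (t₀ := -t₀)
    (hc.comp continuous_neg.continuousOn fun t ht => ⟨by linarith [ht.2], by linarith [ht.1]⟩)
    ⟨by linarith [ht₀.2], by linarith [ht₀.1]⟩ (by simpa using h0)
    (fun t ht ht' => by linarith [hz (-t) ⟨by linarith [ht.2], by linarith [ht.1]⟩ ht'])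
    (by simpa using hpos) hd'
  linarith

section Surface

variable {S : Type*} [TopologicalSpace S] [ChartedSpace (EuclideanHalfSpace 2) S]
  [IsManifold (𝓡∂ 2) ∞ S] {o : SurfaceOrientation S}

theorem TanglePresentation.sign_crossing {R : StrandSystem m n k} {D : Diagram S m n}
    (t : TanglePresentation R D q) (a : Fin q) : (t.crossing a).sign o =
      t.strandSign o a * R.ς (t.pos a false).1 * R.ς (t.pos a true).1 := by
  unfold strandSign
  symm
  calc _ = (t.crossing a).sign o * (R.ς (t.pos a false).1 * R.ς (t.pos a false).1) *
        (R.ς (t.pos a true).1 * R.ς (t.pos a true).1) := by ac_rfl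
    _ = _ := by simp

namespace DrawnBy

variable {R : StrandSystem m n k} {speed : Fin k → ℝ} {d : OrientedDisc o}
  {D : Diagram S m n} {g : Fin k → ℝ → ℝ} {height : Fin k → ℕ}

theorem graph_eq_iff (h : DrawnBy R speed d D fun i t => (t, g i t)) {i j : Fin k} {s t : ℝ}
    (hs : s ∈ Set.Icc (-1 : ℝ) 1) (ht : t ∈ Set.Icc (-1 : ℝ) 1) :
    D.f (R.st i s) = D.f (R.st j t) ↔ s = t ∧ g i s = g j t := by
  rw [h.eq_iff hs ht, Prod.mk.injEq]

/-- The crossing of two graphs. -/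
def graphCrossing (h : DrawnBy R speed d D fun i t => (t, g i t)) (hl : Layered D R.st g height)
    (hh : Function.Injective height) {i j : Fin k} (hij : i ≠ j) {t : ℝ}
    (ht : t ∈ Set.Icc (-1 : ℝ) 1) (hg : g i t = g j t) : D.Crossing :=
  if hlt : height j < height i then
    ⟨R.st i t, R.st j t, fun he => hij (R.injective _ _ _ ht _ ht he).1,
      (h.graph_eq_iff ht ht).2 ⟨rfl, hg⟩, (hl i j hij t ht hg).2 hlt⟩
  else
    ⟨R.st j t, R.st i t, fun he => hij (R.injective _ _ _ ht _ ht he).1.symm,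
      (h.graph_eq_iff ht ht).2 ⟨rfl, hg.symm⟩,
      (hl j i hij.symm t ht hg.symm).2 (lt_of_le_of_ne (not_lt.1 hlt) (hh.ne hij))⟩

theorem graphCrossing_of_lt (h : DrawnBy R speed d D fun i t => (t, g i t))
    (hl : Layered D R.st g height) (hh : Function.Injective height) {i j : Fin k} (hij : i ≠ j)
    {t : ℝ} (ht : t ∈ Set.Icc (-1 : ℝ) 1) (hg : g i t = g j t) (hlt : height j < height i) :
    (h.graphCrossing hl hh hij ht hg).upper = R.st i t ∧
    (h.graphCrossing hl hh hij ht hg).lower = R.st j t := by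
  simp [graphCrossing, hlt]

theorem graphCrossing_of_not_lt (h : DrawnBy R speed d D fun i t => (t, g i t))
    (hl : Layered D R.st g height) (hh : Function.Injective height) {i j : Fin k} (hij : i ≠ j)
    {t : ℝ} (ht : t ∈ Set.Icc (-1 : ℝ) 1) (hg : g i t = g j t) (hlt : ¬ height j < height i) :
    (h.graphCrossing hl hh hij ht hg).upper = R.st j t ∧
    (h.graphCrossing hl hh hij ht hg).lower = R.st i t := by
  simp [graphCrossing, hlt]

theorem exists_graphCrossing (h : DrawnBy R speed d D fun i t => (t, g i t))
    (hl : Layered D R.st g height) (hh : Function.Injective height) (x : D.Crossing)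
    (hx : x.upper ∈ R.support ∨ x.lower ∈ R.support) :
    ∃ (i j : Fin k) (hij : i < j) (t : ℝ) (ht : t ∈ Set.Icc (-1 : ℝ) 1) (hg : g i t = g j t),
      x = h.graphCrossing hl hh hij.ne ht hg := by
  have hu : x.upper ∈ R.support :=
    hx.elim id fun hx => h.mem_support_of_eq x.eq.symm hx
  obtain ⟨i, s, hs, hi⟩ := hu
  obtain ⟨j, t, ht, hj⟩ := h.mem_support_of_eq x.eq ⟨i, s, hs, hi⟩
  have he := x.eq
  rw [hi, hj, h.graph_eq_iff hs ht] at he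
  obtain ⟨rfl, hg⟩ := he
  have hij : i ≠ j := fun hij => x.ne (by rw [hi, hj, hij])
  have hlt := (hl i j hij s ht hg).1 (hi ▸ x.upper_mem)
  rcases hij.lt_or_gt with hij | hij
  · refine ⟨i, j, hij, s, ht, hg, Diagram.Crossing.ext_of_upper ?_⟩
    rw [(h.graphCrossing_of_lt hl hh hij.ne ht hg hlt).1, hi]
  · refine ⟨j, i, hij, s, ht, hg.symm, Diagram.Crossing.ext_of_upper ?_⟩
    rw [(h.graphCrossing_of_not_lt hl hh hij.ne ht hg.symm hlt.not_gt).1, hi]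

/-- The tangle of graphs whose crossings are listed by `pos`. -/
def graphTangle (h : DrawnBy R speed d D fun i t => (t, g i t)) (hl : Layered D R.st g height)
    (hh : Function.Injective height) (mark : Fin k → Bool → ℝ) (neg_one_lt : ∀ i, -1 < mark i false)
    (mark_lt : ∀ i, mark i false < mark i true) (lt_one : ∀ i, mark i true < 1)
    (pos : Fin q → Bool → Fin k × Bool)
    (pos_injective : ∀ a p b p', pos a p = pos b p' → a = b ∧ p = p')
    (pos_lt : ∀ a, (pos a false).1 < (pos a true).1)
    (mark_eq : ∀ a, mark (pos a true).1 (pos a true).2 = mark (pos a false).1 (pos a false).2)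
    (graph_eq : ∀ a, g (pos a false).1 (mark (pos a false).1 (pos a false).2) =
      g (pos a true).1 (mark (pos a false).1 (pos a false).2))
    (all : ∀ i j, i < j → ∀ t ∈ Set.Icc (-1 : ℝ) 1, g i t = g j t → ∃ a,
      i = (pos a false).1 ∧ j = (pos a true).1 ∧ t = mark (pos a false).1 (pos a false).2) :
    TanglePresentation R D q where
  mark := mark
  neg_one_lt := neg_one_lt
  mark_lt := mark_lt
  lt_one := lt_one
  crossing a := h.graphCrossing hl hh (pos_lt a).ne (t := mark (pos a false).1 (pos a false).2) (by
    have h1 := neg_one_lt (pos a false).1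
    have h2 := mark_lt (pos a false).1
    have h3 := lt_one (pos a false).1
    cases (pos a false).2 <;> constructor <;> linarith) (graph_eq a)
  pos := pos
  pos_injective := pos_injective
  place a := by
    rw [mark_eq a]
    by_cases hlt : height (pos a true).1 < height (pos a false).1
    · exact Or.inl (h.graphCrossing_of_lt hl hh _ _ _ hlt)
    · exact Or.inr (h.graphCrossing_of_not_lt hl hh _ _ _ hlt).symm
  exists_crossing x hx := by
    obtain ⟨i, j, hij, t, ht, hg, rfl⟩ := h.exists_graphCrossing hl hh x hx
    obtain ⟨a, rfl, rfl, rfl⟩ := all i j hij t ht hg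
    exact ⟨a, rfl⟩

/-- The sign of a crossing of graphs, with respect to their directions, depends on the slopes. -/
theorem sign_graphCrossing (h : DrawnBy R speed d D fun i t => (t, g i t))
    (hl : Layered D R.st g height) (hh : Function.Injective height) {i j : Fin k} (hij : i ≠ j)
    {t : ℝ} (ht' : t ∈ Set.Ioo (-1 : ℝ) 1) (ht : t ∈ Set.Icc (-1 : ℝ) 1) (hg : g i t = g j t)
    {u : ℝ} (hu : HasDerivAt (fun t => g j t - g i t) u t) (hd : DifferentiableAt ℝ (g i) t) :
    u ≠ 0 ∧ (h.graphCrossing hl hh hij ht hg).sign o * R.ς i * R.ς j =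
      unitSign u * if height j < height i then 1 else -1 := by
  have hi := hd.hasDerivAt
  have hj : HasDerivAt (g j) (deriv (g i) t + u) t := by
    have := hi.add hu
    refine this.congr_of_eventuallyEq (Filter.Eventually.of_forall fun s => ?_)
    simp
  have hi' : HasDerivAt (fun t => (t, g i t)) (1, deriv (g i) t) t := (hasDerivAt_id t).prodMk hi
  have hj' : HasDerivAt (fun t => (t, g j t)) (1, deriv (g i) t + u) t :=
    (hasDerivAt_id t).prodMk hj
  by_cases hlt : height j < height i
  · obtain ⟨h1, h2⟩ := h.graphCrossing_of_lt hl hh hij ht hg hlt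
    obtain ⟨h3, h4⟩ := h.sign_eq _ ht' ht' h1 h2 hi' hj'
    have h5 : (1 : ℝ) * (deriv (g i) t + u) - deriv (g i) t * 1 = u := by ring
    simp only [h5] at h3 h4
    exact ⟨h3, by rw [h4, if_pos hlt, mul_one]⟩
  · obtain ⟨h1, h2⟩ := h.graphCrossing_of_not_lt hl hh hij ht hg hlt
    obtain ⟨h3, h4⟩ := h.sign_eq _ ht' ht' h1 h2 hj' hi'
    have h5 : (1 : ℝ) * deriv (g i) t - (deriv (g i) t + u) * 1 = -u := by ring
    simp only [h5] at h3 h4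
    have h6 : u ≠ 0 := neg_ne_zero.1 h3
    refine ⟨h6, ?_⟩
    rw [if_neg hlt, mul_right_comm, h4]
    have h7 := unitSign_mul h6 (by norm_num : (-1 : ℝ) ≠ 0)
    rwa [unitSign_of_neg (by norm_num : (-1 : ℝ) < 0), mul_neg_one] at h7

/-- The sign of a crossing where the graph of `g j` comes from above. -/
theorem sign_graphCrossing_of_first (h : DrawnBy R speed d D fun i t => (t, g i t))
    (hl : Layered D R.st g height) (hh : Function.Injective height)
    (hg' : ∀ i, ContDiffOn ℝ ∞ (g i) (Set.Icc (-1) 1)) {i j : Fin k} (hij : i ≠ j)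
    {t : ℝ} (ht' : t ∈ Set.Ioo (-1 : ℝ) 1) (ht : t ∈ Set.Icc (-1 : ℝ) 1) (hg : g i t = g j t)
    (hz : ∀ s ∈ Set.Icc (-1 : ℝ) 1, g i s = g j s → t ≤ s) (hpos : g i (-1) < g j (-1)) :
    (h.graphCrossing hl hh hij ht hg).sign o * R.ς i * R.ς j =
      if height j < height i then -1 else 1 := by
  have hd : ∀ i, DifferentiableAt ℝ (g i) t := fun i =>
    ((hg' i).contDiffAt (Icc_mem_nhds ht'.1 ht'.2)).differentiableAt (by simp)
  have hu := ((hd j).sub (hd i)).hasDerivAt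
  obtain ⟨h1, h2⟩ := h.sign_graphCrossing hl hh hij ht' ht hg hu (hd i)
  have h3 := deriv_nonpos_of_first_zero ((hg' j).continuousOn.sub (hg' i).continuousOn) ht'
    (sub_eq_zero.2 hg.symm) (fun s hs hs' => hz s hs (sub_eq_zero.1 hs').symm) (sub_pos.2 hpos) hu
  rw [h2, unitSign_of_neg (lt_of_le_of_ne h3 h1)]
  split_ifs <;> simp

/-- The sign of a crossing where the graph of `g j` leaves above. -/
theorem sign_graphCrossing_of_last (h : DrawnBy R speed d D fun i t => (t, g i t))
    (hl : Layered D R.st g height) (hh : Function.Injective height)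
    (hg' : ∀ i, ContDiffOn ℝ ∞ (g i) (Set.Icc (-1) 1)) {i j : Fin k} (hij : i ≠ j)
    {t : ℝ} (ht' : t ∈ Set.Ioo (-1 : ℝ) 1) (ht : t ∈ Set.Icc (-1 : ℝ) 1) (hg : g i t = g j t)
    (hz : ∀ s ∈ Set.Icc (-1 : ℝ) 1, g i s = g j s → s ≤ t) (hpos : g i 1 < g j 1) :
    (h.graphCrossing hl hh hij ht hg).sign o * R.ς i * R.ς j =
      if height j < height i then 1 else -1 := by
  have hd : ∀ i, DifferentiableAt ℝ (g i) t := fun i =>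
    ((hg' i).contDiffAt (Icc_mem_nhds ht'.1 ht'.2)).differentiableAt (by simp)
  have hu := ((hd j).sub (hd i)).hasDerivAt
  obtain ⟨h1, h2⟩ := h.sign_graphCrossing hl hh hij ht' ht hg hu (hd i)
  have h3 := deriv_nonneg_of_last_zero ((hg' j).continuousOn.sub (hg' i).continuousOn) ht'
    (sub_eq_zero.2 hg.symm) (fun s hs hs' => hz s hs (sub_eq_zero.1 hs').symm) (sub_pos.2 hpos) hu
  rw [h2, unitSign_of_pos (lt_of_le_of_ne h3 h1.symm), one_mul]

end DrawnBy

end Surface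

end Graphs

section Moves

variable {m n k : ℕ}

section Surface

variable {S : Type*} [TopologicalSpace S] [ChartedSpace (EuclideanHalfSpace 2) S]
  [IsManifold (𝓡∂ 2) ∞ S] {o : SurfaceOrientation S}

/-! ### Invariance under the Reidemeister moves -/

/-- The tangle without crossings. -/
def DrawnBy.emptyTangle {R : StrandSystem m n k} {speed : Fin k → ℝ} {d : OrientedDisc o}
    {D : Diagram S m n} {c : Fin k → ℝ → ℝ × ℝ} (h : DrawnBy R speed d D c)
    (hc : ∀ i j, ∀ s ∈ Set.Icc (-1 : ℝ) 1, ∀ t ∈ Set.Icc (-1 : ℝ) 1, c i s = c j t →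
      i = j ∧ s = t) : TanglePresentation R D 0 where
  -- Any two ordered interior times would do: nothing is glued at them.
  mark _ p := if p then 1 / 2 else 0
  neg_one_lt _ := by norm_num
  mark_lt _ := by norm_num
  lt_one _ := by norm_num
  crossing := Fin.elim0
  pos := Fin.elim0
  pos_injective a := a.elim0
  place a := a.elim0
  exists_crossing x hx := by
    exfalso
    have hu : x.upper ∈ R.support := hx.elim id fun hx => h.mem_support_of_eq x.eq.symm hx
    obtain ⟨i, s, hs, hi⟩ := hu
    obtain ⟨j, t, ht, hj⟩ := h.mem_support_of_eq x.eq ⟨i, s, hs, hi⟩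
    have he := x.eq
    rw [hi, hj, h.eq_iff hs ht] at he
    obtain ⟨rfl, rfl⟩ := hc i j s hs t ht he
    exact x.ne (hi.trans hj.symm)

/-- The tangle with one kink. -/
theorem DrawnBy.exists_kinkTangle {R : StrandSystem m n 1} {speed : Fin 1 → ℝ}
    {d : OrientedDisc o} {D : Diagram S m n} {c : ℝ → ℝ × ℝ} (h : DrawnBy R speed d D fun _ => c)
    {t₁ t₂ : ℝ} (h₁ : -1 < t₁) (h₁₂ : t₁ < t₂) (h₂ : t₂ < 1) (hc : c t₁ = c t₂)
    (hc' : ∀ s ∈ Set.Icc (-1 : ℝ) 1, ∀ t ∈ Set.Icc (-1 : ℝ) 1, s < t → c s = c t →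
      s = t₁ ∧ t = t₂) : ∃ t : TanglePresentation R D 1, t.pos = kink := by
  have hm₁ : t₁ ∈ Set.Icc (-1 : ℝ) 1 := ⟨h₁.le, (h₁₂.trans h₂).le⟩
  have hm₂ : t₂ ∈ Set.Icc (-1 : ℝ) 1 := ⟨(h₁.trans h₁₂).le, h₂.le⟩
  have hne : R.st 0 t₁ ≠ R.st 0 t₂ := fun he => h₁₂.ne (R.injective _ _ _ hm₁ _ hm₂ he).2
  have he : D.f (R.st 0 t₁) = D.f (R.st 0 t₂) := (h.eq_iff hm₁ hm₂).2 hc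
  obtain ⟨x, hx⟩ : ∃ x : D.Crossing, (x.upper = R.st 0 t₁ ∧ x.lower = R.st 0 t₂) ∨
      (x.lower = R.st 0 t₁ ∧ x.upper = R.st 0 t₂) := by
    by_cases ho : R.st 0 t₁ ∈ D.overSet
    · exact ⟨⟨_, _, hne, he, ho⟩, Or.inl ⟨rfl, rfl⟩⟩
    · exact ⟨⟨_, _, hne.symm, he.symm, (D.overSet_iff _ _ hne.symm he.symm).2 ho⟩,
        Or.inr ⟨rfl, rfl⟩⟩
  refine ⟨⟨fun _ p => if p then t₂ else t₁, fun _ => h₁, fun _ => h₁₂, fun _ => h₂, fun _ => x, kink,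
    by decide, fun a => ?_, fun y hy => ⟨0, ?_⟩⟩, rfl⟩
  · obtain rfl := Subsingleton.elim a 0
    exact hx
  · have hu : y.upper ∈ R.support := hy.elim id fun hy => h.mem_support_of_eq y.eq.symm hy
    obtain ⟨i, s, hs, hi⟩ := hu
    obtain ⟨j, t, ht, hj⟩ := h.mem_support_of_eq y.eq ⟨i, s, hs, hi⟩
    have he' := y.eq
    rw [hi, hj, h.eq_iff hs ht] at he'
    obtain rfl := Subsingleton.elim i 0
    obtain rfl := Subsingleton.elim j 0
    have hst : s ≠ t := fun hst => y.ne (by rw [hi, hj, hst])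
    have key : (y.upper = R.st 0 t₁ ∧ y.lower = R.st 0 t₂) ∨
        (y.lower = R.st 0 t₁ ∧ y.upper = R.st 0 t₂) := by
      rcases hst.lt_or_gt with hst | hst
      · obtain ⟨rfl, rfl⟩ := hc' s hs t ht hst he'
        exact Or.inl ⟨hi, hj⟩
      · obtain ⟨rfl, rfl⟩ := hc' t ht s hs hst he'.symm
        exact Or.inr ⟨hj, hi⟩
    -- In the two mixed cases one point would be upper for one crossing and lower for the other,
    -- which `overSet` forbids.
    rcases key with ⟨k1, k2⟩ | ⟨k1, k2⟩ <;> rcases hx with ⟨l1, l2⟩ | ⟨l1, l2⟩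
    · exact Diagram.Crossing.ext_of_upper (k1.trans l1.symm)
    · exact absurd (y.upper_mem) ((D.overSet_iff _ _ x.ne x.eq).1 x.upper_mem ∘
        fun hh => by rwa [l1, ← k1])
    · exact absurd (y.upper_mem) ((D.overSet_iff _ _ x.ne x.eq).1 x.upper_mem ∘
        fun hh => by rwa [l2, ← k2])
    · exact Diagram.Crossing.ext_of_upper (k2.trans l2.symm)

open LaurentPolynomial in
-- This identifies the factor produced by a kink with a power of -A, so that it can cancel against
-- the writhe factor.
theorem Diagram.val_negA_zpow_unit (ε : ℤˣ) :
    ((negA ^ (3 * (ε : ℤ)) : (LaurentPolynomial ℤ)ˣ) : LaurentPolynomial ℤ) = -T (3 * (ε : ℤ)) := by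
  rcases Int.units_eq_one_or ε with rfl | rfl
  · change ((negA ^ (3 : ℤ) : (LaurentPolynomial ℤ)ˣ) : LaurentPolynomial ℤ) = -T 3
    rw [show (3 : ℤ) = ((3 : ℕ) : ℤ) from rfl, zpow_natCast, Units.val_pow_eq_pow_val]
    simp [negA, Odd.neg_pow (by decide : Odd 3), T_pow]
  · change ((negA ^ (-3 : ℤ) : (LaurentPolynomial ℤ)ˣ) : LaurentPolynomial ℤ) = -T (-3)
    rw [show (-3 : ℤ) = -((3 : ℕ) : ℤ) from rfl, zpow_neg, zpow_natCast, ← inv_pow,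
      Units.val_pow_eq_pow_val]
    change (-T (-1)) ^ 3 = _
    simp [Odd.neg_pow (by decide : Odd 3), T_pow]

variable [T2Space S]

/-- A kink of sign ε multiplies the bracket by (-A)^(3ε) and raises the writhe by ε, so the
normalization (-A)^(-3w) compensates exactly. -/
theorem R1.kauffmanJones_eq {D D' : Diagram S m n} (H : R1 o D D') :
    D.kauffmanJones o = D'.kauffmanJones o := by
  obtain ⟨c, c', r, t₁, t₂, hc, h₁, h₁₂, h₂, he, hc'⟩ := H
  let t : TanglePresentation r.strands D 0 := r.drawnBy.emptyTangle
    fun i j s hs t ht h => ⟨Subsingleton.elim _ _, hc hs ht h⟩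
  obtain ⟨t', ht'⟩ := r.drawnBy'.exists_kinkTangle h₁ h₁₂ h₂ he hc'
  have hb := r.agreeOutside.bracket_eq_mul t t' _ fun P N N' hN _ h h' =>
    localSum_kink hN h (ht' ▸ h') (t.strandSign o) (t'.strandSign o)
  have hw := r.agreeOutside.writhe_sub_writhe t t'
  -- Both arcs of the crossing lie on one strand, so its direction enters twice and cancels.
  have hs : t'.strandSign o 0 = (t'.crossing 0).sign o := by
    rw [TanglePresentation.strandSign, Subsingleton.elim (t'.pos 0 false).1 (t'.pos 0 true).1,
      mul_assoc, Int.units_mul_self, mul_one]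
  simp only [Finset.univ_eq_empty, Finset.sum_empty, Fin.sum_univ_one, sub_zero, ← hs] at hw
  unfold Diagram.kauffmanJones
  rw [hb, hw, ← Diagram.val_negA_zpow_unit, ← mul_assoc, ← Units.val_mul, ← zpow_add]
  congr 4
  ring

/-- The same strand is on top at both crossings while the difference of slopes changes sign, so the
two crossings have opposite signs: the local sum collapses and the writhe is unchanged. -/
theorem R2.bracket_and_writhe_eq {D D' : Diagram S m n} (H : R2 o D D') :
    D.bracket o = D'.bracket o ∧ D.writhe o = D'.writhe o := by
  obtain ⟨g, g', r, height, t₁, t₂, hg, hg', hlt, h₁, h₁₂, h₂, hz, hh, hl⟩ := H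
  have hl' : Layered D' r.strands.st g' height := hl
  let t : TanglePresentation r.strands D 0 := r.drawnBy.emptyTangle (by
    intro i j s hs t ht he
    obtain ⟨rfl, he⟩ := Prod.ext_iff.1 he
    have h3 := hlt s hs
    simp only at he
    fin_cases i <;> fin_cases j <;> simp_all [h3.ne, h3.ne'])
  have hm₁ : t₁ ∈ Set.Ioo (-1 : ℝ) 1 := ⟨h₁, h₁₂.trans h₂⟩
  have hm₂ : t₂ ∈ Set.Ioo (-1 : ℝ) 1 := ⟨h₁.trans h₁₂, h₂⟩
  have e₁ := (hz t₁ (Set.Ioo_subset_Icc_self hm₁)).2 (Or.inl rfl)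
  have e₂ := (hz t₂ (Set.Ioo_subset_Icc_self hm₂)).2 (Or.inr rfl)
  have hcases : ∀ i j : Fin 2, i < j → i = 0 ∧ j = 1 := by decide
  let t' : TanglePresentation r.strands D' 2 := r.drawnBy'.graphTangle hl' hh
    (fun _ p => if p then t₂ else t₁) (fun _ => h₁) (fun _ => h₁₂) (fun _ => h₂) bigon (by decide)
    (by decide) (by intro a; fin_cases a <;> rfl)
    (by intro a; fin_cases a; exacts [e₁, e₂])
    (by
      intro i j hij t ht he
      obtain ⟨rfl, rfl⟩ : i = 0 ∧ j = 1 := hcases i j hij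
      rcases (hz t ht).1 he with rfl | rfl
      exacts [⟨0, rfl, rfl, rfl⟩, ⟨1, rfl, rfl, rfl⟩])
  -- The move fixes the ends of the strands, so strand 0 is still below strand 1 at both ends. This
  -- determines the slopes at the first and at the last meeting point.
  have hends : ∀ τ : ℤˣ, g' 0 ((τ : ℤ) : ℝ) < g' 1 ((τ : ℤ) : ℝ) := by
    intro τ
    have hend : ∀ i, g' i ((τ : ℤ) : ℝ) = g i ((τ : ℤ) : ℝ) := fun i =>
      (Prod.ext_iff.1 (r.curve_unit_eq i τ)).2
    rw [hend, hend]
    exact hlt _ (unit_mem_Icc τ)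
  have s₁ : t'.strandSign o 0 = if height 1 < height 0 then -1 else 1 :=
    r.drawnBy'.sign_graphCrossing_of_first hl' hh hg' (i := 0) (j := 1) (by decide) hm₁
      (Set.Ioo_subset_Icc_self hm₁) e₁
      (fun s hs he => by rcases (hz s hs).1 he with rfl | rfl; exacts [le_rfl, h₁₂.le])
      (by simpa using hends (-1))
  have s₂ : t'.strandSign o 1 = if height 1 < height 0 then 1 else -1 :=
    r.drawnBy'.sign_graphCrossing_of_last hl' hh hg' (i := 0) (j := 1) (by decide) hm₂
      (Set.Ioo_subset_Icc_self hm₂) e₂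
      (fun s hs he => by rcases (hz s hs).1 he with rfl | rfl; exacts [h₁₂.le, le_rfl])
      (by simpa using hends 1)
  have s₃ : t'.strandSign o 1 = -t'.strandSign o 0 := by
    rw [s₁, s₂]
    split_ifs <;> simp
  have hb := r.agreeOutside.bracket_eq_mul t t' 1 fun P N N' _ hN' h h' => by
    rw [one_mul]
    exact localSum_bigon hN' h h' (t.strandSign o) (t'.strandSign o) s₃
  have hw := r.agreeOutside.writhe_sub_writhe t t'
  refine ⟨by rw [hb, one_mul], ?_⟩
  have hsum : ∑ a, ((t'.crossing a).sign o : ℤ) = 0 := by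
    have h3 : (t'.crossing 1).sign o = -(t'.crossing 0).sign o := by
      rw [t'.sign_crossing, t'.sign_crossing, s₃]
      change -_ * r.strands.ς 0 * r.strands.ς 1 = -(_ * r.strands.ς 0 * r.strands.ς 1)
      simp
    rw [Fin.sum_univ_two, h3]
    simp
  rw [hw, hsum]
  simp

/-- Each pair of strands crosses once, starting in the same vertical order and with the same layers
before and after the move. So corresponding crossings have equal signs, and only the state sums over
the two triangles need comparison. -/
theorem R3.bracket_and_writhe_eq {D D' : Diagram S m n} (H : R3 o D D') :
    D.bracket o = D'.bracket o ∧ D.writhe o = D'.writhe o := by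
  obtain ⟨g, g', r, height, a, b, c, a', b', c', hg, hg', h₀₁, h₁₂, ha, hab, hbc, hc, hc', hcb',
    hba', ha', z₀₁, z₀₂, z₁₂, z₀₁', z₀₂', z₁₂', hh, hl, hl'⟩ := H
  have hl : Layered D r.strands.st g height := hl
  have hl' : Layered D' r.strands.st g' height := hl'
  have ma : a ∈ Set.Ioo (-1 : ℝ) 1 := ⟨by linarith, by linarith⟩
  have mb : b ∈ Set.Ioo (-1 : ℝ) 1 := ⟨by linarith, by linarith⟩
  have mc : c ∈ Set.Ioo (-1 : ℝ) 1 := ⟨by linarith, by linarith⟩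
  have ma' : a' ∈ Set.Ioo (-1 : ℝ) 1 := ⟨by linarith, by linarith⟩
  have mb' : b' ∈ Set.Ioo (-1 : ℝ) 1 := ⟨by linarith, by linarith⟩
  have mc' : c' ∈ Set.Ioo (-1 : ℝ) 1 := ⟨by linarith, by linarith⟩
  have ea := (z₀₁ a (Set.Ioo_subset_Icc_self ma)).2 rfl
  have eb := (z₀₂ b (Set.Ioo_subset_Icc_self mb)).2 rfl
  have ec := (z₁₂ c (Set.Ioo_subset_Icc_self mc)).2 rfl
  have ea' := (z₀₁' a' (Set.Ioo_subset_Icc_self ma')).2 rfl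
  have eb' := (z₀₂' b' (Set.Ioo_subset_Icc_self mb')).2 rfl
  have ec' := (z₁₂' c' (Set.Ioo_subset_Icc_self mc')).2 rfl
  have hcases : ∀ i j : Fin 3, i < j → (i = 0 ∧ j = 1) ∨ (i = 0 ∧ j = 2) ∨ (i = 1 ∧ j = 2) := by
    decide
  -- The marked times of strands 0, 1, 2 are (a, b), (a, c), (b, c), in order of occurrence; after
  -- the move they become (b', a'), (c', a'), (c', b').
  let t : TanglePresentation r.strands D 3 := r.drawnBy.graphTangle hl hh
    (fun i p => if p then ![b, c, c] i else ![a, a, b] i)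
    (by intro i; fin_cases i; exacts [ma.1, ma.1, mb.1])
    (by intro i; fin_cases i; exacts [hab, hab.trans hbc, hbc])
    (by intro i; fin_cases i; exacts [mb.2, mc.2, mc.2]) triangle (by decide)
    (by decide) (by intro a; fin_cases a <;> rfl)
    (by intro x; fin_cases x; exacts [ea, eb, ec])
    (by
      intro i j hij t ht he
      rcases hcases i j hij with ⟨rfl, rfl⟩ | ⟨rfl, rfl⟩ | ⟨rfl, rfl⟩
      · exact ⟨0, rfl, rfl, (z₀₁ t ht).1 he⟩
      · exact ⟨1, rfl, rfl, (z₀₂ t ht).1 he⟩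
      · exact ⟨2, rfl, rfl, (z₁₂ t ht).1 he⟩)
  let t' : TanglePresentation r.strands D' 3 := r.drawnBy'.graphTangle hl' hh
    (fun i p => if p then ![a', a', b'] i else ![b', c', c'] i)
    (by intro i; fin_cases i; exacts [mb'.1, mc'.1, mc'.1])
    (by intro i; fin_cases i; exacts [hba', hcb'.trans hba', hcb'])
    (by intro i; fin_cases i; exacts [ma'.2, ma'.2, mb'.2]) triangle' (by decide)
    (by decide) (by intro a; fin_cases a <;> rfl)
    (by intro x; fin_cases x; exacts [ea', eb', ec'])
    (by
      intro i j hij t ht he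
      rcases hcases i j hij with ⟨rfl, rfl⟩ | ⟨rfl, rfl⟩ | ⟨rfl, rfl⟩
      · exact ⟨0, rfl, rfl, (z₀₁' t ht).1 he⟩
      · exact ⟨1, rfl, rfl, (z₀₂' t ht).1 he⟩
      · exact ⟨2, rfl, rfl, (z₁₂' t ht).1 he⟩)
  have hend : ∀ i, g' i (-1) = g i (-1) := fun i => by
    simpa using (Prod.ext_iff.1 (r.curve_unit_eq i (-1))).2
  have h₀₁' : g' 0 (-1) < g' 1 (-1) := by rwa [hend, hend]
  have h₁₂' : g' 1 (-1) < g' 2 (-1) := by rwa [hend, hend]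
  have s₀ : t.strandSign o 0 = if height 1 < height 0 then -1 else 1 :=
    r.drawnBy.sign_graphCrossing_of_first hl hh hg (i := 0) (j := 1) (by decide) ma
      (Set.Ioo_subset_Icc_self ma) ea
      (fun s hs he => ((z₀₁ s hs).1 he).ge) h₀₁
  have s₁ : t.strandSign o 1 = if height 2 < height 0 then -1 else 1 :=
    r.drawnBy.sign_graphCrossing_of_first hl hh hg (i := 0) (j := 2) (by decide) mb
      (Set.Ioo_subset_Icc_self mb) eb
      (fun s hs he => ((z₀₂ s hs).1 he).ge) (h₀₁.trans h₁₂)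
  have s₂ : t.strandSign o 2 = if height 2 < height 1 then -1 else 1 :=
    r.drawnBy.sign_graphCrossing_of_first hl hh hg (i := 1) (j := 2) (by decide) mc
      (Set.Ioo_subset_Icc_self mc) ec
      (fun s hs he => ((z₁₂ s hs).1 he).ge) h₁₂
  have s₀' : t'.strandSign o 0 = if height 1 < height 0 then -1 else 1 :=
    r.drawnBy'.sign_graphCrossing_of_first hl' hh hg' (i := 0) (j := 1) (by decide) ma'
      (Set.Ioo_subset_Icc_self ma') ea'
      (fun s hs he => ((z₀₁' s hs).1 he).ge) h₀₁'
  have s₁' : t'.strandSign o 1 = if height 2 < height 0 then -1 else 1 :=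
    r.drawnBy'.sign_graphCrossing_of_first hl' hh hg' (i := 0) (j := 2) (by decide) mb'
      (Set.Ioo_subset_Icc_self mb') eb'
      (fun s hs he => ((z₀₂' s hs).1 he).ge) (h₀₁'.trans h₁₂')
  have s₂' : t'.strandSign o 2 = if height 2 < height 1 then -1 else 1 :=
    r.drawnBy'.sign_graphCrossing_of_first hl' hh hg' (i := 1) (j := 2) (by decide) mc'
      (Set.Ioo_subset_Icc_self mc') ec'
      (fun s hs he => ((z₁₂' s hs).1 he).ge) h₁₂'
  have hε : t'.strandSign o = t.strandSign o := by
    funext x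
    fin_cases x
    exacts [s₀'.trans s₀.symm, s₁'.trans s₁.symm, s₂'.trans s₂.symm]
  -- The excluded sign pattern would make the heights cyclic, such as h₁ < h₀, h₂ < h₁ and h₀ < h₂,
  -- which is impossible for strands in layers.
  have hcyc : ¬ (t.strandSign o 0 = t.strandSign o 2 ∧ t.strandSign o 0 = -t.strandSign o 1) := by
    have hne : (1 : ℤˣ) ≠ -1 := by decide
    rw [s₀, s₁, s₂]
    have n₀₁ := hh.ne (show (0 : Fin 3) ≠ 1 by decide)
    have n₀₂ := hh.ne (show (0 : Fin 3) ≠ 2 by decide)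
    have n₁₂ := hh.ne (show (1 : Fin 3) ≠ 2 by decide)
    split_ifs <;> simp [hne, hne.symm] <;> omega
  have hb := r.agreeOutside.bracket_eq_mul t t' 1 fun P N N' hN hN' h h' => by
    rw [one_mul, hε]
    exact localSum_triangle hN hN' h h' (t.strandSign o) hcyc
  have hw := r.agreeOutside.writhe_sub_writhe t t'
  refine ⟨by rw [hb, one_mul], ?_⟩
  have hsum : ∀ x, (t'.crossing x).sign o = (t.crossing x).sign o := by
    intro x
    rw [t'.sign_crossing, t.sign_crossing, hε]
    fin_cases x <;> rfl
  simp only [hsum, sub_self, add_zero] at hw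
  exact hw.symm

/-! ### Invariance of the polynomials -/

theorem RegularStep.bracket_eq {D D' : AnyDiagram S} (h : RegularStep o D D') :
    D.2.2.bracket o = D'.2.2.bracket o := by
  cases h with
  | same D D' h => exact h.bracket_eq o
  | isotopy D D' h => exact (h.germIso o).1.bracket_eq
  | r2 D D' h => exact h.bracket_and_writhe_eq.1
  | r3 D D' h => exact h.bracket_and_writhe_eq.1

theorem OrientedStep.kauffmanJones_eq {D D' : AnyDiagram S} (h : OrientedStep o D D') :
    D.2.2.kauffmanJones o = D'.2.2.kauffmanJones o := by
  cases h with
  | same D D' h => exact h.kauffmanJones_eq o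
  | isotopy D D' h => exact (h.germIso o).1.kauffmanJones_eq (h.germIso o).2
  | r1 D D' h => exact h.kauffmanJones_eq
  | r2 D D' h =>
    obtain ⟨hb, hw⟩ := h.bracket_and_writhe_eq
    simp only [Diagram.kauffmanJones, hb, hw]
  | r3 D D' h =>
    obtain ⟨hb, hw⟩ := h.bracket_and_writhe_eq
    simp only [Diagram.kauffmanJones, hb, hw]

end Surface

end Moves

end GenLink

end

theorem theorem1p3 {S : Type*} [TopologicalSpace S] [T2Space S]
    [ChartedSpace (EuclideanHalfSpace 2) S] [IsManifold (𝓡∂ 2) ∞ S]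
    (o : GenLink.SurfaceOrientation S) :
    (∀ (m n m' n' : ℕ) (D : GenLink.Diagram S m n) (D' : GenLink.Diagram S m' n'),
      GenLink.RegularlyEquivalent o ⟨m, n, D⟩ ⟨m', n', D'⟩ → D.bracket o = D'.bracket o) ∧
    (∀ (m n m' n' : ℕ) (D : GenLink.Diagram S m n) (D' : GenLink.Diagram S m' n'),
      GenLink.OrientedEquivalent o ⟨m, n, D⟩ ⟨m', n', D'⟩ →
        D.kauffmanJones o = D'.kauffmanJones o) := by
  constructor
  · intro m n m' n' D D' h
    have key : ∀ E E' : GenLink.AnyDiagram S, GenLink.RegularlyEquivalent o E E' →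
        E.2.2.bracket o = E'.2.2.bracket o := by
      intro E E' h
      induction h with
      | rel _ _ h => exact h.bracket_eq
      | refl => rfl
      | symm _ _ _ ih => exact ih.symm
      | trans _ _ _ _ _ ih ih' => exact ih.trans ih'
    exact key ⟨m, n, D⟩ ⟨m', n', D'⟩ h
  · intro m n m' n' D D' h
    have key : ∀ E E' : GenLink.AnyDiagram S, GenLink.OrientedEquivalent o E E' →
        E.2.2.kauffmanJones o = E'.2.2.kauffmanJones o := by
      intro E E' h
      induction h with
      | rel _ _ h => exact h.kauffmanJones_eq
      | refl => rfl
      | symm _ _ _ ih => exact ih.symm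
      | trans _ _ _ _ _ ih ih' => exact ih.trans ih'
    exact key ⟨m, n, D⟩ ⟨m', n', D'⟩ h
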